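/- **Setting.** Let $(W,A,L,Y,C^L,C^Y)$ be the data of one trial participant: baseline variables $W$, study arm $A\in\{0,1\}$, short-term outcome $L$ ($W$ and $L$ take values in arbitrary measurable spaces; in particular $L$ may be binary), real primary outcome $Y$ with $E(Y^2)<\infty$, and indicators $C^L,C^Y\in\{0,1\}$ that $L$, respectively $Y$, has been observed at the analysis time. The observed data of the participant are $O=(W,A)$ together with $L$ if $C^L=1$ and $Y$ if $C^Y=1$; the sample $O_1,\dots,O_n$ is i.i.d. Fix a randomization probability $\rho\in(0,1)$. The semiparametric model consists of all laws $P$ of $(W,A,L,Y,C^L,C^Y)$ with $E(Y^2)<\infty$ such that (1) $A$ is independent of $W$ and $P(A=1)=\rho$; (2) $(C^L,C^Y)$ is independent of $(W,A,L,Y)$; (3) $C^L\ge C^Y$ almost surely. Write $p_a=P(A=a)$, $p_l=P(C^L=1)$, $p_y=P(C^Y=1)$; let $E_a,\mathrm{Var}_a$ denote (conditional) expectation and variance given $A=a$, and put $$R^2_{W;a}=\frac{\mathrm{Var}\{E_a(Y\mid W)\}}{\mathrm{Var}_a(Y)},\qquad R^2_{L\mid W;a}=\frac{\mathrm{Var}_a\{E_a(Y\mid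 L,W)-E_a(Y\mid W)\}}{\mathrm{Var}_a(Y)}.$$ **Efficiency.** A regular parametric submodel through $P$ is a path $t\mapsto P_t$ with $P_0=P$, lying in the model for $t$ near $0$, whose observed-data laws are, near $t=0$, dominated by a common $\sigma$-finite measure, and are differentiable in quadratic mean at $t=0$ with a score $g$ such that $0<E_P\{g(O)^2\}<\infty$, and with $E_{P_t}(Y^2)$ bounded for $t$ near $0$. The semiparametric lower bound at $P$ for estimating $E(Y\mid A=a)$ is the supremum of the Cramér–Rao bounds $\{\tfrac{d}{dt}E_{P_t}(Y\mid A=a)|_{t=0}\}^2/E_P\{g(O)^2\}$ over all such submodels (for which the derivative exists). An estimator $T_n=T_n(O_1,\dots,O_n)$ is RAL at $P$ if $\sqrt n\{T_n-E_P(Y\mid A=a)\}=n^{-1/2}\sum_i\varphi(O_i)+o_P(1)$ for some $\varphi$ with $E_P\{\varphi(O)\}=0$, $E_P\{\varphi(O)^2\}<\infty$, and if along every regular parametric submodel and for every $h\in\mathbb R$ the law of $\sqrt n\{T_n-E_{P_{h/\sqrt n}}(Y\mid A=a)\}$ under $P_{h/\sqrt n}$ converges weakly to a limit not depending on the submodel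 or on $h$. Its asymptotic variance $\mathrm{AVar}$ is the $\sigma^2$ for which $\sqrt n\{T_n-E_P(Y\mid A=a)\}\to N(0,\sigma^2)$ in distribution under $P$; it is efficient at $P$ if $\mathrm{AVar}$ equals the semiparametric lower bound at $P$. The asymptotic relative efficiency is $\mathrm{ARE}(T,T')=\mathrm{AVar}(T')/\mathrm{AVar}(T)$. The unadjusted estimator of $E(Y\mid A=a)$ is $$\frac{\sum_{i=1}^n Y_i\,\mathbf 1(A_i=a,\,C^Y_i=1)}{\sum_{i=1}^n \mathbf 1(A_i=a,\,C^Y_i=1)}.$$ **Theorem.** Let $P$ belong to the model, and suppose $p_y>0$. Then for each arm $a\in\{0,1\}$ with $\mathrm{Var}_a(Y)>0$, and each RAL estimator of $E(Y\mid A=a)$ that is efficient at $P$, the asymptotic variance of the unadjusted estimator exists, that of the efficient estimator is nonzero, and the asymptotic relative efficiency between the efficient estimator and the unadjusted estimator equals $$\frac{1}{1-(1-p_ap_y)\,R^2_{W;a}-(1-p_y/p_l)\,R^2_{L\mid W;a}} .$$ -/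

import Mathlib

open MeasureTheory ProbabilityTheory Filter Topology
open scoped NNReal ENNReal

namespace TrialARE

/-! ### Data -/

/-- Full data `(W, A, L, Y, C^L, C^Y)` of one participant: baseline variables, study arm
(`true` is treatment, `false` is control), short-term outcome, primary outcome, and the indicators
that the short-term and the primary outcome have been observed at the analysis time. -/
abbrev FullData (𝒲 ℒ : Type*) : Type _ := 𝒲 × Bool × ℒ × ℝ × Bool × Bool

/-- Observed data of one participant: `(W, A)`, the short-term outcome if it has been observed, and
the primary outcome if it has been observed (`Sum.inr ()` stands for "missing"). -/
abbrev ObsData (𝒲 ℒ : Type*) : Type _ := 𝒲 × Bool × (ℒ ⊕ Unit) × (ℝ ⊕ Unit)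

section Coordinates

variable {𝒲 ℒ : Type*}

def baseline (x : FullData 𝒲 ℒ) : 𝒲 := x.1
def arm (x : FullData 𝒲 ℒ) : Bool := x.2.1
def shortTerm (x : FullData 𝒲 ℒ) : ℒ := x.2.2.1
def outcome (x : FullData 𝒲 ℒ) : ℝ := x.2.2.2.1
def seenL (x : FullData 𝒲 ℒ) : Bool := x.2.2.2.2.1
def seenY (x : FullData 𝒲 ℒ) : Bool := x.2.2.2.2.2

/-- What is observed of a participant. -/
def observe (x : FullData 𝒲 ℒ) : ObsData 𝒲 ℒ :=
  (baseline x, arm x,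
    if seenL x = true then Sum.inl (shortTerm x) else Sum.inr (),
    if seenY x = true then Sum.inl (outcome x) else Sum.inr ())

variable [MeasurableSpace 𝒲] [MeasurableSpace ℒ]

theorem measurable_observe : Measurable (observe (𝒲 := 𝒲) (ℒ := ℒ)) := by
  have hL : MeasurableSet {x : FullData 𝒲 ℒ | seenL x = true} := by
    have h : Measurable (seenL (𝒲 := 𝒲) (ℒ := ℒ)) := by unfold seenL; fun_prop
    exact h (measurableSet_singleton true)
  have hY : MeasurableSet {x : FullData 𝒲 ℒ | seenY x = true} := by
    have h : Measurable (seenY (𝒲 := 𝒲) (ℒ := ℒ)) := by unfold seenY; fun_prop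
    exact h (measurableSet_singleton true)
  have h1 : Measurable (baseline (𝒲 := 𝒲) (ℒ := ℒ)) := by unfold baseline; fun_prop
  have h2 : Measurable (arm (𝒲 := 𝒲) (ℒ := ℒ)) := by unfold arm; fun_prop
  have h3 : Measurable (shortTerm (𝒲 := 𝒲) (ℒ := ℒ)) := by unfold shortTerm; fun_prop
  have h4 : Measurable (outcome (𝒲 := 𝒲) (ℒ := ℒ)) := by unfold outcome; fun_prop
  exact h1.prodMk (h2.prodMk
    ((Measurable.ite hL (measurable_inl.comp h3) measurable_const).prodMk
      (Measurable.ite hY (measurable_inl.comp h4) measurable_const)))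

end Coordinates

noncomputable section

variable {𝒲 ℒ : Type*} [MeasurableSpace 𝒲] [MeasurableSpace ℒ]

/-! ### The semiparametric model -/

/-- The semiparametric model. It is nonparametric except for: randomization with probability `ρ` of
the treatment arm, independent censoring, and monotone censoring (`false ≤ true` on `Bool`). The
primary outcome has a finite second moment, so that its variances exist. -/
structure InModel (ρ : ℝ) (P : ProbabilityMeasure (FullData 𝒲 ℒ)) : Prop where
  randomization_indep : IndepFun arm baseline (P : Measure (FullData 𝒲 ℒ))
  randomization_prob : (P : Measure (FullData 𝒲 ℒ)).real {x | arm x = true} = ρ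
  independent_censoring :
    IndepFun (fun x => (seenL x, seenY x))
      (fun x => (baseline x, arm x, shortTerm x, outcome x)) (P : Measure (FullData 𝒲 ℒ))
  monotone_censoring : ∀ᵐ x ∂(P : Measure (FullData 𝒲 ℒ)), seenY x ≤ seenL x
  memLp_outcome : MemLp outcome 2 (P : Measure (FullData 𝒲 ℒ))

/-- The law of the observed data of one participant. -/
def obsLaw (P : ProbabilityMeasure (FullData 𝒲 ℒ)) : ProbabilityMeasure (ObsData 𝒲 ℒ) :=
  P.map measurable_observe.aemeasurable

/-- The law of the observed data of `n` independent and identically distributed participants. -/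
def sampleLaw (P : ProbabilityMeasure (FullData 𝒲 ℒ)) (n : ℕ) :
    ProbabilityMeasure (Fin n → ObsData 𝒲 ℒ) :=
  ⟨Measure.pi fun _ => (obsLaw P : Measure (ObsData 𝒲 ℒ)), inferInstance⟩

/-! ### Population quantities -/

/-- `p_a = P(A = a)`. -/
def armProb (P : ProbabilityMeasure (FullData 𝒲 ℒ)) (a : Bool) : ℝ :=
  (P : Measure (FullData 𝒲 ℒ)).real {x | arm x = a}

/-- `p_l = P(C^L = 1)`. -/
def probL (P : ProbabilityMeasure (FullData 𝒲 ℒ)) : ℝ :=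
  (P : Measure (FullData 𝒲 ℒ)).real {x | seenL x = true}

/-- `p_y = P(C^Y = 1)`. -/
def probY (P : ProbabilityMeasure (FullData 𝒲 ℒ)) : ℝ :=
  (P : Measure (FullData 𝒲 ℒ)).real {x | seenY x = true}

/-- The conditional law of the full data given `A = a`. -/
def armLaw (P : ProbabilityMeasure (FullData 𝒲 ℒ)) (a : Bool) : Measure (FullData 𝒲 ℒ) :=
  ProbabilityTheory.cond (P : Measure (FullData 𝒲 ℒ)) {x | arm x = a}

/-- The estimand, the treatment specific mean `E(Y | A = a)`. -/
def armMean (P : ProbabilityMeasure (FullData 𝒲 ℒ)) (a : Bool) : ℝ :=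
  ∫ x, outcome x ∂(armLaw P a)

/-- `Var_a(X) = Var(X | A = a)`. -/
def armVar (P : ProbabilityMeasure (FullData 𝒲 ℒ)) (a : Bool) (X : FullData 𝒲 ℒ → ℝ) : ℝ :=
  variance X (armLaw P a)

/-- `E_a(Y | W) = E(Y | W, A = a)`. It is measurable with respect to `W`. -/
def regW (P : ProbabilityMeasure (FullData 𝒲 ℒ)) (a : Bool) : FullData 𝒲 ℒ → ℝ :=
  condExp (MeasurableSpace.comap (baseline (𝒲 := 𝒲) (ℒ := ℒ)) inferInstance) (armLaw P a) outcome

/-- `E_a(Y | L, W) = E(Y | L, W, A = a)`. -/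
def regLW (P : ProbabilityMeasure (FullData 𝒲 ℒ)) (a : Bool) : FullData 𝒲 ℒ → ℝ :=
  condExp
    (MeasurableSpace.comap (fun x : FullData 𝒲 ℒ => (shortTerm x, baseline x)) inferInstance)
    (armLaw P a) outcome

/-- `R²_{W;a} = Var{E_a(Y | W)} / Var_a(Y)`, with the variance in the numerator taken under the
law of `W` in the whole population. -/
def rsqW (P : ProbabilityMeasure (FullData 𝒲 ℒ)) (a : Bool) : ℝ :=
  variance (regW P a) (P : Measure (FullData 𝒲 ℒ)) / armVar P a outcome

/-- `R²_{L|W;a} = Var_a{E_a(Y | L, W) - E_a(Y | W)} / Var_a(Y)`. -/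
def rsqLW (P : ProbabilityMeasure (FullData 𝒲 ℒ)) (a : Bool) : ℝ :=
  armVar P a (fun x => regLW P a x - regW P a x) / armVar P a outcome

/-! ### Regular parametric submodels and the semiparametric variance bound -/

/-- The square root of the density of the observed data law with respect to `μ`. -/
def rootDensity (P : ProbabilityMeasure (FullData 𝒲 ℒ)) (μ : Measure (ObsData 𝒲 ℒ))
    (o : ObsData 𝒲 ℒ) : ℝ :=
  Real.sqrt (((obsLaw P : Measure (ObsData 𝒲 ℒ)).rnDeriv μ o).toReal)

/-- `Pt` is a regular one-dimensional parametric submodel through `P`, with score `g` at `P`: it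
lies in the model, the laws of the observed data are dominated by a σ-finite measure and
differentiable in quadratic mean at `t = 0` with score `g`, the Fisher information `∫ g²` is
positive and finite, and the second moment of `Y` stays bounded near `t = 0` (without such a bound
`E(Y | A = a)` need not be differentiable along the submodel). -/
structure IsRegularSubmodel (ρ : ℝ) (P : ProbabilityMeasure (FullData 𝒲 ℒ))
    (Pt : ℝ → ProbabilityMeasure (FullData 𝒲 ℒ)) (g : ObsData 𝒲 ℒ → ℝ) : Prop where
  at_zero : Pt 0 = P
  mem_model : ∀ᶠ t in 𝓝 (0 : ℝ), InModel ρ (Pt t)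
  moment_bound : ∃ C : ℝ≥0, ∀ᶠ t in 𝓝 (0 : ℝ),
    ∫⁻ x, ENNReal.ofReal (outcome x ^ 2) ∂(Pt t : Measure (FullData 𝒲 ℒ)) ≤ C
  memLp_score : MemLp g 2 (obsLaw P : Measure (ObsData 𝒲 ℒ))
  information_pos : 0 < ∫ o, g o ^ 2 ∂(obsLaw P : Measure (ObsData 𝒲 ℒ))
  differentiable_qm : ∃ μ : Measure (ObsData 𝒲 ℒ), SigmaFinite μ ∧
    (∀ᶠ t in 𝓝 (0 : ℝ), (obsLaw (Pt t) : Measure (ObsData 𝒲 ℒ)) ≪ μ) ∧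
    Tendsto (fun t : ℝ => ∫⁻ o, ENNReal.ofReal
        (((rootDensity (Pt t) μ o - rootDensity P μ o) / t
          - 1 / 2 * g o * rootDensity P μ o) ^ 2) ∂μ)
      (𝓝[≠] (0 : ℝ)) (𝓝 0)

/-- The semiparametric lower bound on the asymptotic variance for `E(Y | A = a)` at `P`: the
supremum, over all regular parametric submodels through `P`, of the Cramér–Rao bounds
`(d/dt E_{P_t}(Y | A = a) at 0)² / (Fisher information at 0)`. -/
def varianceBound (ρ : ℝ) (P : ProbabilityMeasure (FullData 𝒲 ℒ)) (a : Bool) : ℝ≥0∞ :=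
  ⨆ (Pt : ℝ → ProbabilityMeasure (FullData 𝒲 ℒ)) (g : ObsData 𝒲 ℒ → ℝ) (d : ℝ)
    (_ : IsRegularSubmodel ρ P Pt g) (_ : HasDerivAt (fun t => armMean (Pt t) a) d 0),
    ENNReal.ofReal (d ^ 2 / ∫ o, g o ^ 2 ∂(obsLaw P : Measure (ObsData 𝒲 ℒ)))

/-! ### Estimators -/

/-- An estimator: for each sample size, a function of the observed data of the participants. -/
abbrev Estimator (𝒲 ℒ : Type*) : Type _ := (n : ℕ) → (Fin n → ObsData 𝒲 ℒ) → ℝ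

/-- Asymptotic variance: `√n (T_n - E(Y | A = a))` converges in distribution to `N(0, v)` under
`P`. -/
def HasAsymptoticVariance (a : Bool) (P : ProbabilityMeasure (FullData 𝒲 ℒ))
    (T : Estimator 𝒲 ℒ) (v : ℝ≥0) : Prop :=
  TendstoInDistribution (fun (n : ℕ) (o : Fin n → ObsData 𝒲 ℒ) =>
      Real.sqrt n * (T n o - armMean P a)) atTop (id : ℝ → ℝ)
    (fun n => (sampleLaw P n : Measure (Fin n → ObsData 𝒲 ℒ))) (gaussianReal 0 v)

/-- Asymptotic linearity at `P`: for some influence function `φ`,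
`√n (T_n - E(Y | A = a)) - n^{-1/2} ∑ φ(O_i)` converges to `0` in probability under `P`. -/
def IsAsymptoticallyLinear (a : Bool) (P : ProbabilityMeasure (FullData 𝒲 ℒ))
    (T : Estimator 𝒲 ℒ) : Prop :=
  ∃ φ : ObsData 𝒲 ℒ → ℝ, MemLp φ 2 (obsLaw P : Measure (ObsData 𝒲 ℒ)) ∧
    ∫ o, φ o ∂(obsLaw P : Measure (ObsData 𝒲 ℒ)) = 0 ∧
    ∀ ε : ℝ, 0 < ε → Tendsto (fun n : ℕ =>
      (sampleLaw P n : Measure (Fin n → ObsData 𝒲 ℒ))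
        {o | ε ≤ |Real.sqrt n * (T n o - armMean P a) - (Real.sqrt n)⁻¹ * ∑ i, φ (o i)|})
      atTop (𝓝 0)

/-- Regularity at `P`: along every regular parametric submodel and for every local parameter `h`,
`√n (T_n - E_{P_{h/√n}}(Y | A = a))` converges in distribution under `P_{h/√n}`, to one and the
same limit law. -/
def IsRegularEstimator (ρ : ℝ) (a : Bool) (P : ProbabilityMeasure (FullData 𝒲 ℒ))
    (T : Estimator 𝒲 ℒ) : Prop :=
  ∃ ν : ProbabilityMeasure ℝ,
    ∀ (Pt : ℝ → ProbabilityMeasure (FullData 𝒲 ℒ)) (g : ObsData 𝒲 ℒ → ℝ),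
      IsRegularSubmodel ρ P Pt g → ∀ h : ℝ,
        TendstoInDistribution (fun (n : ℕ) (o : Fin n → ObsData 𝒲 ℒ) =>
            Real.sqrt n * (T n o - armMean (Pt (h / Real.sqrt n)) a)) atTop (id : ℝ → ℝ)
          (fun n => (sampleLaw (Pt (h / Real.sqrt n)) n : Measure (Fin n → ObsData 𝒲 ℒ)))
          (ν : Measure ℝ)

/-- Regular, asymptotically linear (RAL) estimators of `E(Y | A = a)` at `P`. -/
structure IsRAL (ρ : ℝ) (a : Bool) (P : ProbabilityMeasure (FullData 𝒲 ℒ))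
    (T : Estimator 𝒲 ℒ) : Prop where
  measurable : ∀ n, Measurable (T n)
  asymptoticallyLinear : IsAsymptoticallyLinear a P T
  regular : IsRegularEstimator ρ a P T

/-- Efficient RAL estimators at `P`: the asymptotic variance achieves the semiparametric lower
bound. -/
def IsEfficientRAL (ρ : ℝ) (a : Bool) (P : ProbabilityMeasure (FullData 𝒲 ℒ))
    (T : Estimator 𝒲 ℒ) : Prop :=
  IsRAL ρ a P T ∧
    ∃ v : ℝ≥0, HasAsymptoticVariance a P T v ∧ (v : ℝ≥0∞) = varianceBound ρ P a

/-- The unadjusted estimator of `E(Y | A = a)`: the sample mean of `Y` over the participants in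
arm `a` whose primary outcome has been observed. -/
def unadjusted (a : Bool) : Estimator 𝒲 ℒ := fun n o =>
  (∑ i : Fin n, if (o i).2.1 = a then Sum.elim id (fun _ => (0 : ℝ)) (o i).2.2.2 else 0) /
    ∑ i : Fin n, if (o i).2.1 = a then Sum.elim (fun _ => (1 : ℝ)) (fun _ => 0) (o i).2.2.2 else 0

/-- The asymptotic relative efficiency `ARE(T₁, T₂) = AVar(T₂) / AVar(T₁)` exists and equals `r`. -/
def HasARE (a : Bool) (P : ProbabilityMeasure (FullData 𝒲 ℒ)) (T₁ T₂ : Estimator 𝒲 ℒ)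
    (r : ℝ) : Prop :=
  ∃ v₁ v₂ : ℝ≥0, HasAsymptoticVariance a P T₁ v₁ ∧ HasAsymptoticVariance a P T₂ v₂ ∧
    v₁ ≠ 0 ∧ r = (v₂ : ℝ) / (v₁ : ℝ)

end

end TrialARE

open TrialARE

namespace TrialARE

/-! ### Differentiation under differentiability in quadratic mean -/

/-! Write `m` for $E_a(Y\mid W)$, `r` for $E_a(Y\mid L,W)$ and $\psi$ for $E_a(Y)$. Everything rests
on the efficient influence function
$$D=\frac{C^Y1(A=a)}{p_ap_y}(Y-r)+\frac{C^L1(A=a)}{p_ap_l}(r-m)+(m-\psi).$$ Its three terms are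
orthogonal, so with $T_3=E_a(Y-r)^2$, $T_2=E_a(r-m)^2$ and $T_1=\mathrm{Var}(m)$ one gets
$E(D^2)=T_3/(p_ap_y)+T_2/(p_ap_l)+T_1$ (`IsRegression.integral_influence_sq`). The unadjusted
estimator is a ratio of sample means with asymptotic variance $\mathrm{Var}_a(Y)/(p_ap_y)$
(`hasAsymptoticVariance_unadjusted`). Since $\mathrm{Var}_a(Y)=T_1+T_2+T_3$, the quotient of the two
variances is the stated formula, once the semiparametric bound is known to be $E(D^2)$
(`varianceBound_eq`).

The bound is at most $E(D^2)$: along a regular submodel with score $g$ the derivative of the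
estimand is $E(Dg)$ (`IsRegularSubmodel.deriv_armMean_eq`), and Cauchy–Schwarz applies. No tangent
space is computed. Instead, the moment identities that randomization and independent censoring
impose on every law of the model are differentiated along the path, and $E(Dg)$ is a linear
combination of the results. Differentiation under the integral uses quadratic mean differentiability
and a local bound on second moments (`hasDerivAt_integral_mul_sq`).

The bound is at least $E(D^2)$: the full-data law is tilted by $1+ts$, where $s$ is $D$ without its
censoring indicators. Independent censoring survives because $s$ does not involve $C^L,C^Y$;
randomization survives because $E(s\mid A,W)$ is a function of $W$; and $E(s\mid O)=D$, so the
observed-data law is tilted by $1+tD$. A tilt needs a bounded $s$, so $Y$ is first clipped to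
$[-k,k]$, which gives an influence function $D_k$ as score and the Cramér–Rao bound
$E(DD_k)^2/E(D_k^2)$; it tends to $E(D^2)$ because $D_k\to D$ in $L^2$. -/

theorem sq_integral_mul_le {α : Type*} [MeasurableSpace α] {μ : Measure α} {u v : α → ℝ}
    (hu : MemLp u 2 μ) (hv : MemLp v 2 μ) :
    (∫ x, u x * v x ∂μ) ^ 2 ≤ (∫ x, u x ^ 2 ∂μ) * ∫ x, v x ^ 2 ∂μ := by
  have huv : Integrable (fun x => u x * v x) μ := hu.integrable_mul hv
  -- The quadratic polynomial $s\mapsto\int(su+v)^2$ is nonnegative, so its discriminant is at most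
  -- zero.
  have key : ∀ s : ℝ, 0 ≤ (∫ x, u x ^ 2 ∂μ) * (s * s) + (2 * ∫ x, u x * v x ∂μ) * s
      + ∫ x, v x ^ 2 ∂μ := by
    intro s
    have h0 : 0 ≤ ∫ x, (s * u x + v x) ^ 2 ∂μ := integral_nonneg fun x => sq_nonneg _
    have h1 : ∫ x, (s * u x + v x) ^ 2 ∂μ
        = ∫ x, ((s * s) * u x ^ 2 + (2 * s) * (u x * v x)) + v x ^ 2 ∂μ := by
      congr 1 with x; ring
    have i1 : Integrable (fun x => (s * s) * u x ^ 2 + (2 * s) * (u x * v x)) μ :=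
      (hu.integrable_sq.const_mul _).add (huv.const_mul _)
    rw [h1, integral_add i1 hv.integrable_sq,
      integral_add (hu.integrable_sq.const_mul _) (huv.const_mul _), integral_const_mul,
      integral_const_mul] at h0
    linarith
  have := discrim_le_zero key
  unfold discrim at this
  nlinarith

theorem abs_integral_mul_le {α : Type*} [MeasurableSpace α] {μ : Measure α} {u v : α → ℝ}
    (hu : MemLp u 2 μ) (hv : MemLp v 2 μ) :
    |∫ x, u x * v x ∂μ| ≤ √(∫ x, u x ^ 2 ∂μ) * √(∫ x, v x ^ 2 ∂μ) := by
  rw [← Real.sqrt_mul (integral_nonneg fun x => sq_nonneg _)]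
  exact Real.abs_le_sqrt (sq_integral_mul_le hu hv)

theorem integral_sq_add_le {α : Type*} [MeasurableSpace α] {μ : Measure α} {u v : α → ℝ}
    (hu : MemLp u 2 μ) (hv : MemLp v 2 μ) :
    ∫ x, (u x + v x) ^ 2 ∂μ ≤ 2 * (∫ x, u x ^ 2 ∂μ) + 2 * ∫ x, v x ^ 2 ∂μ := by
  rw [← integral_const_mul, ← integral_const_mul, ← integral_add (hu.integrable_sq.const_mul _)
    (hv.integrable_sq.const_mul _)]
  refine integral_mono (hu.add hv).integrable_sq
    ((hu.integrable_sq.const_mul _).add (hv.integrable_sq.const_mul _)) fun x => ?_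
  simp only
  nlinarith [sq_nonneg (u x - v x)]

/-- If `k t → 0` in `L²` while `f * k t` stays bounded in `L²`, then `f * k t → 0` weakly. -/
theorem tendsto_integral_mul_mul_zero {α ι : Type*} [MeasurableSpace α] {μ : Measure α}
    {l : Filter ι} {f w : α → ℝ} {k : ι → α → ℝ} {C : ℝ} (hf : Measurable f)
    (hw : MemLp w 2 μ) (hk : ∀ᶠ t in l, MemLp (k t) 2 μ)
    (hfk : ∀ᶠ t in l, MemLp (fun x => f x * k t x) 2 μ)
    (hC : ∀ᶠ t in l, ∫ x, (f x * k t x) ^ 2 ∂μ ≤ C)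
    (hk0 : Tendsto (fun t => ∫ x, k t x ^ 2 ∂μ) l (𝓝 0)) :
    Tendsto (fun t => ∫ x, f x * k t x * w x ∂μ) l (𝓝 0) := by
  -- Truncation of `f` at level `M`. Where $|f|\le M$ the factor `f` costs at most `M` and `k t` is
  -- small in $L^2$; elsewhere `f * k t` is only bounded, by `√C`, but the part of `w` living there
  -- has small norm for large `M`.
  set s : ℕ → Set α := fun M => {x | |f x| ≤ M} with hs
  have hsm : ∀ M, MeasurableSet (s M) := fun M => measurableSet_le hf.abs measurable_const
  have htail : Tendsto (fun M : ℕ => ∫ x, ((s M)ᶜ.indicator w x) ^ 2 ∂μ) atTop (𝓝 0) := by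
    have : Tendsto (fun M : ℕ => ∫ x, ((s M)ᶜ.indicator w x) ^ 2 ∂μ) atTop
        (𝓝 (∫ x, (0 : ℝ) ∂μ)) := by
      refine tendsto_integral_of_dominated_convergence (fun x => w x ^ 2) ?_ hw.integrable_sq ?_ ?_
      · intro M
        exact (hw.indicator (hsm M).compl).integrable_sq.aestronglyMeasurable
      · intro M
        refine ae_of_all _ fun x => ?_
        by_cases hx : x ∈ (s M)ᶜ <;> simp [hx, sq_nonneg]
      · refine ae_of_all _ fun x => ?_
        obtain ⟨M0, hM0⟩ := exists_nat_ge |f x|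
        refine tendsto_const_nhds.congr' ?_
        filter_upwards [eventually_ge_atTop M0] with M hM
        have : x ∈ s M := hM0.trans (by exact_mod_cast hM)
        simp [this]
    simpa using this
  rw [Metric.tendsto_nhds]
  intro ε hε
  have htail' : Tendsto (fun M : ℕ => √C * √(∫ x, ((s M)ᶜ.indicator w x) ^ 2 ∂μ)) atTop (𝓝 0) := by
    simpa using (htail.sqrt).const_mul (√C)
  obtain ⟨M, hM⟩ := (htail'.eventually_lt_const (half_pos hε)).exists
  have hhead : Tendsto (fun t => M * √(∫ x, k t x ^ 2 ∂μ) * √(∫ x, w x ^ 2 ∂μ)) l (𝓝 0) := by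
    simpa using ((hk0.sqrt).const_mul (M : ℝ)).mul_const (√(∫ x, w x ^ 2 ∂μ))
  filter_upwards [hk, hfk, hC, hhead.eventually_lt_const (half_pos hε)] with t h1 h2 h3 h4
  have hm1 : MemLp ((s M).indicator fun x => f x * k t x) 2 μ := h2.indicator (hsm M)
  have hm2 := hw.indicator (hsm M).compl
  have hsplit : ∫ x, f x * k t x * w x ∂μ
      = (∫ x, (s M).indicator (fun x => f x * k t x) x * w x ∂μ)
        + ∫ x, (f x * k t x) * (s M)ᶜ.indicator w x ∂μ := by
    have i1 : Integrable (fun x => (s M).indicator (fun x => f x * k t x) x * w x) μ :=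
      hm1.integrable_mul hw
    have i2 : Integrable (fun x => (f x * k t x) * (s M)ᶜ.indicator w x) μ :=
      h2.integrable_mul hm2
    rw [← integral_add i1 i2]
    congr 1 with x
    by_cases hx : x ∈ s M <;> simp [hx]
  have hb1 : ∫ x, ((s M).indicator (fun x => f x * k t x) x) ^ 2 ∂μ
      ≤ (M : ℝ) ^ 2 * ∫ x, k t x ^ 2 ∂μ := by
    rw [← integral_const_mul]
    refine integral_mono hm1.integrable_sq (h1.integrable_sq.const_mul _) fun x => ?_
    by_cases hx : x ∈ s M
    · simp only [hx, Set.indicator_of_mem, mul_pow]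
      refine mul_le_mul_of_nonneg_right ?_ (sq_nonneg _)
      have hx' : |f x| ≤ M := hx
      exact sq_le_sq' (by linarith [(abs_le.1 hx').1]) (abs_le.1 hx').2
    · have := mul_nonneg (sq_nonneg (M : ℝ)) (sq_nonneg (k t x))
      simpa [hx] using this
  have e1 := abs_integral_mul_le hm1 hw
  have e2 := abs_integral_mul_le h2 hm2
  have e3 : √(∫ x, ((s M).indicator (fun x => f x * k t x) x) ^ 2 ∂μ)
      ≤ M * √(∫ x, k t x ^ 2 ∂μ) := by
    refine (Real.sqrt_le_sqrt hb1).trans_eq ?_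
    rw [Real.sqrt_mul (sq_nonneg _), Real.sqrt_sq (Nat.cast_nonneg _)]
  rw [Real.dist_eq, sub_zero, hsplit]
  calc _ ≤ _ := abs_add_le _ _
    _ ≤ M * √(∫ x, k t x ^ 2 ∂μ) * √(∫ x, w x ^ 2 ∂μ)
        + √C * √(∫ x, ((s M)ᶜ.indicator w x) ^ 2 ∂μ) := by
      refine add_le_add (e1.trans ?_) (e2.trans ?_)
      · gcongr
      · gcongr
    _ < ε := by linarith

/-- With $r_t=(p_t-p_0)/t-\tfrac12gp_0$, factoring $p_t^2-p_0^2$ shows that the difference quotient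
minus its limit is $\int f(p_t+p_0)r_t+\tfrac12\int f(p_t-p_0)\,gp_0$. The first integral vanishes
by Cauchy–Schwarz. In the second, $f(p_t-p_0)$ need not tend to zero in $L^2$ for unbounded `f`, but
it does so weakly, by `tendsto_integral_mul_mul_zero`. -/
theorem hasDerivAt_integral_mul_sq {α : Type*} [MeasurableSpace α] {μ : Measure α}
    {p : ℝ → α → ℝ} {f g : α → ℝ} {C : ℝ} (hf : Measurable f)
    (hp : ∀ᶠ t in 𝓝 (0 : ℝ), MemLp (p t) 2 μ)
    (hg : MemLp (fun x => g x * p 0 x) 2 μ)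
    (hfp : ∀ᶠ t in 𝓝 (0 : ℝ), MemLp (fun x => f x * p t x) 2 μ)
    (hC : ∀ᶠ t in 𝓝 (0 : ℝ), ∫ x, (f x * p t x) ^ 2 ∂μ ≤ C)
    (hqm : Tendsto (fun t : ℝ => ∫ x, ((p t x - p 0 x) / t - 1 / 2 * g x * p 0 x) ^ 2 ∂μ)
      (𝓝[≠] 0) (𝓝 0)) :
    HasDerivAt (fun t => ∫ x, f x * p t x ^ 2 ∂μ) (∫ x, f x * g x * p 0 x ^ 2 ∂μ) 0 := by
  set r : ℝ → α → ℝ := fun t x => (p t x - p 0 x) / t - 1 / 2 * g x * p 0 x with hr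
  have hp0 := hp.self_of_nhds
  have hfp0 := hfp.self_of_nhds
  have hC0 := hC.self_of_nhds
  have hk : ∀ᶠ t in 𝓝[≠] (0 : ℝ), MemLp (fun x => p t x - p 0 x) 2 μ := by
    filter_upwards [hp.filter_mono nhdsWithin_le_nhds] with t h1 using h1.sub hp0
  have hrL : ∀ᶠ t in 𝓝[≠] (0 : ℝ), MemLp (r t) 2 μ := by
    filter_upwards [hk] with t h1
    have := (h1.const_mul t⁻¹).sub (hg.const_mul (1 / 2))
    refine this.ae_eq (ae_of_all _ fun x => ?_)
    simp only [hr, Pi.sub_apply]; ring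
  have hfk : ∀ᶠ t in 𝓝[≠] (0 : ℝ), MemLp (fun x => f x * (p t x - p 0 x)) 2 μ := by
    filter_upwards [hfp.filter_mono nhdsWithin_le_nhds] with t h1
    refine (h1.sub hfp0).ae_eq (ae_of_all _ fun x => ?_)
    simp only [Pi.sub_apply]; ring
  -- Here $p_t-p_0=t\,(r_t+\tfrac12gp_0)$, and the bracket stays bounded in $L^2$.
  have hk0 : Tendsto (fun t => ∫ x, (p t x - p 0 x) ^ 2 ∂μ) (𝓝[≠] (0 : ℝ)) (𝓝 0) := by
    have hlim : Tendsto (fun t : ℝ => t ^ 2 * (2 * (∫ x, r t x ^ 2 ∂μ)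
        + 2 * ∫ x, (1 / 2 * (g x * p 0 x)) ^ 2 ∂μ)) (𝓝[≠] (0 : ℝ)) (𝓝 0) := by
      have h1 : Tendsto (fun t : ℝ => t ^ 2) (𝓝[≠] (0 : ℝ)) (𝓝 0) := by
        have : Tendsto (fun t : ℝ => t ^ 2) (𝓝 (0 : ℝ)) (𝓝 (0 ^ 2)) :=
        (continuous_pow 2).tendsto 0
        simpa using this.mono_left nhdsWithin_le_nhds
      have := h1.mul ((hqm.const_mul 2).add_const (2 * ∫ x, (1 / 2 * (g x * p 0 x)) ^ 2 ∂μ))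
      rwa [zero_mul] at this
    refine squeeze_zero' (Eventually.of_forall fun t => integral_nonneg fun x => sq_nonneg _)
      ?_ hlim
    filter_upwards [hrL, self_mem_nhdsWithin] with t h1 ht
    have ht' : t ≠ 0 := ht
    refine le_trans (le_of_eq ?_) (mul_le_mul_of_nonneg_left
      (integral_sq_add_le h1 (hg.const_mul (1 / 2))) (sq_nonneg t))
    rw [← integral_const_mul]
    congr 1 with x
    simp only [hr]
    field_simp
    ring
  have hfkC : ∀ᶠ t in 𝓝[≠] (0 : ℝ), ∫ x, (f x * (p t x - p 0 x)) ^ 2 ∂μ ≤ 4 * C := by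
    filter_upwards [hfp.filter_mono nhdsWithin_le_nhds, hC.filter_mono nhdsWithin_le_nhds]
      with t h1 h2
    have := integral_sq_add_le h1 hfp0.neg
    simp only [Pi.neg_apply, neg_sq] at this
    calc _ = ∫ x, (f x * p t x + -(f x * p 0 x)) ^ 2 ∂μ := by congr 1 with x; ring
      _ ≤ _ := this
      _ ≤ 4 * C := by linarith
  have hT2 := tendsto_integral_mul_mul_zero hf hg hk hfk hfkC hk0
  have hT1 : Tendsto (fun t => ∫ x, (f x * (p t x + p 0 x)) * r t x ∂μ) (𝓝[≠] (0 : ℝ)) (𝓝 0) := by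
    have hlim : Tendsto (fun t : ℝ => √(4 * C) * √(∫ x, r t x ^ 2 ∂μ)) (𝓝[≠] (0 : ℝ)) (𝓝 0) := by
      have := hqm.sqrt.const_mul (√(4 * C))
      rwa [Real.sqrt_zero, mul_zero] at this
    refine squeeze_zero_norm' ?_ hlim
    filter_upwards [hfp.filter_mono nhdsWithin_le_nhds, hC.filter_mono nhdsWithin_le_nhds, hrL]
      with t h1 h2 h3
    have hsum : MemLp (fun x => f x * (p t x + p 0 x)) 2 μ :=
      (h1.add hfp0).ae_eq (ae_of_all _ fun x => by simp only [Pi.add_apply]; ring)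
    refine (abs_integral_mul_le hsum h3).trans ?_
    gcongr
    have := integral_sq_add_le h1 hfp0
    calc _ = ∫ x, (f x * p t x + (f x * p 0 x)) ^ 2 ∂μ := by congr 1 with x; ring
      _ ≤ _ := this
      _ ≤ 4 * C := by linarith
  rw [hasDerivAt_iff_tendsto_slope_zero]
  have hlim := (hT1.add (hT2.const_mul (1 / 2))).add_const (∫ x, f x * g x * p 0 x ^ 2 ∂μ)
  simp only [mul_zero, add_zero, zero_add] at hlim
  refine hlim.congr' ?_
  filter_upwards [hfp.filter_mono nhdsWithin_le_nhds, hp.filter_mono nhdsWithin_le_nhds, hrL, hfk,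
    self_mem_nhdsWithin] with t h1 h2 h3 h4 ht
  have ht' : t ≠ 0 := ht
  have hsum : MemLp (fun x => f x * (p t x + p 0 x)) 2 μ :=
    (h1.add hfp0).ae_eq (ae_of_all _ fun x => by simp only [Pi.add_apply]; ring)
  have i1 : Integrable (fun x => (f x * (p t x + p 0 x)) * r t x) μ := hsum.integrable_mul h3
  have i2 : Integrable (fun x => f x * (p t x - p 0 x) * (g x * p 0 x)) μ := h4.integrable_mul hg
  have i3 : Integrable (fun x => f x * g x * p 0 x ^ 2) μ :=
    (hfp0.integrable_mul hg).congr (ae_of_all _ fun x => by simp only [Pi.mul_apply]; ring)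
  have i4 : Integrable (fun x => f x * p t x ^ 2) μ :=
    (h1.integrable_mul h2).congr (ae_of_all _ fun x => by simp only [Pi.mul_apply]; ring)
  have i5 : Integrable (fun x => f x * p 0 x ^ 2) μ :=
    (hfp0.integrable_mul hp0).congr (ae_of_all _ fun x => by simp only [Pi.mul_apply]; ring)
  simp only [zero_add, smul_eq_mul]
  have i6 : Integrable (fun x => (f x * (p t x + p 0 x)) * r t x
      + 1 / 2 * (f x * (p t x - p 0 x) * (g x * p 0 x))) μ := i1.add (i2.const_mul _)
  rw [← integral_const_mul, ← integral_add i1 (i2.const_mul _), ← integral_add i6 i3, ← integral_sub i4 i5, ← integral_const_mul]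
  congr 1 with x
  simp only [hr]
  field_simp
  ring
-- Square roots of densities
section RootDensity

variable {α : Type*} [MeasurableSpace α] {μ Q : Measure α} [SigmaFinite μ] [IsProbabilityMeasure Q]

theorem integral_mul_sq_sqrt_rnDeriv (hQ : Q ≪ μ) (h : α → ℝ) :
    ∫ x, h x * √((Q.rnDeriv μ x).toReal) ^ 2 ∂μ = ∫ x, h x ∂Q := by
  rw [← integral_rnDeriv_smul hQ]
  congr 1 with x
  rw [Real.sq_sqrt ENNReal.toReal_nonneg, smul_eq_mul, mul_comm]

theorem memLp_mul_sqrt_rnDeriv (hQ : Q ≪ μ) {h : α → ℝ} (hm : Measurable h) :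
    MemLp (fun x => h x * √((Q.rnDeriv μ x).toReal)) 2 μ ↔ MemLp h 2 Q := by
  have hd : Measurable fun x => √((Q.rnDeriv μ x).toReal) :=
    (Measure.measurable_rnDeriv Q μ).ennreal_toReal.sqrt
  have hhd : Measurable fun x => h x * √((Q.rnDeriv μ x).toReal) := hm.mul hd
  rw [memLp_two_iff_integrable_sq hhd.aestronglyMeasurable,
    memLp_two_iff_integrable_sq hm.aestronglyMeasurable, ← integrable_rnDeriv_smul_iff hQ]
  refine integrable_congr (ae_of_all _ fun x => ?_)
  simp only [mul_pow, Real.sq_sqrt ENNReal.toReal_nonneg, smul_eq_mul]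
  ring

/-- A `Q`-null set may have positive `μ`-measure, but the density of `Q` vanishes `μ`-almost
everywhere on it, so the weight hides the discrepancy. This makes a change of version of the score
harmless under the dominating measure. -/
theorem ae_mul_sqrt_rnDeriv_eq (hQ : Q ≪ μ) {g g' : α → ℝ} (h : g =ᵐ[Q] g') :
    (fun x => g x * √((Q.rnDeriv μ x).toReal)) =ᵐ[μ]
      fun x => g' x * √((Q.rnDeriv μ x).toReal) := by
  rw [← Measure.withDensity_rnDeriv_eq Q μ hQ] at h
  have := (ae_withDensity_iff (Measure.measurable_rnDeriv Q μ)).1 h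
  filter_upwards [this] with x hx
  by_cases h0 : Q.rnDeriv μ x = 0
  · simp [h0]
  · rw [hx h0]

end RootDensity

variable {𝒲 ℒ : Type*} [MeasurableSpace 𝒲] [MeasurableSpace ℒ]

/-- Along a regular submodel, the mean of a statistic with locally bounded second moment is
differentiable, and its derivative is the covariance with the score. -/
theorem IsRegularSubmodel.hasDerivAt_integral {ρ : ℝ} {P : ProbabilityMeasure (FullData 𝒲 ℒ)}
    {Pt : ℝ → ProbabilityMeasure (FullData 𝒲 ℒ)} {g : ObsData 𝒲 ℒ → ℝ}
    (h : IsRegularSubmodel ρ P Pt g) {f : ObsData 𝒲 ℒ → ℝ} (hf : Measurable f) {C : ℝ}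
    (hfL : ∀ᶠ t in 𝓝 (0 : ℝ), MemLp f 2 (obsLaw (Pt t) : Measure (ObsData 𝒲 ℒ)))
    (hC : ∀ᶠ t in 𝓝 (0 : ℝ), ∫ o, f o ^ 2 ∂(obsLaw (Pt t) : Measure (ObsData 𝒲 ℒ)) ≤ C) :
    HasDerivAt (fun t => ∫ o, f o ∂(obsLaw (Pt t) : Measure (ObsData 𝒲 ℒ)))
      (∫ o, f o * g o ∂(obsLaw P : Measure (ObsData 𝒲 ℒ))) 0 := by
  obtain ⟨μ, hμ, hac, hqm⟩ := h.differentiable_qm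
  have h0 : obsLaw (Pt 0) = obsLaw P := by rw [h.at_zero]
  have hac0 : (obsLaw P : Measure (ObsData 𝒲 ℒ)) ≪ μ := h0 ▸ hac.self_of_nhds
  -- The score is only almost everywhere measurable, under the law at `P`; a measurable version is
  -- used under `μ`.
  set g' := h.memLp_score.aestronglyMeasurable.mk g with hg'
  have hgm : Measurable g' := h.memLp_score.aestronglyMeasurable.stronglyMeasurable_mk.measurable
  have hgg : g =ᵐ[(obsLaw P : Measure (ObsData 𝒲 ℒ))] g' :=
    h.memLp_score.aestronglyMeasurable.ae_eq_mk
  have hg'L : MemLp g' 2 (obsLaw P : Measure (ObsData 𝒲 ℒ)) := h.memLp_score.ae_eq hgg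
  have hroot : ∀ t, Measurable (rootDensity (Pt t) μ) := fun t =>
    (Measure.measurable_rnDeriv _ μ).ennreal_toReal.sqrt
  have hval : ∫ o, f o * g' o * rootDensity (Pt 0) μ o ^ 2 ∂μ
      = ∫ o, f o * g o ∂(obsLaw P : Measure (ObsData 𝒲 ℒ)) := by
    rw [h.at_zero]
    refine (integral_mul_sq_sqrt_rnDeriv hac0 fun o => f o * g' o).trans (integral_congr_ae ?_)
    filter_upwards [hgg] with o ho
    rw [ho]
  have main : HasDerivAt (fun t => ∫ o, f o * rootDensity (Pt t) μ o ^ 2 ∂μ)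
      (∫ o, f o * g' o * rootDensity (Pt 0) μ o ^ 2 ∂μ) 0 := by
    refine hasDerivAt_integral_mul_sq (C := C) hf ?_ ?_ ?_ ?_ ?_
    · filter_upwards [hac] with t ht
      have := (memLp_mul_sqrt_rnDeriv ht (h := fun _ => (1 : ℝ)) measurable_const).2
        (memLp_const _)
      simp only [one_mul] at this
      exact this
    · rw [h.at_zero]
      exact (memLp_mul_sqrt_rnDeriv hac0 hgm).2 hg'L
    · filter_upwards [hac, hfL] with t ht h2
      exact (memLp_mul_sqrt_rnDeriv ht hf).2 h2
    · filter_upwards [hac, hC] with t ht h2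
      refine le_trans (le_of_eq ?_) h2
      rw [← integral_mul_sq_sqrt_rnDeriv ht]
      congr 1 with o
      rw [mul_pow]; rfl
    · rw [h.at_zero]
      have hlim := (ENNReal.tendsto_toReal ENNReal.zero_ne_top).comp hqm
      rw [ENNReal.toReal_zero] at hlim
      refine hlim.congr fun t => ?_
      rw [integral_eq_lintegral_of_nonneg_ae (ae_of_all _ fun o => sq_nonneg _)]
      · simp only [Function.comp_apply]
        congr 1
        refine lintegral_congr_ae ?_
        filter_upwards [ae_mul_sqrt_rnDeriv_eq hac0 hgg] with o ho
        have ho' : g o * rootDensity P μ o = g' o * rootDensity P μ o := ho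
        rw [mul_assoc, mul_assoc, ho']
      · have hP : Measurable (rootDensity P μ) := h.at_zero ▸ hroot 0
        exact (((((hroot t).sub hP).div_const t).sub ((hgm.const_mul _).mul hP)).pow_const
          2).aestronglyMeasurable
  rw [hval] at main
  refine main.congr_of_eventuallyEq ?_
  filter_upwards [hac] with t ht
  exact (integral_mul_sq_sqrt_rnDeriv ht f).symm

/-! ### Clipping -/

/-- Clipping of a real number to `[-K, K]`. -/
def clip (K z : ℝ) : ℝ := max (-K) (min K z)

theorem abs_clip_le {K : ℝ} (hK : 0 ≤ K) (z : ℝ) : |clip K z| ≤ K :=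
  abs_le.2 ⟨le_max_left _ _, max_le (by linarith) (min_le_left _ _)⟩

theorem clip_eq_self {K z : ℝ} (hz : |z| ≤ K) : clip K z = z := by
  rw [clip, min_eq_right (abs_le.1 hz).2, max_eq_right (abs_le.1 hz).1]

theorem abs_clip_le_abs {K : ℝ} (hK : 0 ≤ K) (z : ℝ) : |clip K z| ≤ |z| := by
  rcases le_total |z| K with h | h
  · rw [clip_eq_self h]
  · exact (abs_clip_le hK z).trans h

theorem measurable_clip (K : ℝ) : Measurable (clip K) :=
  measurable_const.max (measurable_const.min measurable_id)

theorem tendsto_clip (z : ℝ) : Tendsto (fun k : ℕ => clip k z) atTop (𝓝 z) := by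
  obtain ⟨k₀, hk₀⟩ := exists_nat_ge |z|
  refine tendsto_const_nhds.congr' ?_
  filter_upwards [eventually_ge_atTop k₀] with k hk
  exact (clip_eq_self (hk₀.trans (by exact_mod_cast hk))).symm

/-- Dominated convergence, with bound $|bH|$. It carries the score identities from bounded to square
integrable functions: only for bounded functions is a second moment bound along the whole path
automatic. -/
theorem tendsto_integral_clip_mul {α : Type*} [MeasurableSpace α] {μ : Measure α} {b H : α → ℝ}
    (hb : Measurable b) (hH : AEStronglyMeasurable H μ) (hi : Integrable (fun x => b x * H x) μ) :
    Tendsto (fun k : ℕ => ∫ x, clip k (b x) * H x ∂μ) atTop (𝓝 (∫ x, b x * H x ∂μ)) := by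
  refine tendsto_integral_of_dominated_convergence (fun x => ‖b x * H x‖)
    (fun k => ((measurable_clip k).comp hb).aestronglyMeasurable.mul hH) hi.norm ?_ ?_
  · refine fun k => ae_of_all _ fun x => ?_
    rw [norm_mul, norm_mul]
    exact mul_le_mul_of_nonneg_right (abs_clip_le_abs (Nat.cast_nonneg k) _) (norm_nonneg _)
  · exact ae_of_all _ fun x => (tendsto_clip (b x)).mul_const _

/-! ### Integrals under the model -/

section Basic

variable {𝒲 ℒ : Type*}

/-- The indicator of `b = a`. -/
def boolInd (a b : Bool) : ℝ := if b = a then 1 else 0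

theorem boolInd_mul_self (a b : Bool) : boolInd a b * boolInd a b = boolInd a b := by
  cases a <;> cases b <;> simp [boolInd]

theorem abs_boolInd_le (a b : Bool) : |boolInd a b| ≤ 1 := by
  cases a <;> cases b <;> simp [boolInd]

theorem boolInd_mul_eq_indicator {a : Bool} (F : FullData 𝒲 ℒ → ℝ) :
    (fun x => boolInd a (arm x) * F x) = Set.indicator {x | arm x = a} F := by
  ext x
  by_cases h : arm x = a <;> simp [boolInd, h]

/-- A function of the short-term outcome and baseline, set to zero when the former is missing. -/
def obsLW (h : ℒ × 𝒲 → ℝ) (o : ObsData 𝒲 ℒ) : ℝ :=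
  Sum.elim (fun l => h (l, o.1)) (fun _ => 0) o.2.2.1

/-- A function of the primary outcome, set to zero when the latter is missing. -/
def obsY (u : ℝ → ℝ) (o : ObsData 𝒲 ℒ) : ℝ := Sum.elim u (fun _ => 0) o.2.2.2

theorem obsLW_observe (h : ℒ × 𝒲 → ℝ) (x : FullData 𝒲 ℒ) :
    obsLW h (observe x) = boolInd true (seenL x) * h (shortTerm x, baseline x) := by
  cases hx : seenL x <;> simp [obsLW, observe, boolInd, hx]

theorem obsY_observe (u : ℝ → ℝ) (x : FullData 𝒲 ℒ) :
    obsY u (observe x) = boolInd true (seenY x) * u (outcome x) := by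
  cases hx : seenY x <;> simp [obsY, observe, boolInd, hx]

variable [MeasurableSpace 𝒲] [MeasurableSpace ℒ]

@[fun_prop]
theorem measurable_boolInd (a : Bool) : Measurable (boolInd a) := measurable_of_finite _

@[fun_prop]
theorem measurable_baseline : Measurable (baseline (𝒲 := 𝒲) (ℒ := ℒ)) := by
  unfold baseline; fun_prop

@[fun_prop]
theorem measurable_arm : Measurable (arm (𝒲 := 𝒲) (ℒ := ℒ)) := by unfold arm; fun_prop

@[fun_prop]
theorem measurable_shortTerm : Measurable (shortTerm (𝒲 := 𝒲) (ℒ := ℒ)) := by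
  unfold shortTerm; fun_prop

@[fun_prop]
theorem measurable_outcome : Measurable (outcome (𝒲 := 𝒲) (ℒ := ℒ)) := by
  unfold outcome; fun_prop

@[fun_prop]
theorem measurable_seenL : Measurable (seenL (𝒲 := 𝒲) (ℒ := ℒ)) := by unfold seenL; fun_prop

@[fun_prop]
theorem measurable_seenY : Measurable (seenY (𝒲 := 𝒲) (ℒ := ℒ)) := by unfold seenY; fun_prop

theorem measurableSet_arm_eq (a : Bool) : MeasurableSet {x : FullData 𝒲 ℒ | arm x = a} :=
  measurable_arm (measurableSet_singleton a)

variable {ρ : ℝ} {P : ProbabilityMeasure (FullData 𝒲 ℒ)} {a : Bool}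

theorem integral_boolInd_comp {f : FullData 𝒲 ℒ → Bool} (hf : Measurable f) (b : Bool)
    (Q : Measure (FullData 𝒲 ℒ)) : ∫ x, boolInd b (f x) ∂Q = Q.real {x | f x = b} := by
  have hs : MeasurableSet {x | f x = b} := hf (measurableSet_singleton b)
  rw [← integral_indicator_one hs]
  congr 1 with x
  by_cases h : f x = b <;> simp [boolInd, h]

theorem integral_boolInd_seenL : ∫ x, boolInd true (seenL x) ∂(P : Measure (FullData 𝒲 ℒ))
    = probL P := integral_boolInd_comp measurable_seenL true _

theorem integral_boolInd_seenY : ∫ x, boolInd true (seenY x) ∂(P : Measure (FullData 𝒲 ℒ))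
    = probY P := integral_boolInd_comp measurable_seenY true _

theorem InModel.armProb_eq (hP : InModel ρ P) (a : Bool) :
    armProb P a = if a = true then ρ else 1 - ρ := by
  cases a
  · have hc : {x : FullData 𝒲 ℒ | arm x = false} = {x | arm x = true}ᶜ := by
      ext x; simp
    simp only [armProb, hc, measureReal_compl (measurableSet_arm_eq true), hP.randomization_prob]
    simp
  · simpa [armProb] using hP.randomization_prob

theorem InModel.armProb_pos (hP : InModel ρ P) (hρ0 : 0 < ρ) (hρ1 : ρ < 1) (a : Bool) :
    0 < armProb P a := by
  rw [hP.armProb_eq]; split_ifs <;> linarith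

theorem InModel.probY_le_probL (hP : InModel ρ P) : probY P ≤ probL P := by
  refine ENNReal.toReal_mono (measure_ne_top _ _) (measure_mono_ae ?_)
  filter_upwards [hP.monotone_censoring] with x hx h
  have h' : seenY x = true := h
  rw [h'] at hx
  exact Bool.eq_true_of_true_le hx

theorem probL_le_one : probL P ≤ 1 := measureReal_le_one

theorem armProb_le_one : armProb P a ≤ 1 := measureReal_le_one

theorem integral_boolInd_arm_mul (ha : 0 < armProb P a) (F : FullData 𝒲 ℒ → ℝ) :
    ∫ x, boolInd a (arm x) * F x ∂(P : Measure (FullData 𝒲 ℒ))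
      = armProb P a * ∫ x, F x ∂(armLaw P a) := by
  rw [boolInd_mul_eq_indicator, integral_indicator (measurableSet_arm_eq a), armLaw,
    ProbabilityTheory.cond, integral_smul_measure, ENNReal.toReal_inv, smul_eq_mul]
  exact (mul_inv_cancel_left₀ ha.ne' _).symm

theorem isProbabilityMeasure_armLaw (ha : 0 < armProb P a) :
    IsProbabilityMeasure (armLaw P a) :=
  cond_isProbabilityMeasure fun h => by simp [armProb, measureReal_def, h] at ha

theorem memLp_boolInd_arm_mul (ha : 0 < armProb P a) {F : FullData 𝒲 ℒ → ℝ}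
    (hF : MemLp F 2 (armLaw P a)) :
    MemLp (fun x => boolInd a (arm x) * F x) 2 (P : Measure (FullData 𝒲 ℒ)) := by
  rw [boolInd_mul_eq_indicator, memLp_indicator_iff_restrict (measurableSet_arm_eq a)]
  have hne : (P : Measure (FullData 𝒲 ℒ)) {x | arm x = a} ≠ 0 :=
    fun h => by simp [armProb, measureReal_def, h] at ha
  refine hF.of_measure_le_smul (c := (P : Measure (FullData 𝒲 ℒ)) {x | arm x = a})
    (measure_ne_top _ _) ?_
  rw [armLaw, ProbabilityTheory.cond, smul_smul, ENNReal.mul_inv_cancel hne (measure_ne_top _ _),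
    one_smul]

theorem memLp_armLaw {F : FullData 𝒲 ℒ → ℝ} (ha : 0 < armProb P a)
    (hF : MemLp F 2 (P : Measure (FullData 𝒲 ℒ))) : MemLp F 2 (armLaw P a) := by
  have hne : (P : Measure (FullData 𝒲 ℒ)) {x | arm x = a} ≠ 0 :=
    fun h => by simp [armProb, measureReal_def, h] at ha
  refine hF.of_measure_le_smul (c := ((P : Measure (FullData 𝒲 ℒ)) {x | arm x = a})⁻¹)
    (ENNReal.inv_ne_top.2 hne) ?_
  rw [armLaw, ProbabilityTheory.cond]
  gcongr
  exact Measure.restrict_le_self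

/-- Randomization: the baseline variables have the same law in each arm. -/
theorem InModel.map_baseline_armLaw (hP : InModel ρ P) (ha : 0 < armProb P a) :
    (armLaw P a).map baseline = (P : Measure (FullData 𝒲 ℒ)).map baseline := by
  have hne : (P : Measure (FullData 𝒲 ℒ)) {x | arm x = a} ≠ 0 :=
    fun h => by simp [armProb, measureReal_def, h] at ha
  ext s hs
  rw [Measure.map_apply measurable_baseline hs, Measure.map_apply measurable_baseline hs, armLaw,
    cond_apply (measurableSet_arm_eq a)]
  have := hP.randomization_indep.measure_inter_preimage_eq_mul {a} s (measurableSet_singleton a) hs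
  have h2 : {x : FullData 𝒲 ℒ | arm x = a} = arm ⁻¹' {a} := rfl
  rw [h2, this, ← mul_assoc, ← h2, ENNReal.inv_mul_cancel hne (measure_ne_top _ _), one_mul]

theorem InModel.integral_baseline (hP : InModel ρ P) (ha : 0 < armProb P a) {b : 𝒲 → ℝ}
    (hb : Measurable b) :
    ∫ x, b (baseline x) ∂(armLaw P a) = ∫ x, b (baseline x) ∂(P : Measure (FullData 𝒲 ℒ)) := by
  rw [← integral_map measurable_baseline.aemeasurable hb.aestronglyMeasurable,
    ← integral_map measurable_baseline.aemeasurable hb.aestronglyMeasurable,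
    hP.map_baseline_armLaw ha]

theorem InModel.memLp_baseline (hP : InModel ρ P) (ha : 0 < armProb P a) {b : 𝒲 → ℝ}
    (hb : Measurable b) (h : MemLp (fun x => b (baseline x)) 2 (armLaw P a)) :
    MemLp (fun x => b (baseline x)) 2 (P : Measure (FullData 𝒲 ℒ)) := by
  have h1 := (memLp_map_measure_iff (p := 2) hb.aestronglyMeasurable
    (measurable_baseline (𝒲 := 𝒲) (ℒ := ℒ)).aemeasurable (μ := armLaw P a)).2 h
  rw [hP.map_baseline_armLaw ha] at h1
  exact (memLp_map_measure_iff hb.aestronglyMeasurable measurable_baseline.aemeasurable).1 h1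

/-- Independent censoring: factorization of integrals. -/
theorem InModel.integral_censoring_mul (hP : InModel ρ P) (ha : 0 < armProb P a)
    (c : Bool × Bool → ℝ) {F : 𝒲 → ℒ → ℝ → ℝ}
    (hF : Measurable fun p : 𝒲 × ℒ × ℝ => F p.1 p.2.1 p.2.2) :
    ∫ x, c (seenL x, seenY x) * (boolInd a (arm x) * F (baseline x) (shortTerm x) (outcome x))
        ∂(P : Measure (FullData 𝒲 ℒ))
      = (∫ x, c (seenL x, seenY x) ∂(P : Measure (FullData 𝒲 ℒ)))
        * (armProb P a * ∫ x, F (baseline x) (shortTerm x) (outcome x) ∂(armLaw P a)) := by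
  rw [← integral_boolInd_arm_mul ha]
  refine hP.independent_censoring.integral_fun_comp_mul_comp (f := c)
    (g := fun q : 𝒲 × Bool × ℒ × ℝ => boolInd a q.2.1 * F q.1 q.2.2.1 q.2.2.2)
    (by fun_prop) (by fun_prop) (measurable_of_finite c).aestronglyMeasurable ?_
  have h1 : Measurable fun q : 𝒲 × Bool × ℒ × ℝ => F q.1 q.2.2.1 q.2.2.2 :=
    hF.comp (f := fun q : 𝒲 × Bool × ℒ × ℝ => (q.1, q.2.2.1, q.2.2.2)) (by fun_prop)
  have h2 : Measurable fun q : 𝒲 × Bool × ℒ × ℝ => boolInd a q.2.1 := by fun_prop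
  exact (h2.mul h1).aestronglyMeasurable

/-- The algebraic form in which monotone censoring is used: $C^YC^L=C^Y$. -/
theorem InModel.seenY_mul_seenL (hP : InModel ρ P) : ∀ᵐ x ∂(P : Measure (FullData 𝒲 ℒ)),
    boolInd true (seenY x) * boolInd true (seenL x) = boolInd true (seenY x) := by
  filter_upwards [hP.monotone_censoring] with x hx
  cases h1 : seenY x <;> cases h2 : seenL x <;> simp only [h1, h2] at hx <;>
    first | exact absurd hx (by decide) | simp [boolInd]

@[fun_prop]
theorem measurable_obsLW {h : ℒ × 𝒲 → ℝ} (hh : Measurable h) :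
    Measurable (obsLW h : ObsData 𝒲 ℒ → ℝ) := by
  have h1 : Measurable (Sum.elim (fun p : 𝒲 × ℒ => h (p.2, p.1)) fun _ : 𝒲 × Unit => (0 : ℝ)) :=
    Measurable.sumElim (by fun_prop) measurable_const
  -- The value depends on `W` as well as on the summand that holds `L`, so the product is
  -- distributed over the sum before splitting into cases.
  have h2 : Measurable fun o : ObsData 𝒲 ℒ =>
      MeasurableEquiv.prodSumDistrib 𝒲 ℒ Unit (o.1, o.2.2.1) :=
    (MeasurableEquiv.measurable _).comp (by fun_prop)
  convert h1.comp h2 using 1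
  ext ⟨w, b, l, y⟩
  rcases l with l | l <;> rfl

@[fun_prop]
theorem measurable_obsY {u : ℝ → ℝ} (hu : Measurable u) :
    Measurable (obsY u : ObsData 𝒲 ℒ → ℝ) := by
  have h1 : Measurable (Sum.elim u fun _ : Unit => (0 : ℝ)) := hu.sumElim measurable_const
  exact h1.comp (by fun_prop)

theorem integral_obsLaw {f : ObsData 𝒲 ℒ → ℝ}
    (hf : AEStronglyMeasurable f (obsLaw P : Measure (ObsData 𝒲 ℒ))) :
    ∫ o, f o ∂(obsLaw P : Measure (ObsData 𝒲 ℒ))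
      = ∫ x, f (observe x) ∂(P : Measure (FullData 𝒲 ℒ)) :=
  integral_map measurable_observe.aemeasurable hf

theorem memLp_obsLaw {f : ObsData 𝒲 ℒ → ℝ}
    (hf : AEStronglyMeasurable f (obsLaw P : Measure (ObsData 𝒲 ℒ))) :
    MemLp f 2 (obsLaw P : Measure (ObsData 𝒲 ℒ))
      ↔ MemLp (fun x => f (observe x)) 2 (P : Measure (FullData 𝒲 ℒ)) :=
  memLp_map_measure_iff hf measurable_observe.aemeasurable

end Basic
/-! ### Regression functions and the efficient influence function -/

section Regression

variable {𝒲 ℒ : Type*} [MeasurableSpace 𝒲] [MeasurableSpace ℒ]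

/-- `m` and `r` are versions of the regressions of `u(Y)` on `W` and on `(L, W)` in arm `a`. -/
structure IsRegression (P : ProbabilityMeasure (FullData 𝒲 ℒ)) (a : Bool) (u : ℝ → ℝ)
    (m : 𝒲 → ℝ) (r : ℒ × 𝒲 → ℝ) : Prop where
  measurable_u : Measurable u
  measurable_m : Measurable m
  measurable_r : Measurable r
  memLp_u : MemLp (fun x => u (outcome x)) 2 (armLaw P a)
  memLp_m : MemLp (fun x => m (baseline x)) 2 (armLaw P a)
  memLp_r : MemLp (fun x => r (shortTerm x, baseline x)) 2 (armLaw P a)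
  orth_m : ∀ β : 𝒲 → ℝ, Measurable β → MemLp (fun x => β (baseline x)) 2 (armLaw P a) →
    ∫ x, β (baseline x) * (u (outcome x) - m (baseline x)) ∂(armLaw P a) = 0
  orth_r : ∀ β : ℒ × 𝒲 → ℝ, Measurable β →
    MemLp (fun x => β (shortTerm x, baseline x)) 2 (armLaw P a) →
    ∫ x, β (shortTerm x, baseline x) * (u (outcome x) - r (shortTerm x, baseline x))
      ∂(armLaw P a) = 0

/-- The factor `β` is pulled out of the conditional expectation. This orthogonality is the only
property of regressions that the later arguments use. -/
theorem integral_mul_sub_condExp {α : Type*} {m₁ m₀ : MeasurableSpace α} {ν : Measure α}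
    [IsFiniteMeasure ν] (hm : m₁ ≤ m₀) {β f : α → ℝ} (hβ : StronglyMeasurable[m₁] β)
    (hβ2 : MemLp β 2 ν) (hf : MemLp f 2 ν) : ∫ x, β x * (f x - (ν[f|m₁]) x) ∂ν = 0 := by
  have hprod : Integrable (β * f) ν := hβ2.integrable_mul hf
  have i1 : Integrable (fun x => β x * f x) ν := hprod
  have hpull : ν[β * f|m₁] =ᵐ[ν] β * ν[f|m₁] :=
    condExp_mul_of_stronglyMeasurable_left hβ hprod (hf.integrable one_le_two)
  have hint : ∫ x, β x * (ν[f|m₁]) x ∂ν = ∫ x, β x * f x ∂ν := by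
    calc _ = ∫ x, (ν[β * f|m₁]) x ∂ν := integral_congr_ae hpull.symm
      _ = _ := integral_condExp hm
  have i2 : Integrable (fun x => β x * (ν[f|m₁]) x) ν := hβ2.integrable_mul (hf.condExp one_le_two)
  simp only [mul_sub]
  rw [integral_sub i1 i2, hint, sub_self]

variable {P : ProbabilityMeasure (FullData 𝒲 ℒ)} {a : Bool} {u v : ℝ → ℝ} {m n : 𝒲 → ℝ}
  {r q : ℒ × 𝒲 → ℝ} {ρ : ℝ}

/-- A function measurable for the σ-algebra of a map factors through that map. The two identities
with `condExp` hold at every point, not just almost everywhere in the arm; they can therefore be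
used when the variance of $E_a(Y\mid W)$ is taken under the law of the whole population. -/
theorem exists_isRegression (ha : 0 < armProb P a) (hu : Measurable u)
    (hu2 : MemLp (fun x => u (outcome x)) 2 (armLaw P a)) :
    ∃ (m : 𝒲 → ℝ) (r : ℒ × 𝒲 → ℝ), IsRegression P a u m r ∧
      (fun x => m (baseline x)) = condExp (MeasurableSpace.comap
        (baseline (𝒲 := 𝒲) (ℒ := ℒ)) inferInstance) (armLaw P a) (fun x => u (outcome x)) ∧
      (fun x => r (shortTerm x, baseline x)) = condExp (MeasurableSpace.comap
        (fun x : FullData 𝒲 ℒ => (shortTerm x, baseline x)) inferInstance) (armLaw P a)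
          (fun x => u (outcome x)) := by
  have := isProbabilityMeasure_armLaw ha
  have hLW : Measurable fun x : FullData 𝒲 ℒ => (shortTerm x, baseline x) := by fun_prop
  obtain ⟨m, hm, hm'⟩ := (stronglyMeasurable_condExp (m := MeasurableSpace.comap
    (baseline (𝒲 := 𝒲) (ℒ := ℒ)) inferInstance) (μ := armLaw P a)
    (f := fun x => u (outcome x))).exists_eq_measurable_comp
  obtain ⟨r, hr, hr'⟩ := (stronglyMeasurable_condExp (m := MeasurableSpace.comap
    (fun x : FullData 𝒲 ℒ => (shortTerm x, baseline x)) inferInstance) (μ := armLaw P a)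
    (f := fun x => u (outcome x))).exists_eq_measurable_comp
  have hm'' : (fun x => m (baseline x)) = _ := hm'.symm
  have hr'' : (fun x => r (shortTerm x, baseline x)) = _ := hr'.symm
  refine ⟨m, r, ⟨hu, hm.measurable, hr.measurable, hu2, ?_, ?_, ?_, ?_⟩, hm'', hr''⟩
  · rw [hm'']; exact hu2.condExp one_le_two
  · rw [hr'']; exact hu2.condExp one_le_two
  · intro β hβ hβ2
    have := integral_mul_sub_condExp (f := fun x => u (outcome x)) measurable_baseline.comap_le
      (hβ.comp (comap_measurable baseline)).stronglyMeasurable hβ2 hu2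
    rw [← hm''] at this
    exact this
  · intro β hβ hβ2
    have := integral_mul_sub_condExp (f := fun x => u (outcome x)) hLW.comap_le
      (hβ.comp (comap_measurable _)).stronglyMeasurable hβ2 hu2
    rw [← hr''] at this
    exact this

theorem IsRegression.congr (h : IsRegression P a u m r) (hn : Measurable n) (hq : Measurable q)
    (hmn : ∀ᵐ x ∂(armLaw P a), m (baseline x) = n (baseline x))
    (hrq : ∀ᵐ x ∂(armLaw P a), r (shortTerm x, baseline x) = q (shortTerm x, baseline x)) :
    IsRegression P a u n q where
  measurable_u := h.measurable_u
  measurable_m := hn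
  measurable_r := hq
  memLp_u := h.memLp_u
  memLp_m := h.memLp_m.ae_eq hmn
  memLp_r := h.memLp_r.ae_eq hrq
  orth_m β hβ hβ2 := by
    rw [← h.orth_m β hβ hβ2]
    refine integral_congr_ae ?_
    filter_upwards [hmn] with x hx
    rw [hx]
  orth_r β hβ hβ2 := by
    rw [← h.orth_r β hβ hβ2]
    refine integral_congr_ae ?_
    filter_upwards [hrq] with x hx
    rw [hx]

/-- Conditional expectations inherit the bound almost everywhere, so clipping them changes them on a
null set only. Bounds at every point make the density of a tilt positive everywhere for small `t`.
-/
theorem exists_isRegression_bounded (ha : 0 < armProb P a) (hu : Measurable u) {K : ℝ≥0}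
    (hK : ∀ y, |u y| ≤ K) :
    ∃ (m : 𝒲 → ℝ) (r : ℒ × 𝒲 → ℝ), IsRegression P a u m r ∧ (∀ w, |m w| ≤ K) ∧
      ∀ z, |r z| ≤ K := by
  have := isProbabilityMeasure_armLaw ha
  have hu2 : MemLp (fun x => u (outcome x)) 2 (armLaw P a) :=
    MemLp.of_bound (hu.comp measurable_outcome).aestronglyMeasurable K
      (ae_of_all _ fun x => hK _)
  obtain ⟨m, r, h, hm, hr⟩ := exists_isRegression ha hu hu2
  refine ⟨fun w => clip K (m w), fun z => clip K (r z), h.congr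
    ((measurable_clip K).comp h.measurable_m) ((measurable_clip K).comp h.measurable_r) ?_ ?_,
    fun w => abs_clip_le K.2 _, fun z => abs_clip_le K.2 _⟩
  · have := ae_bdd_abs_condExp_of_ae_bdd_abs (m := MeasurableSpace.comap
      (baseline (𝒲 := 𝒲) (ℒ := ℒ)) inferInstance) (μ := armLaw P a)
      (f := fun x => u (outcome x)) (R := (K : ℝ)) (ae_of_all _ fun x => hK _)
    rw [← hm] at this
    filter_upwards [this] with x hx using (clip_eq_self hx).symm
  · have := ae_bdd_abs_condExp_of_ae_bdd_abs (m := MeasurableSpace.comap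
      (fun x : FullData 𝒲 ℒ => (shortTerm x, baseline x)) inferInstance) (μ := armLaw P a)
      (f := fun x => u (outcome x)) (R := (K : ℝ)) (ae_of_all _ fun x => hK _)
    rw [← hr] at this
    filter_upwards [this] with x hx using (clip_eq_self hx).symm

namespace IsRegression

/-- The orthogonality relations are linear. Together with `influence_sub` this makes $D-D_k$ the
influence function of the clipping error $Y-\mathrm{clip}_k(Y)$. -/
theorem sub (h : IsRegression P a u m r) (h' : IsRegression P a v n q) :
    IsRegression P a (fun y => u y - v y) (fun w => m w - n w) (fun z => r z - q z) where
  measurable_u := h.measurable_u.sub h'.measurable_u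
  measurable_m := h.measurable_m.sub h'.measurable_m
  measurable_r := h.measurable_r.sub h'.measurable_r
  memLp_u := h.memLp_u.sub h'.memLp_u
  memLp_m := h.memLp_m.sub h'.memLp_m
  memLp_r := h.memLp_r.sub h'.memLp_r
  orth_m β hβ hβ2 := by
    have e1 := h.orth_m β hβ hβ2
    have e2 := h'.orth_m β hβ hβ2
    have i1 : Integrable (fun x => β (baseline x) * (u (outcome x) - m (baseline x)))
      (armLaw P a) := hβ2.integrable_mul (h.memLp_u.sub h.memLp_m)
    have i2 : Integrable (fun x => β (baseline x) * (v (outcome x) - n (baseline x)))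
      (armLaw P a) := hβ2.integrable_mul (h'.memLp_u.sub h'.memLp_m)
    have := integral_sub i1 i2
    rw [e1, e2, sub_zero] at this
    rw [← this]
    congr 1 with x
    ring
  orth_r β hβ hβ2 := by
    have e1 := h.orth_r β hβ hβ2
    have e2 := h'.orth_r β hβ hβ2
    have i1 : Integrable (fun x => β (shortTerm x, baseline x) * (u (outcome x) -
      r (shortTerm x, baseline x))) (armLaw P a) := hβ2.integrable_mul (h.memLp_u.sub h.memLp_r)
    have i2 : Integrable (fun x => β (shortTerm x, baseline x) * (v (outcome x) -
      q (shortTerm x, baseline x))) (armLaw P a) := hβ2.integrable_mul (h'.memLp_u.sub h'.memLp_r)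
    have := integral_sub i1 i2
    rw [e1, e2, sub_zero] at this
    rw [← this]
    congr 1 with x
    ring

/-- The tower property: a function of $W$ is also one of $(L,W)$, hence orthogonal both to $u-m$ and
to $u-r$, and $r-m$ is their difference. -/
theorem orth_sub (h : IsRegression P a u m r) (β : 𝒲 → ℝ) (hβ : Measurable β)
    (hβ2 : MemLp (fun x => β (baseline x)) 2 (armLaw P a)) :
    ∫ x, β (baseline x) * (r (shortTerm x, baseline x) - m (baseline x)) ∂(armLaw P a) = 0 := by
  have e1 := h.orth_m β hβ hβ2
  have e2 := h.orth_r (fun z => β z.2) (by fun_prop) hβ2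
  have i1 : Integrable (fun x => β (baseline x) * (u (outcome x) - m (baseline x)))
    (armLaw P a) := hβ2.integrable_mul (h.memLp_u.sub h.memLp_m)
  have i2 : Integrable (fun x => β (baseline x) * (u (outcome x) - r (shortTerm x, baseline x)))
    (armLaw P a) := hβ2.integrable_mul (h.memLp_u.sub h.memLp_r)
  have := integral_sub i1 i2
  rw [e1, e2, sub_zero] at this
  rw [← this]
  congr 1 with x
  ring

theorem integral_m (h : IsRegression P a u m r) (ha : 0 < armProb P a) :
    ∫ x, m (baseline x) ∂(armLaw P a) = ∫ x, u (outcome x) ∂(armLaw P a) := by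
  have := isProbabilityMeasure_armLaw ha
  have e := h.orth_m (fun _ => 1) measurable_const (memLp_const _)
  simp only [one_mul] at e
  rw [integral_sub (h.memLp_u.integrable one_le_two) (h.memLp_m.integrable one_le_two)] at e
  linarith

theorem memLp_uo (h : IsRegression P a u m r) :
    MemLp (fun x => u (outcome x) - r (shortTerm x, baseline x)) 2 (armLaw P a) :=
  h.memLp_u.sub h.memLp_r

theorem memLp_rm (h : IsRegression P a u m r) :
    MemLp (fun x => r (shortTerm x, baseline x) - m (baseline x)) 2 (armLaw P a) :=
  h.memLp_r.sub h.memLp_m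

theorem memLp_mc (h : IsRegression P a u m r) (ha : 0 < armProb P a) (c : ℝ) :
    MemLp (fun x => m (baseline x) - c) 2 (armLaw P a) := by
  have := isProbabilityMeasure_armLaw ha
  exact h.memLp_m.sub (memLp_const c)

/-- Decomposition of the second moment about the mean. -/
theorem integral_sq_sub_mean (h : IsRegression P a u m r) (ha : 0 < armProb P a) (c : ℝ) :
    ∫ x, (u (outcome x) - c) ^ 2 ∂(armLaw P a)
      = ∫ x, (u (outcome x) - r (shortTerm x, baseline x)) ^ 2 ∂(armLaw P a)
        + ∫ x, (r (shortTerm x, baseline x) - m (baseline x)) ^ 2 ∂(armLaw P a)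
        + ∫ x, (m (baseline x) - c) ^ 2 ∂(armLaw P a) := by
  have h1 := h.memLp_uo
  have h2 := h.memLp_rm
  have h3 := h.memLp_mc ha c
  have hm := h.measurable_m
  have hr := h.measurable_r
  have c1 : ∫ x, (r (shortTerm x, baseline x) - c) * (u (outcome x) - r (shortTerm x, baseline x))
      ∂(armLaw P a) = 0 := by
    have := isProbabilityMeasure_armLaw ha
    exact h.orth_r (fun z => r z - c) (by fun_prop) (h.memLp_r.sub (memLp_const c))
  have c2 : ∫ x, (m (baseline x) - c) * (r (shortTerm x, baseline x) - m (baseline x))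
      ∂(armLaw P a) = 0 := h.orth_sub (fun w => m w - c) (by fun_prop) h3
  have i4 : Integrable (fun x => (r (shortTerm x, baseline x) - c) *
      (u (outcome x) - r (shortTerm x, baseline x))) (armLaw P a) := by
    have := isProbabilityMeasure_armLaw ha
    exact (h.memLp_r.sub (memLp_const c)).integrable_mul h1
  have i5 : Integrable (fun x => (m (baseline x) - c) *
      (r (shortTerm x, baseline x) - m (baseline x))) (armLaw P a) := h3.integrable_mul h2
  have i12 : Integrable (fun x => (u (outcome x) - r (shortTerm x, baseline x)) ^ 2
      + (r (shortTerm x, baseline x) - m (baseline x)) ^ 2) (armLaw P a) :=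
    h1.integrable_sq.add h2.integrable_sq
  have i123 : Integrable (fun x => (u (outcome x) - r (shortTerm x, baseline x)) ^ 2
      + (r (shortTerm x, baseline x) - m (baseline x)) ^ 2 + (m (baseline x) - c) ^ 2)
      (armLaw P a) := i12.add h3.integrable_sq
  have i45 : Integrable (fun x => (r (shortTerm x, baseline x) - c) *
      (u (outcome x) - r (shortTerm x, baseline x)) + (m (baseline x) - c) *
      (r (shortTerm x, baseline x) - m (baseline x))) (armLaw P a) := i4.add i5
  rw [← integral_add h1.integrable_sq h2.integrable_sq, ← integral_add i12 h3.integrable_sq]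
  -- The cross terms arise from splitting $u-c=(u-r)+(r-c)$, and then $r-c=(r-m)+(m-c)$.
  have e : ∫ x, 2 * ((r (shortTerm x, baseline x) - c) *
      (u (outcome x) - r (shortTerm x, baseline x)) + (m (baseline x) - c) *
      (r (shortTerm x, baseline x) - m (baseline x))) ∂(armLaw P a) = 0 := by
    rw [integral_const_mul, integral_add i4 i5, c1, c2]; simp
  have key := integral_add i123 (i45.const_mul 2)
  rw [e, add_zero] at key
  rw [← key]
  congr 1 with x
  ring

end IsRegression

/-- The efficient influence function of `E(u(Y) | A = a)` at `P`. -/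
noncomputable def influence (P : ProbabilityMeasure (FullData 𝒲 ℒ)) (a : Bool) (u : ℝ → ℝ)
    (m : 𝒲 → ℝ) (r : ℒ × 𝒲 → ℝ) (o : ObsData 𝒲 ℒ) : ℝ :=
  (armProb P a * probY P)⁻¹ * (boolInd a o.2.1 * (obsY u o - obsY (fun _ => 1) o * obsLW r o))
    + (armProb P a * probL P)⁻¹ * (boolInd a o.2.1 * (obsLW r o - obsLW (fun z => m z.2) o))
    + (m o.1 - ∫ x, u (outcome x) ∂(armLaw P a))

theorem IsRegression.measurable_influence (h : IsRegression P a u m r) :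
    Measurable (influence P a u m r) := by
  have hm := h.measurable_m
  have hr := h.measurable_r
  have hu := h.measurable_u
  unfold influence
  fun_prop

theorem influence_sub (h : IsRegression P a u m r) (h' : IsRegression P a v n q)
    (ha : 0 < armProb P a) (o : ObsData 𝒲 ℒ) :
    influence P a (fun y => u y - v y) (fun w => m w - n w) (fun z => r z - q z) o
      = influence P a u m r o - influence P a v n q o := by
  have := isProbabilityMeasure_armLaw ha
  obtain ⟨w, b, l, y⟩ := o
  simp only [influence]
  rw [integral_sub (h.memLp_u.integrable one_le_two) (h'.memLp_u.integrable one_le_two)]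
  rcases l with l | l <;> rcases y with y | y <;>
    simp only [obsY, obsLW, Sum.elim_inl, Sum.elim_inr] <;> ring

/-- In `influence`, the regression on $(L,W)$ can be evaluated only when $L$ is seen, so it carries
the factor $C^YC^L$. Monotone censoring turns this into $C^Y$, which is why the formula holds almost
surely only. -/
theorem influence_observe (hP : InModel ρ P) : ∀ᵐ x ∂(P : Measure (FullData 𝒲 ℒ)),
    influence P a u m r (observe x)
      = (armProb P a * probY P)⁻¹ * (boolInd true (seenY x) * (boolInd a (arm x) *
          (u (outcome x) - r (shortTerm x, baseline x))))
        + (armProb P a * probL P)⁻¹ * (boolInd true (seenL x) * (boolInd a (arm x) *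
          (r (shortTerm x, baseline x) - m (baseline x))))
        + (m (baseline x) - ∫ x, u (outcome x) ∂(armLaw P a)) := by
  filter_upwards [hP.seenY_mul_seenL] with x hx
  simp only [influence, obsLW_observe, obsY_observe]
  have e1 : (observe x).1 = baseline x := rfl
  have e2 : (observe x).2.1 = arm x := rfl
  rw [e1, e2, mul_one, ← mul_assoc (boolInd true (seenY x)) (boolInd true (seenL x)), hx]
  ring

theorem memLp_boolInd_mul {f : FullData 𝒲 ℒ → Bool} (hf : Measurable f) (b : Bool)
    {Q : Measure (FullData 𝒲 ℒ)} {F : FullData 𝒲 ℒ → ℝ} (hF : MemLp F 2 Q) :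
    MemLp (fun x => boolInd b (f x) * F x) 2 Q := by
  have h1 : Measurable fun x => boolInd b (f x) := by fun_prop
  refine hF.of_le (h1.aestronglyMeasurable.mul hF.aestronglyMeasurable) (ae_of_all _ fun x => ?_)
  rw [norm_mul]
  exact mul_le_of_le_one_left (norm_nonneg _) (abs_boolInd_le _ _)

theorem IsRegression.memLp_influence (h : IsRegression P a u m r) (hP : InModel ρ P)
    (ha : 0 < armProb P a) :
    MemLp (influence P a u m r) 2 (obsLaw P : Measure (ObsData 𝒲 ℒ)) := by
  rw [memLp_obsLaw h.measurable_influence.aestronglyMeasurable]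
  have h3 := memLp_boolInd_mul measurable_seenY true (memLp_boolInd_arm_mul ha h.memLp_uo)
  have h2 := memLp_boolInd_mul measurable_seenL true (memLp_boolInd_arm_mul ha h.memLp_rm)
  have h1 := (hP.memLp_baseline ha h.measurable_m h.memLp_m).sub
    (memLp_const (∫ x, u (outcome x) ∂(armLaw P a)))
  have hsum := ((h3.const_mul (armProb P a * probY P)⁻¹).add
    (h2.const_mul (armProb P a * probL P)⁻¹)).add h1
  refine hsum.ae_eq ?_
  filter_upwards [influence_observe hP] with x hx
  rw [hx]
  rfl

/-- By independent censoring each product of two terms integrates to a censoring moment times $p_a$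
times an integral in the arm. For distinct terms the latter is zero by orthogonality. For a square,
the indicators are idempotent and contribute $p_ap_y$ or $p_ap_l$, cancelling one of two inverse
factors; the square of the baseline term passes from `P` to the arm by randomization. -/
theorem IsRegression.integral_influence_sq (h : IsRegression P a u m r) (hP : InModel ρ P)
    (ha : 0 < armProb P a) (hpy : 0 < probY P) :
    ∫ o, influence P a u m r o ^ 2 ∂(obsLaw P : Measure (ObsData 𝒲 ℒ))
      = (armProb P a * probY P)⁻¹ *
          ∫ x, (u (outcome x) - r (shortTerm x, baseline x)) ^ 2 ∂(armLaw P a)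
        + (armProb P a * probL P)⁻¹ *
          ∫ x, (r (shortTerm x, baseline x) - m (baseline x)) ^ 2 ∂(armLaw P a)
        + ∫ x, (m (baseline x) - ∫ x, u (outcome x) ∂(armLaw P a)) ^ 2 ∂(armLaw P a) := by
  have hm := h.measurable_m
  have hr := h.measurable_r
  have hu := h.measurable_u
  have hpl : 0 < probL P := hpy.trans_le hP.probY_le_probL
  set ψ := ∫ x, u (outcome x) ∂(armLaw P a) with hψ
  set c₃ := (armProb P a * probY P)⁻¹ with hc₃
  set c₂ := (armProb P a * probL P)⁻¹ with hc₂
  set T₃ : FullData 𝒲 ℒ → ℝ := fun x => boolInd true (seenY x) * (boolInd a (arm x) *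
    (u (outcome x) - r (shortTerm x, baseline x))) with hT₃
  set T₂ : FullData 𝒲 ℒ → ℝ := fun x => boolInd true (seenL x) * (boolInd a (arm x) *
    (r (shortTerm x, baseline x) - m (baseline x))) with hT₂
  set T₁ : FullData 𝒲 ℒ → ℝ := fun x => m (baseline x) - ψ with hT₁
  have L₃ : MemLp T₃ 2 (P : Measure (FullData 𝒲 ℒ)) :=
    memLp_boolInd_mul measurable_seenY _ (memLp_boolInd_arm_mul ha h.memLp_uo)
  have L₂ : MemLp T₂ 2 (P : Measure (FullData 𝒲 ℒ)) :=
    memLp_boolInd_mul measurable_seenL _ (memLp_boolInd_arm_mul ha h.memLp_rm)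
  have L₁ : MemLp T₁ 2 (P : Measure (FullData 𝒲 ℒ)) :=
    (hP.memLp_baseline ha h.measurable_m h.memLp_m).sub (memLp_const _)
  have hψ1 : ∫ x, (m (baseline x) - ψ) * (r (shortTerm x, baseline x) - m (baseline x))
      ∂(armLaw P a) = 0 :=
    h.orth_sub (fun w => m w - ψ) (by fun_prop) (h.memLp_mc ha ψ)
  have s₃ : ∫ x, T₃ x ^ 2 ∂(P : Measure (FullData 𝒲 ℒ)) = probY P * (armProb P a *
      ∫ x, (u (outcome x) - r (shortTerm x, baseline x)) ^ 2 ∂(armLaw P a)) := by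
    rw [← integral_boolInd_seenY, ← hP.integral_censoring_mul ha (fun c => boolInd true c.2)
      (F := fun w l y => (u y - r (l, w)) ^ 2) (by fun_prop)]
    congr 1 with x
    simp only [hT₃, mul_pow]
    rw [pow_two (boolInd _ _), boolInd_mul_self, pow_two (boolInd _ _), boolInd_mul_self]
  have s₂ : ∫ x, T₂ x ^ 2 ∂(P : Measure (FullData 𝒲 ℒ)) = probL P * (armProb P a *
      ∫ x, (r (shortTerm x, baseline x) - m (baseline x)) ^ 2 ∂(armLaw P a)) := by
    rw [← integral_boolInd_seenL, ← hP.integral_censoring_mul ha (fun c => boolInd true c.1)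
      (F := fun w l y => (r (l, w) - m w) ^ 2) (by fun_prop)]
    congr 1 with x
    simp only [hT₂, mul_pow]
    rw [pow_two (boolInd _ _), boolInd_mul_self, pow_two (boolInd _ _), boolInd_mul_self]
  have s₁ : ∫ x, T₁ x ^ 2 ∂(P : Measure (FullData 𝒲 ℒ))
      = ∫ x, (m (baseline x) - ψ) ^ 2 ∂(armLaw P a) :=
    (hP.integral_baseline ha (b := fun w => (m w - ψ) ^ 2) (by fun_prop)).symm
  have x₃₂ : ∫ x, T₃ x * T₂ x ∂(P : Measure (FullData 𝒲 ℒ)) = 0 := by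
    have e := hP.integral_censoring_mul ha (fun c => boolInd true c.2 * boolInd true c.1)
      (F := fun w l y => (r (l, w) - m w) * (u y - r (l, w))) (by fun_prop)
    rw [h.orth_r (fun z => r z - m z.2) (by fun_prop) h.memLp_rm, mul_zero, mul_zero] at e
    rw [← e]
    congr 1 with x
    simp only [hT₃, hT₂]
    linear_combination (boolInd true (seenY x) * boolInd true (seenL x) *
      (r (shortTerm x, baseline x) - m (baseline x)) *
      (u (outcome x) - r (shortTerm x, baseline x))) * boolInd_mul_self a (arm x)
  have x₃₁ : ∫ x, T₃ x * T₁ x ∂(P : Measure (FullData 𝒲 ℒ)) = 0 := by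
    have e := hP.integral_censoring_mul ha (fun c => boolInd true c.2)
      (F := fun w l y => (m w - ψ) * (u y - r (l, w))) (by fun_prop)
    rw [h.orth_r (fun z => m z.2 - ψ) (by fun_prop) (h.memLp_mc ha ψ), mul_zero, mul_zero] at e
    rw [← e]
    congr 1 with x
    simp only [hT₃, hT₁]
    ring
  have x₂₁ : ∫ x, T₂ x * T₁ x ∂(P : Measure (FullData 𝒲 ℒ)) = 0 := by
    have e := hP.integral_censoring_mul ha (fun c => boolInd true c.1)
      (F := fun w l y => (m w - ψ) * (r (l, w) - m w)) (by fun_prop)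
    rw [hψ1, mul_zero, mul_zero] at e
    rw [← e]
    congr 1 with x
    simp only [hT₂, hT₁]
    ring
  rw [integral_obsLaw (f := fun o => influence P a u m r o ^ 2)
    (h.measurable_influence.pow_const 2).aestronglyMeasurable]
  have i₃ := L₃.integrable_sq
  have i₂ := L₂.integrable_sq
  have i₁ := L₁.integrable_sq
  have j₃₂ : Integrable (fun x => T₃ x * T₂ x) (P : Measure (FullData 𝒲 ℒ)) := L₃.integrable_mul L₂
  have j₃₁ : Integrable (fun x => T₃ x * T₁ x) (P : Measure (FullData 𝒲 ℒ)) := L₃.integrable_mul L₁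
  have j₂₁ : Integrable (fun x => T₂ x * T₁ x) (P : Measure (FullData 𝒲 ℒ)) := L₂.integrable_mul L₁
  have expand : ∫ x, influence P a u m r (observe x) ^ 2 ∂(P : Measure (FullData 𝒲 ℒ))
      = ∫ x, (c₃ ^ 2 * T₃ x ^ 2 + (c₂ ^ 2 * T₂ x ^ 2 + (T₁ x ^ 2 + (2 * c₃ * c₂ * (T₃ x * T₂ x)
        + (2 * c₃ * (T₃ x * T₁ x) + 2 * c₂ * (T₂ x * T₁ x))))))
          ∂(P : Measure (FullData 𝒲 ℒ)) := by
    refine integral_congr_ae ?_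
    filter_upwards [influence_observe hP] with x hx
    rw [hx]
    simp only [hT₃, hT₂, hT₁]
    ring
  have k₁ := (j₃₁.const_mul (2 * c₃)).add (j₂₁.const_mul (2 * c₂))
  have k₂ := (j₃₂.const_mul (2 * c₃ * c₂)).add k₁
  have k₃ := i₁.add k₂
  have k₄ := (i₂.const_mul (c₂ ^ 2)).add k₃
  simp only [Pi.add_def] at k₁ k₂ k₃ k₄
  rw [expand, integral_add (i₃.const_mul _) k₄, integral_add (i₂.const_mul _) k₃,
    integral_add i₁ k₂, integral_add (j₃₂.const_mul _) k₁, integral_add (j₃₁.const_mul _)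
    (j₂₁.const_mul _)]
  simp only [integral_const_mul]
  rw [s₃, s₂, s₁, x₃₂, x₃₁, x₂₁, hc₃, hc₂]
  field_simp
  ring

end Regression
/-! ### The derivative of the estimand along a regular submodel -/

section Derivative

variable {𝒲 ℒ : Type*} [MeasurableSpace 𝒲] [MeasurableSpace ℒ] {ρ : ℝ}
  {P : ProbabilityMeasure (FullData 𝒲 ℒ)} {a : Bool}
  {Pt : ℝ → ProbabilityMeasure (FullData 𝒲 ℒ)} {g : ObsData 𝒲 ℒ → ℝ}
  {m : 𝒲 → ℝ} {r : ℒ × 𝒲 → ℝ}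

namespace IsRegularSubmodel

theorem memLp_score_observe (h : IsRegularSubmodel ρ P Pt g) :
    MemLp (fun x => g (observe x)) 2 (P : Measure (FullData 𝒲 ℒ)) :=
  (memLp_obsLaw h.memLp_score.aestronglyMeasurable).1 h.memLp_score

theorem hasDerivAt_integral_observe (h : IsRegularSubmodel ρ P Pt g) {f : ObsData 𝒲 ℒ → ℝ}
    (hf : Measurable f) {C : ℝ}
    (hfL : ∀ᶠ t in 𝓝 (0 : ℝ), MemLp f 2 (obsLaw (Pt t) : Measure (ObsData 𝒲 ℒ)))
    (hC : ∀ᶠ t in 𝓝 (0 : ℝ), ∫ o, f o ^ 2 ∂(obsLaw (Pt t) : Measure (ObsData 𝒲 ℒ)) ≤ C) :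
    HasDerivAt (fun t => ∫ x, f (observe x) ∂(Pt t : Measure (FullData 𝒲 ℒ)))
      (∫ x, f (observe x) * g (observe x) ∂(P : Measure (FullData 𝒲 ℒ))) 0 := by
  have := h.hasDerivAt_integral hf hfL hC
  rw [integral_obsLaw (f := fun o => f o * g o)
    (hf.aestronglyMeasurable.mul h.memLp_score.aestronglyMeasurable)] at this
  simpa only [integral_obsLaw hf.aestronglyMeasurable] using this

theorem hasDerivAt_integral_of_bounded (h : IsRegularSubmodel ρ P Pt g) {f : ObsData 𝒲 ℒ → ℝ}
    (hf : Measurable f) {K : ℝ} (hK : ∀ o, |f o| ≤ K) :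
    HasDerivAt (fun t => ∫ x, f (observe x) ∂(Pt t : Measure (FullData 𝒲 ℒ)))
      (∫ x, f (observe x) * g (observe x) ∂(P : Measure (FullData 𝒲 ℒ))) 0 := by
  have hL : ∀ t, MemLp f 2 (obsLaw (Pt t) : Measure (ObsData 𝒲 ℒ)) := fun t =>
    MemLp.of_bound hf.aestronglyMeasurable K (ae_of_all _ hK)
  refine h.hasDerivAt_integral_observe hf (C := K ^ 2) (Eventually.of_forall hL)
    (Eventually.of_forall fun t => ?_)
  have := integral_mono (hL t).integrable_sq (integrable_const (K ^ 2))
    fun o => sq_le_sq' (abs_le.1 (hK o)).1 (abs_le.1 (hK o)).2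
  simpa using this

/-- The total mass is constantly one along the path. -/
theorem integral_score (h : IsRegularSubmodel ρ P Pt g) :
    ∫ x, g (observe x) ∂(P : Measure (FullData 𝒲 ℒ)) = 0 := by
  have h1 := h.hasDerivAt_integral_of_bounded (f := fun _ => 1) measurable_const (K := 1) (by simp)
  simp only [integral_const, probReal_univ, one_mul, smul_eq_mul, mul_one] at h1
  exact h1.unique (hasDerivAt_const 0 (1 : ℝ))

theorem hasDerivAt_probY (h : IsRegularSubmodel ρ P Pt g) :
    HasDerivAt (fun t => probY (Pt t))
      (∫ x, boolInd true (seenY x) * g (observe x) ∂(P : Measure (FullData 𝒲 ℒ))) 0 := by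
  have := h.hasDerivAt_integral_of_bounded (f := obsY fun _ => 1) (by fun_prop) (K := 1) (by
    rintro ⟨w, b, l, y | y⟩ <;> simp [obsY])
  simpa only [obsY_observe, mul_one, integral_boolInd_seenY] using this

theorem hasDerivAt_probL (h : IsRegularSubmodel ρ P Pt g) :
    HasDerivAt (fun t => probL (Pt t))
      (∫ x, boolInd true (seenL x) * g (observe x) ∂(P : Measure (FullData 𝒲 ℒ))) 0 := by
  have := h.hasDerivAt_integral_of_bounded (f := obsLW fun _ => 1) (by fun_prop) (K := 1) (by
    rintro ⟨w, b, l | l, y⟩ <;> simp [obsLW])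
  simpa only [obsLW_observe, mul_one, integral_boolInd_seenL] using this

/-- The randomization probability is known, so $p_a$ acts as a constant in all differentiations
below. -/
theorem armProb_eq (h : IsRegularSubmodel ρ P Pt g) (hP : InModel ρ P) (a : Bool) :
    ∀ᶠ t in 𝓝 (0 : ℝ), armProb (Pt t) a = armProb P a := by
  filter_upwards [h.mem_model] with t ht
  rw [ht.armProb_eq, hP.armProb_eq]

theorem unique_deriv_zero {F F' : ℝ → ℝ} {d d' : ℝ} (h : HasDerivAt F d 0)
    (h' : HasDerivAt F' d' 0) (he : F =ᶠ[𝓝 0] F') : d = d' :=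
  h.unique (h'.congr_of_eventuallyEq he)

/-- The product rule applied to $E_t\{b(W)C^Y1(A=a)\}=p_a\,p_y(t)\,E_t\{b(W)\}$, which holds for all
laws of the model by randomization and independent censoring. -/
theorem integral_baseline_score_of_bounded (h : IsRegularSubmodel ρ P Pt g) (hP : InModel ρ P)
    (ha : 0 < armProb P a) {b : 𝒲 → ℝ} (hb : Measurable b) {K : ℝ} (hK : ∀ w, |b w| ≤ K) :
    ∫ x, b (baseline x) * (boolInd true (seenY x) * (boolInd a (arm x) * g (observe x)))
        ∂(P : Measure (FullData 𝒲 ℒ))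
      = armProb P a * ((∫ x, boolInd true (seenY x) * g (observe x)
            ∂(P : Measure (FullData 𝒲 ℒ))) * (∫ x, b (baseline x) ∂(P : Measure (FullData 𝒲 ℒ)))
          + probY P * ∫ x, b (baseline x) * g (observe x) ∂(P : Measure (FullData 𝒲 ℒ))) := by
  have hm : Measurable fun o : ObsData 𝒲 ℒ => b o.1 := by fun_prop
  have d1 := h.hasDerivAt_integral_of_bounded
    (f := fun o => b o.1 * (obsY (fun _ => 1) o * boolInd a o.2.1)) (by fun_prop) (K := K) (by
      rintro ⟨w, c, l, y | y⟩
      · simp only [obsY, Sum.elim_inl, one_mul, abs_mul]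
        exact (mul_le_of_le_one_right (abs_nonneg _) (abs_boolInd_le _ _)).trans (hK w)
      · simpa [obsY] using (abs_nonneg _).trans (hK w))
  have d2 := (h.hasDerivAt_probY.mul
    (h.hasDerivAt_integral_of_bounded hm (K := K) fun o => hK o.1)).const_mul (armProb P a)
  have he : (fun t => ∫ x, b (observe x).1 * (obsY (fun _ => 1) (observe x) *
        boolInd a (observe x).2.1) ∂(Pt t : Measure (FullData 𝒲 ℒ)))
      =ᶠ[𝓝 0] fun t => armProb P a * (probY (Pt t) *
        ∫ x, b (observe x).1 ∂(Pt t : Measure (FullData 𝒲 ℒ))) := by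
    filter_upwards [h.mem_model, h.armProb_eq hP a] with t ht hta
    have ha' : 0 < armProb (Pt t) a := hta ▸ ha
    have e := ht.integral_censoring_mul ha' (fun c => boolInd true c.2)
      (F := fun w _ _ => b w) (by fun_prop)
    rw [integral_boolInd_seenY, ht.integral_baseline ha' hb, hta] at e
    calc _ = _ := by
          congr 1 with x
          rw [obsY_observe, mul_one]
          change b (baseline x) * (boolInd true (seenY x) * boolInd a (arm x))
            = boolInd true (seenY x) * (boolInd a (arm x) * b (baseline x))
          ring
      _ = _ := e
      _ = _ := by
        change _ = armProb P a * (probY (Pt t) *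
          ∫ x, b (baseline x) ∂(Pt t : Measure (FullData 𝒲 ℒ)))
        ring
  have := unique_deriv_zero d1 d2 he
  rw [h.at_zero] at this
  calc _ = _ := by
        congr 1 with x
        rw [obsY_observe, mul_one]
        change _ = b (baseline x) * (boolInd true (seenY x) * boolInd a (arm x)) * _
        ring
    _ = _ := this
    _ = _ := rfl

/-- Scores are compatible with known randomization and independent censoring. -/
theorem integral_baseline_score (h : IsRegularSubmodel ρ P Pt g) (hP : InModel ρ P)
    (ha : 0 < armProb P a) {b : 𝒲 → ℝ} (hb : Measurable b)
    (hb2 : MemLp (fun x => b (baseline x)) 2 (P : Measure (FullData 𝒲 ℒ))) :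
    ∫ x, b (baseline x) * (boolInd true (seenY x) * (boolInd a (arm x) * g (observe x)))
        ∂(P : Measure (FullData 𝒲 ℒ))
      = armProb P a * ((∫ x, boolInd true (seenY x) * g (observe x)
            ∂(P : Measure (FullData 𝒲 ℒ))) * (∫ x, b (baseline x) ∂(P : Measure (FullData 𝒲 ℒ)))
          + probY P * ∫ x, b (baseline x) * g (observe x) ∂(P : Measure (FullData 𝒲 ℒ))) := by
  have hG := h.memLp_score_observe
  have hH := memLp_boolInd_mul measurable_seenY true (memLp_boolInd_mul measurable_arm a hG)
  have hbm : Measurable fun x : FullData 𝒲 ℒ => b (baseline x) := by fun_prop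
  have t1 := tendsto_integral_clip_mul hbm hH.aestronglyMeasurable (hb2.integrable_mul hH)
  have t2 := tendsto_integral_clip_mul hbm (H := fun _ => 1) (μ := (P : Measure (FullData 𝒲 ℒ)))
    aestronglyMeasurable_const (by simpa using hb2.integrable one_le_two)
  have t3 := tendsto_integral_clip_mul hbm hG.aestronglyMeasurable (hb2.integrable_mul hG)
  simp only [mul_one] at t2
  refine tendsto_nhds_unique t1 (Tendsto.congr (fun k => ?_)
    (((t2.const_mul _).add (t3.const_mul _)).const_mul _))
  exact (h.integral_baseline_score_of_bounded hP ha (b := fun w => clip k (b w))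
    ((measurable_clip k).comp hb) (K := k) fun w => abs_clip_le (Nat.cast_nonneg k) _).symm

/-- In the model, $E_t\{b\,C^Y1(A=a)\}$ and $E_t\{b\,C^L1(A=a)\}$ are $p_y(t)$ and $p_l(t)$ times
the same quantity $p_aE_{t,a}(b)$. Cross-multiplication gives an identity free of that quantity, and
the product rule is applied to both of its sides. -/
theorem integral_shortTerm_score_of_bounded (h : IsRegularSubmodel ρ P Pt g) (hP : InModel ρ P)
    (ha : 0 < armProb P a) {b : ℒ × 𝒲 → ℝ} (hb : Measurable b) {K : ℝ} (hK : ∀ z, |b z| ≤ K) :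
    (∫ x, b (shortTerm x, baseline x) *
          (boolInd true (seenY x) * (boolInd a (arm x) * g (observe x)))
          ∂(P : Measure (FullData 𝒲 ℒ))) * probL P
        + probY P * (armProb P a * ∫ x, b (shortTerm x, baseline x) ∂(armLaw P a)) *
          (∫ x, boolInd true (seenL x) * g (observe x) ∂(P : Measure (FullData 𝒲 ℒ)))
      = (∫ x, b (shortTerm x, baseline x) *
          (boolInd true (seenL x) * (boolInd a (arm x) * g (observe x)))
          ∂(P : Measure (FullData 𝒲 ℒ))) * probY P
        + probL P * (armProb P a * ∫ x, b (shortTerm x, baseline x) ∂(armLaw P a)) *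
          (∫ x, boolInd true (seenY x) * g (observe x) ∂(P : Measure (FullData 𝒲 ℒ))) := by
  have hbd : ∀ (l : ℒ ⊕ Unit) (w : 𝒲) (c : Bool) (y : ℝ ⊕ Unit),
      |obsLW b (w, c, l, y)| ≤ K := by
    rintro (l | l) w c y
    · exact hK _
    -- Nonnegativity of `K` is read off at a point of `ℒ`. There is one, since a probability measure
    -- lives on a nonempty space.
    · rcases isEmpty_or_nonempty ℒ with hℒ | ⟨⟨l'⟩⟩
      · exact (hℒ.false (shortTerm (Classical.choice P.nonempty))).elim
      · simpa [obsLW] using (abs_nonneg _).trans (hK (l', w))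
  have d1 := (h.hasDerivAt_integral_of_bounded
    (f := fun o => boolInd a o.2.1 * (obsY (fun _ => 1) o * obsLW b o)) (by fun_prop) (K := K) (by
      rintro ⟨w, c, l, y | y⟩
      · simp only [obsY, Sum.elim_inl, one_mul, abs_mul]
        exact (mul_le_of_le_one_left (abs_nonneg _) (abs_boolInd_le _ _)).trans (hbd _ _ _ _)
      · simpa [obsY] using (abs_nonneg _).trans (hbd l w c (Sum.inr y)))).mul h.hasDerivAt_probL
  have d2 := (h.hasDerivAt_integral_of_bounded
    (f := fun o => boolInd a o.2.1 * obsLW b o) (by fun_prop) (K := K) (by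
      rintro ⟨w, c, l, y⟩
      rw [abs_mul]
      exact (mul_le_of_le_one_left (abs_nonneg _) (abs_boolInd_le _ _)).trans
        (hbd _ _ _ _))).mul h.hasDerivAt_probY
  have e1 : ∀ t, InModel ρ (Pt t) → 0 < armProb (Pt t) a →
      ∫ x, boolInd a (observe x).2.1 * (obsY (fun _ => 1) (observe x) * obsLW b (observe x))
        ∂(Pt t : Measure (FullData 𝒲 ℒ))
      = probY (Pt t) * (armProb (Pt t) a *
          ∫ x, b (shortTerm x, baseline x) ∂(armLaw (Pt t) a)) := by
    intro t ht ha'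
    rw [← integral_boolInd_seenY, ← ht.integral_censoring_mul ha' (fun c => boolInd true c.2)
      (F := fun w l _ => b (l, w)) (by fun_prop)]
    refine integral_congr_ae ?_
    filter_upwards [ht.seenY_mul_seenL] with x hx
    rw [obsY_observe, obsLW_observe, mul_one, ← mul_assoc (boolInd true (seenY x)), hx]
    change boolInd a (arm x) * _ = _
    ring
  have e2 : ∀ t, InModel ρ (Pt t) → 0 < armProb (Pt t) a →
      ∫ x, boolInd a (observe x).2.1 * obsLW b (observe x) ∂(Pt t : Measure (FullData 𝒲 ℒ))
      = probL (Pt t) * (armProb (Pt t) a *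
          ∫ x, b (shortTerm x, baseline x) ∂(armLaw (Pt t) a)) := by
    intro t ht ha'
    rw [← integral_boolInd_seenL, ← ht.integral_censoring_mul ha' (fun c => boolInd true c.1)
      (F := fun w l _ => b (l, w)) (by fun_prop)]
    congr 1 with x
    rw [obsLW_observe]
    change boolInd a (arm x) * _ = _
    ring
  have he : ((fun t => ∫ x, boolInd a (observe x).2.1 * (obsY (fun _ => 1) (observe x) *
        obsLW b (observe x)) ∂(Pt t : Measure (FullData 𝒲 ℒ))) * fun t => probL (Pt t))
      =ᶠ[𝓝 0] (fun t => ∫ x, boolInd a (observe x).2.1 * obsLW b (observe x)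
        ∂(Pt t : Measure (FullData 𝒲 ℒ))) * fun t => probY (Pt t) := by
    filter_upwards [h.mem_model, h.armProb_eq hP a] with t ht hta
    have ha' : 0 < armProb (Pt t) a := hta ▸ ha
    simp only [Pi.mul_apply]
    rw [e1 t ht ha', e2 t ht ha']
    ring
  have key := unique_deriv_zero d1 d2 he
  have ha0 : 0 < armProb (Pt 0) a := by rw [h.at_zero]; exact ha
  rw [e1 0 h.mem_model.self_of_nhds ha0, e2 0 h.mem_model.self_of_nhds ha0, h.at_zero] at key
  have f1 : ∫ x, boolInd a (observe x).2.1 * (obsY (fun _ => 1) (observe x) *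
        obsLW b (observe x)) * g (observe x) ∂(P : Measure (FullData 𝒲 ℒ))
      = ∫ x, b (shortTerm x, baseline x) *
          (boolInd true (seenY x) * (boolInd a (arm x) * g (observe x)))
          ∂(P : Measure (FullData 𝒲 ℒ)) := by
    refine integral_congr_ae ?_
    filter_upwards [hP.seenY_mul_seenL] with x hx
    rw [obsY_observe, obsLW_observe, mul_one, ← mul_assoc (boolInd true (seenY x)), hx]
    change boolInd a (arm x) * _ * _ = _
    ring
  have f2 : ∫ x, boolInd a (observe x).2.1 * obsLW b (observe x) * g (observe x)
        ∂(P : Measure (FullData 𝒲 ℒ))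
      = ∫ x, b (shortTerm x, baseline x) *
          (boolInd true (seenL x) * (boolInd a (arm x) * g (observe x)))
          ∂(P : Measure (FullData 𝒲 ℒ)) := by
    congr 1 with x
    rw [obsLW_observe]
    change boolInd a (arm x) * _ * _ = _
    ring
  rw [f1, f2] at key
  exact key

/-- Scores are compatible with independent monotone censoring. -/
theorem integral_shortTerm_score (h : IsRegularSubmodel ρ P Pt g) (hP : InModel ρ P)
    (ha : 0 < armProb P a) {b : ℒ × 𝒲 → ℝ} (hb : Measurable b)
    (hb2 : MemLp (fun x => b (shortTerm x, baseline x)) 2 (armLaw P a))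
    (hb0 : ∫ x, b (shortTerm x, baseline x) ∂(armLaw P a) = 0) :
    (∫ x, b (shortTerm x, baseline x) *
          (boolInd true (seenY x) * (boolInd a (arm x) * g (observe x)))
          ∂(P : Measure (FullData 𝒲 ℒ))) * probL P
      = (∫ x, b (shortTerm x, baseline x) *
          (boolInd true (seenL x) * (boolInd a (arm x) * g (observe x)))
          ∂(P : Measure (FullData 𝒲 ℒ))) * probY P := by
  have := isProbabilityMeasure_armLaw ha
  have hG := h.memLp_score_observe
  have hH1 := memLp_boolInd_mul measurable_seenY true (memLp_boolInd_mul measurable_arm a hG)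
  have hH2 := memLp_boolInd_mul measurable_seenL true (memLp_boolInd_mul measurable_arm a hG)
  have hbm : Measurable fun x : FullData 𝒲 ℒ => b (shortTerm x, baseline x) := by fun_prop
  -- Square integrability of `b` is known in arm `a` only, so the arm indicator is attached to `b`
  -- rather than to the score.
  have hAb := memLp_boolInd_arm_mul ha hb2
  have j1 : Integrable (fun x => b (shortTerm x, baseline x) *
      (boolInd true (seenY x) * (boolInd a (arm x) * g (observe x))))
      (P : Measure (FullData 𝒲 ℒ)) :=
    (hAb.integrable_mul (memLp_boolInd_mul measurable_seenY true hG)).congr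
      (ae_of_all _ fun x => by simp only [Pi.mul_apply]; ring)
  have j2 : Integrable (fun x => b (shortTerm x, baseline x) *
      (boolInd true (seenL x) * (boolInd a (arm x) * g (observe x))))
      (P : Measure (FullData 𝒲 ℒ)) :=
    (hAb.integrable_mul (memLp_boolInd_mul measurable_seenL true hG)).congr
      (ae_of_all _ fun x => by simp only [Pi.mul_apply]; ring)
  have t1 := tendsto_integral_clip_mul hbm hH1.aestronglyMeasurable j1
  have t2 := tendsto_integral_clip_mul hbm hH2.aestronglyMeasurable j2
  have t3 := tendsto_integral_clip_mul hbm (H := fun _ => 1) (μ := armLaw P a)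
    aestronglyMeasurable_const (by simpa using hb2.integrable one_le_two)
  simp only [mul_one] at t3
  have lhs := (t1.mul_const (probL P)).add (((t3.const_mul (armProb P a)).const_mul
    (probY P)).mul_const (∫ x, boolInd true (seenL x) * g (observe x)
      ∂(P : Measure (FullData 𝒲 ℒ))))
  have rhs := (t2.mul_const (probY P)).add (((t3.const_mul (armProb P a)).const_mul
    (probL P)).mul_const (∫ x, boolInd true (seenY x) * g (observe x)
      ∂(P : Measure (FullData 𝒲 ℒ))))
  have key := tendsto_nhds_unique lhs (rhs.congr fun k =>
    (h.integral_shortTerm_score_of_bounded hP ha (b := fun z => clip k (b z))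
      ((measurable_clip k).comp hb) (K := k) fun w => abs_clip_le (Nat.cast_nonneg k) _).symm)
  -- In the limit, the mean-zero assumption removes the two terms carrying the derivatives of $p_l$
  -- and $p_y$.
  simpa [hb0] using key

/-- The product rule for $E_t\{Y\,C^Y1(A=a)\}=p_a\,p_y(t)\,E_t(Y\mid A=a)$. The statistic is
unbounded; its second moment is controlled near $t=0$ by the moment bound in the definition of a
regular submodel. -/
theorem integral_outcome_score (h : IsRegularSubmodel ρ P Pt g) (hP : InModel ρ P)
    (ha : 0 < armProb P a) {d : ℝ} (hd : HasDerivAt (fun t => armMean (Pt t) a) d 0) :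
    ∫ x, outcome x * (boolInd true (seenY x) * (boolInd a (arm x) * g (observe x)))
        ∂(P : Measure (FullData 𝒲 ℒ))
      = armProb P a * ((∫ x, boolInd true (seenY x) * g (observe x)
            ∂(P : Measure (FullData 𝒲 ℒ))) * armMean P a + probY P * d) := by
  obtain ⟨C, hC⟩ := h.moment_bound
  set f : ObsData 𝒲 ℒ → ℝ := fun o => boolInd a o.2.1 * obsY (fun y => y) o with hf
  have hfm : Measurable f := by fun_prop
  have hfo : ∀ x, f (observe x)
      = boolInd true (seenY x) * (boolInd a (arm x) * outcome x) := fun x => by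
    simp only [hf, obsY_observe]
    change boolInd a (arm x) * _ = _
    ring
  have hL : ∀ t, InModel ρ (Pt t) →
      MemLp (fun x => f (observe x)) 2 (Pt t : Measure (FullData 𝒲 ℒ)) := fun t ht => by
    simp only [hfo]
    exact memLp_boolInd_mul measurable_seenY true
      (memLp_boolInd_mul measurable_arm a ht.memLp_outcome)
  have d1 := h.hasDerivAt_integral_observe hfm (C := C) (by
      filter_upwards [h.mem_model] with t ht
      exact (memLp_obsLaw hfm.aestronglyMeasurable).2 (hL t ht)) (by
      filter_upwards [h.mem_model, hC] with t ht htC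
      rw [integral_obsLaw (f := fun o => f o ^ 2) (hfm.pow_const 2).aestronglyMeasurable]
      refine (integral_mono (hL t ht).integrable_sq ht.memLp_outcome.integrable_sq
        fun x => ?_).trans ?_
      · simp only [hfo]
        refine sq_le_sq.2 ?_
        rw [abs_mul, abs_mul]
        exact (mul_le_of_le_one_left (by positivity) (abs_boolInd_le _ _)).trans
          (mul_le_of_le_one_left (abs_nonneg _) (abs_boolInd_le _ _))
      · rw [integral_eq_lintegral_of_nonneg_ae (ae_of_all _ fun x => sq_nonneg _)
          ht.memLp_outcome.integrable_sq.aestronglyMeasurable]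
        exact ENNReal.toReal_le_coe_of_le_coe htC)
  have d2 := (h.hasDerivAt_probY.mul hd).const_mul (armProb P a)
  have he : (fun t => ∫ x, f (observe x) ∂(Pt t : Measure (FullData 𝒲 ℒ)))
      =ᶠ[𝓝 0] fun t => armProb P a * (probY (Pt t) * armMean (Pt t) a) := by
    filter_upwards [h.mem_model, h.armProb_eq hP a] with t ht hta
    have ha' : 0 < armProb (Pt t) a := hta ▸ ha
    have e := ht.integral_censoring_mul ha' (fun c => boolInd true c.2)
      (F := fun _ _ y => y) (by fun_prop)
    rw [integral_boolInd_seenY, hta] at e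
    simp only [hfo]
    rw [e, armMean]
    ring
  have key := unique_deriv_zero d1 d2 he
  rw [h.at_zero] at key
  rw [← key]
  congr 1 with x
  rw [hfo]
  ring

/-- The derivative of the estimand is the inner product of the efficient influence function and
the score. -/
theorem deriv_armMean_eq (h : IsRegularSubmodel ρ P Pt g) (hP : InModel ρ P)
    (ha : 0 < armProb P a) (hpy : 0 < probY P) (hr : IsRegression P a (fun y => y) m r) {d : ℝ}
    (hd : HasDerivAt (fun t => armMean (Pt t) a) d 0) :
    d = ∫ o, influence P a (fun y => y) m r o * g o ∂(obsLaw P : Measure (ObsData 𝒲 ℒ)) := by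
  have hpl : 0 < probL P := hpy.trans_le hP.probY_le_probL
  have hG := h.memLp_score_observe
  have hm2 := hP.memLp_baseline ha hr.measurable_m hr.memLp_m
  have hmm := hr.measurable_m
  have hrm := hr.measurable_r
  have E1 := h.integral_baseline_score hP ha hr.measurable_m hm2
  have E2 := h.integral_shortTerm_score hP ha (b := fun z => r z - m z.2) (by fun_prop) hr.memLp_rm
    (by
      have := isProbabilityMeasure_armLaw ha
      simpa using hr.orth_sub (fun _ => 1) measurable_const (memLp_const _))
  have E3 := h.integral_outcome_score hP ha hd
  rw [← hP.integral_baseline ha hr.measurable_m, hr.integral_m ha] at E1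
  have L1 := memLp_boolInd_mul measurable_seenY true hG
  have L2 := memLp_boolInd_mul measurable_seenL true hG
  have aY := memLp_boolInd_mul measurable_arm a hP.memLp_outcome
  have aM := memLp_boolInd_mul measurable_arm a hm2
  have aR := memLp_boolInd_arm_mul ha hr.memLp_rm
  have iY : Integrable (fun x => outcome x * (boolInd true (seenY x) * (boolInd a (arm x) *
      g (observe x)))) (P : Measure (FullData 𝒲 ℒ)) :=
    (aY.integrable_mul L1).congr (ae_of_all _ fun x => by simp only [Pi.mul_apply]; ring)
  have iM : Integrable (fun x => m (baseline x) * (boolInd true (seenY x) * (boolInd a (arm x) *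
      g (observe x)))) (P : Measure (FullData 𝒲 ℒ)) :=
    (aM.integrable_mul L1).congr (ae_of_all _ fun x => by simp only [Pi.mul_apply]; ring)
  have iR : Integrable (fun x => (r (shortTerm x, baseline x) - m (baseline x)) *
      (boolInd true (seenY x) * (boolInd a (arm x) * g (observe x))))
      (P : Measure (FullData 𝒲 ℒ)) :=
    (aR.integrable_mul L1).congr (ae_of_all _ fun x => by simp only [Pi.mul_apply]; ring)
  have iL : Integrable (fun x => (r (shortTerm x, baseline x) - m (baseline x)) *
      (boolInd true (seenL x) * (boolInd a (arm x) * g (observe x))))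
      (P : Measure (FullData 𝒲 ℒ)) :=
    (aR.integrable_mul L2).congr (ae_of_all _ fun x => by simp only [Pi.mul_apply]; ring)
  have iG : Integrable (fun x => g (observe x)) (P : Measure (FullData 𝒲 ℒ)) :=
    hG.integrable one_le_two
  have iMG : Integrable (fun x => m (baseline x) * g (observe x)) (P : Measure (FullData 𝒲 ℒ)) :=
    hm2.integrable_mul hG
  rw [integral_obsLaw (f := fun o => influence P a (fun y => y) m r o * g o)
    (hr.measurable_influence.aestronglyMeasurable.mul h.memLp_score.aestronglyMeasurable)]
  set c₃ := (armProb P a * probY P)⁻¹ with hc₃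
  set c₂ := (armProb P a * probL P)⁻¹ with hc₂
  set ψ := ∫ x, outcome x ∂(armLaw P a) with hψ
  -- The residual is split as $Y-r=Y-(r-m)-m$ to match the three score identities. By `E2` the two
  -- terms with $r-m$ cancel. In `E3` minus `E1` the derivative of $p_y$ drops out, because
  -- $E(m)=\psi$, which leaves $d-E(mg)$; the baseline term restores $E(mg)$, as the score has mean
  -- zero.
  have expand : ∫ x, influence P a (fun y => y) m r (observe x) * g (observe x)
        ∂(P : Measure (FullData 𝒲 ℒ))
      = ∫ x, (c₃ * (outcome x * (boolInd true (seenY x) * (boolInd a (arm x) * g (observe x))))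
        + (-c₃ * ((r (shortTerm x, baseline x) - m (baseline x)) *
            (boolInd true (seenY x) * (boolInd a (arm x) * g (observe x))))
        + (-c₃ * (m (baseline x) * (boolInd true (seenY x) * (boolInd a (arm x) * g (observe x))))
        + (c₂ * ((r (shortTerm x, baseline x) - m (baseline x)) *
            (boolInd true (seenL x) * (boolInd a (arm x) * g (observe x))))
        + (m (baseline x) * g (observe x) + -ψ * g (observe x))))))
        ∂(P : Measure (FullData 𝒲 ℒ)) := by
    refine integral_congr_ae ?_
    filter_upwards [influence_observe (u := fun y => y) (m := m) (r := r) (a := a) hP] with x hx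
    rw [hx]
    ring
  have k₁ := iMG.add (iG.const_mul (-ψ))
  have k₂ := (iL.const_mul c₂).add k₁
  have k₃ := (iM.const_mul (-c₃)).add k₂
  have k₄ := (iR.const_mul (-c₃)).add k₃
  simp only [Pi.add_def] at k₁ k₂ k₃ k₄
  rw [expand, integral_add (iY.const_mul _) k₄, integral_add (iR.const_mul _) k₃,
    integral_add (iM.const_mul _) k₂, integral_add (iL.const_mul _) k₁,
    integral_add iMG (iG.const_mul _)]
  simp only [integral_const_mul]
  rw [h.integral_score, E1, E3, armMean, ← hψ]
  have E2' := (eq_div_iff hpl.ne').2 E2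
  rw [E2', hc₃, hc₂]
  field_simp
  ring

/-- Cauchy–Schwarz for the inner product of influence function and score: no submodel has a
Cramér–Rao bound above $E(D^2)$. -/
theorem sq_deriv_div_le (h : IsRegularSubmodel ρ P Pt g) (hP : InModel ρ P)
    (ha : 0 < armProb P a) (hpy : 0 < probY P) (hr : IsRegression P a (fun y => y) m r) {d : ℝ}
    (hd : HasDerivAt (fun t => armMean (Pt t) a) d 0) :
    d ^ 2 / ∫ o, g o ^ 2 ∂(obsLaw P : Measure (ObsData 𝒲 ℒ))
      ≤ ∫ o, influence P a (fun y => y) m r o ^ 2 ∂(obsLaw P : Measure (ObsData 𝒲 ℒ)) := by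
  rw [div_le_iff₀ h.information_pos, h.deriv_armMean_eq hP ha hpy hr hd]
  exact sq_integral_mul_le (hr.memLp_influence hP ha) h.memLp_score

end IsRegularSubmodel
end Derivative
/-! ### Linear tilts of a probability measure -/

section Tilt

/-- With $y=\sqrt{1+x}$ the error is exactly $-(y-1)^2/2$, and $(y-1)^2\le(y-1)^2(y+1)^2=x^2$. -/
theorem abs_sqrt_one_add_sub_le {x : ℝ} (hx : -1 ≤ x) : |√(1 + x) - 1 - x / 2| ≤ x ^ 2 / 2 := by
  have h0 : 0 ≤ √(1 + x) := Real.sqrt_nonneg _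
  have h1 : √(1 + x) ^ 2 = 1 + x := Real.sq_sqrt (by linarith)
  set y := √(1 + x)
  have hxy : x = y ^ 2 - 1 := by linarith
  rw [hxy, abs_le]
  constructor <;> nlinarith [sq_nonneg (y - 1), mul_nonneg h0 (sq_nonneg (y - 1)),
    mul_nonneg (mul_nonneg h0 h0) (sq_nonneg (y - 1))]

variable {α β γ : Type*} {s s' : α → ℝ} {t S : ℝ}

theorem abs_mul_le_half (hS : ∀ x, |s x| ≤ S) (ht : |t| * S ≤ 1 / 2) (x : α) :
    |t * s x| ≤ 1 / 2 := by
  rw [abs_mul]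
  exact (mul_le_mul_of_nonneg_left (hS x) (abs_nonneg t)).trans ht

theorem half_le_one_add (hS : ∀ x, |s x| ≤ S) (ht : |t| * S ≤ 1 / 2) (x : α) :
    1 / 2 ≤ 1 + t * s x := by
  have := (abs_le.1 (abs_mul_le_half hS ht x)).1
  linarith

variable [MeasurableSpace α] [MeasurableSpace β] [MeasurableSpace γ]

/-- The measure with density `1 + t * s`. -/
noncomputable def tilt (Q : Measure α) (s : α → ℝ) (t : ℝ) : Measure α :=
  Q.withDensity fun x => ENNReal.ofReal (1 + t * s x)

variable {Q : Measure α}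

theorem tilt_zero : tilt Q s 0 = Q := by simp [tilt]

theorem tilt_le (hS : ∀ x, |s x| ≤ S) (ht : |t| * S ≤ 1 / 2) :
    tilt Q s t ≤ (2 : ℝ≥0∞) • Q := by
  rw [← withDensity_const]
  refine withDensity_mono (ae_of_all _ fun x => ?_)
  have := (abs_le.1 (abs_mul_le_half hS ht x)).2
  refine (ENNReal.ofReal_le_ofReal (by linarith : 1 + t * s x ≤ 2)).trans (by simp)

theorem integral_tilt (hs : Measurable s) (hS : ∀ x, |s x| ≤ S) (ht : |t| * S ≤ 1 / 2)
    (F : α → ℝ) : ∫ x, F x ∂(tilt Q s t) = ∫ x, (1 + t * s x) * F x ∂Q := by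
  rw [tilt, integral_withDensity_eq_integral_toReal_smul (by fun_prop)
    (ae_of_all _ fun x => ENNReal.ofReal_lt_top)]
  congr 1 with x
  rw [ENNReal.toReal_ofReal (by linarith [half_le_one_add hS ht x]), smul_eq_mul]

theorem map_tilt_comp {φ : α → β} (hφ : Measurable φ) {g : β → ℝ} (hg : Measurable g) :
    (tilt Q (fun x => g (φ x)) t).map φ = tilt (Q.map φ) g t := by
  ext R hR
  rw [Measure.map_apply hφ hR, tilt, tilt, withDensity_apply _ (hφ hR), withDensity_apply _ hR,
    setLIntegral_map hR (by fun_prop) hφ]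

/-- Tilting by a function of `Z` preserves the independence of `X` and `Z`, and the law of `X`. -/
theorem indepFun_tilt {X : α → β} {Z : α → γ} (hX : Measurable X) (hZ : Measurable Z)
    (hXZ : IndepFun X Z Q) {f : γ → ℝ} (hf : Measurable f)
    [hp : IsProbabilityMeasure (tilt Q (fun x => f (Z x)) t)] :
    IndepFun X Z (tilt Q (fun x => f (Z x)) t) ∧
      ∀ R, MeasurableSet R → tilt Q (fun x => f (Z x)) t (X ⁻¹' R) = Q (X ⁻¹' R) := by
  have key : ∀ R B, MeasurableSet R → MeasurableSet B →
      tilt Q (fun x => f (Z x)) t (X ⁻¹' R ∩ Z ⁻¹' B)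
        = Q (X ⁻¹' R) * tilt Q (fun x => f (Z x)) t (Z ⁻¹' B) := by
    intro R B hR hB
    have h1 : ∫⁻ x, R.indicator 1 (X x) ∂Q = Q (X ⁻¹' R) := by
      rw [← lintegral_indicator_one (hX hR)]; rfl
    have hi : Measurable (R.indicator (1 : β → ℝ≥0∞)) := measurable_one.indicator hR
    have hj : Measurable (B.indicator fun z => ENNReal.ofReal (1 + t * f z)) :=
      Measurable.indicator (by fun_prop) hB
    have h2 := lintegral_mul_eq_lintegral_mul_lintegral_of_indepFun (hi.comp hX) (hj.comp hZ)
      (hXZ.comp hi hj)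
    simp only [Pi.mul_apply, Function.comp_apply] at h2
    rw [h1] at h2
    rw [tilt, withDensity_apply _ ((hX hR).inter (hZ hB)), withDensity_apply _ (hZ hB),
      ← lintegral_indicator ((hX hR).inter (hZ hB)), ← lintegral_indicator (hZ hB)]
    refine Eq.trans ?_ h2
    congr 1 with x
    by_cases hx : X x ∈ R <;> by_cases hz : Z x ∈ B <;> simp [hx, hz]
  have hlaw : ∀ R, MeasurableSet R →
      tilt Q (fun x => f (Z x)) t (X ⁻¹' R) = Q (X ⁻¹' R) := by
    intro R hR
    -- With the whole space for `B` the second factor is the total mass, which is one.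
    simpa using key R Set.univ hR MeasurableSet.univ
  refine ⟨?_, hlaw⟩
  rw [indepFun_iff_measure_inter_preimage_eq_mul]
  intro R B hR hB
  rw [key R B hR hB, hlaw R hR]

variable [IsProbabilityMeasure Q]

theorem integrable_of_abs_le (hs : Measurable s) (hS : ∀ x, |s x| ≤ S) : Integrable s Q :=
  Integrable.of_bound hs.aestronglyMeasurable S (ae_of_all _ hS)

theorem tilt_apply (hs : Measurable s) (hS : ∀ x, |s x| ≤ S) (ht : |t| * S ≤ 1 / 2) {R : Set α}
    (hR : MeasurableSet R) : tilt Q s t R = ENNReal.ofReal (Q.real R + t * ∫ x in R, s x ∂Q) := by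
  have hi := (integrable_of_abs_le (Q := Q) hs hS).integrableOn (s := R)
  have hi1 : IntegrableOn (fun x => 1 + t * s x) R Q :=
    (integrable_const (1 : ℝ)).integrableOn.add (hi.const_mul t)
  rw [tilt, withDensity_apply _ hR, ← ofReal_integral_eq_lintegral_ofReal hi1
    (ae_of_all _ fun x => le_trans (by norm_num) (half_le_one_add hS ht x)),
    integral_add (integrable_const (1 : ℝ)).integrableOn (hi.const_mul t), integral_const_mul]
  simp

theorem isProbabilityMeasure_tilt (hs : Measurable s) (hS : ∀ x, |s x| ≤ S)
    (ht : |t| * S ≤ 1 / 2) (h0 : ∫ x, s x ∂Q = 0) : IsProbabilityMeasure (tilt Q s t) :=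
  ⟨by rw [tilt_apply hs hS ht MeasurableSet.univ]; simp [h0]⟩

/-- The image of a tilt under `φ` depends on `s` only through its conditional expectation given `φ`,
and the hypothesis says that `s` and `s'` have the same one. -/
theorem map_tilt_eq {φ : α → β} (hφ : Measurable φ) (hs : Measurable s) (hS : ∀ x, |s x| ≤ S)
    (hs' : Measurable s') (hS' : ∀ x, |s' x| ≤ S) (ht : |t| * S ≤ 1 / 2)
    (h : ∀ R, MeasurableSet R → ∫ x, (φ ⁻¹' R).indicator (fun x => s x - s' x) x ∂Q = 0) :
    (tilt Q s t).map φ = (tilt Q s' t).map φ := by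
  ext R hR
  have hφR := hφ hR
  rw [Measure.map_apply hφ hR, Measure.map_apply hφ hR, tilt_apply hs hS ht hφR,
    tilt_apply hs' hS' ht hφR]
  have := h R hR
  rw [integral_indicator hφR, integral_sub (integrable_of_abs_le hs hS).integrableOn
    (integrable_of_abs_le hs' hS').integrableOn, sub_eq_zero] at this
  rw [this]

end Tilt
-- The full-data score and its conditional expectations
section Path

variable {𝒲 ℒ : Type*} [MeasurableSpace 𝒲] [MeasurableSpace ℒ]

/-- The full-data score whose conditional expectation given the observed data is the efficient
influence function. -/
noncomputable def fullScore (P : ProbabilityMeasure (FullData 𝒲 ℒ)) (a : Bool) (u : ℝ → ℝ)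
    (m : 𝒲 → ℝ) (r : ℒ × 𝒲 → ℝ) (z : 𝒲 × Bool × ℒ × ℝ) : ℝ :=
  (armProb P a * probY P)⁻¹ * (boolInd a z.2.1 * (u z.2.2.2 - r (z.2.2.1, z.1)))
    + (armProb P a * probL P)⁻¹ * (boolInd a z.2.1 * (r (z.2.2.1, z.1) - m z.1))
    + (m z.1 - ∫ x, u (outcome x) ∂(armLaw P a))

/-- The uncensored data of a participant. -/
def uncensored (x : FullData 𝒲 ℒ) : 𝒲 × Bool × ℒ × ℝ :=
  (baseline x, arm x, shortTerm x, outcome x)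

theorem measurable_uncensored : Measurable (uncensored (𝒲 := 𝒲) (ℒ := ℒ)) := by
  unfold uncensored; fun_prop

theorem fullScore_uncensored (P : ProbabilityMeasure (FullData 𝒲 ℒ)) (a : Bool) (u : ℝ → ℝ)
    (m : 𝒲 → ℝ) (r : ℒ × 𝒲 → ℝ) (x : FullData 𝒲 ℒ) : fullScore P a u m r (uncensored x)
      = (armProb P a * probY P)⁻¹ *
          (boolInd a (arm x) * (u (outcome x) - r (shortTerm x, baseline x)))
        + (armProb P a * probL P)⁻¹ *
          (boolInd a (arm x) * (r (shortTerm x, baseline x) - m (baseline x)))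
        + (m (baseline x) - ∫ x, u (outcome x) ∂(armLaw P a)) := rfl

/-- A bound of the scores in terms of a bound of the regression functions. -/
noncomputable def scoreBound (P : ProbabilityMeasure (FullData 𝒲 ℒ)) (a : Bool) (K : ℝ) : ℝ :=
  (armProb P a * probY P)⁻¹ * (2 * K) + (armProb P a * probL P)⁻¹ * (2 * K) + 2 * K

variable {P : ProbabilityMeasure (FullData 𝒲 ℒ)} {a : Bool} {u : ℝ → ℝ} {m : 𝒲 → ℝ}
  {r : ℒ × 𝒲 → ℝ} {ρ : ℝ} {K t : ℝ}

theorem abs_boolInd_mul_sub_le {b : Bool} {x y : ℝ} (hx : |x| ≤ K) (hy : |y| ≤ K) :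
    |boolInd a b * (x - y)| ≤ 2 * K := by
  rw [abs_mul]
  refine (mul_le_of_le_one_left (abs_nonneg _) (abs_boolInd_le _ _)).trans ?_
  exact (abs_sub _ _).trans (by linarith)

theorem abs_add_scores_le {x y z : ℝ} (ha : 0 < armProb P a) (hpy : 0 < probY P)
    (hpl : 0 < probL P) (hx : |x| ≤ 2 * K) (hy : |y| ≤ 2 * K) (hz : |z| ≤ 2 * K) :
    |(armProb P a * probY P)⁻¹ * x + (armProb P a * probL P)⁻¹ * y + z| ≤ scoreBound P a K := by
  refine (abs_add_le _ _).trans (add_le_add ((abs_add_le _ _).trans (add_le_add ?_ ?_)) hz)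
  · rw [abs_mul, abs_of_pos (by positivity : 0 < (armProb P a * probY P)⁻¹)]
    gcongr
  · rw [abs_mul, abs_of_pos (by positivity : 0 < (armProb P a * probL P)⁻¹)]
    gcongr

theorem abs_mean_le (ha : 0 < armProb P a) (hu : ∀ y, |u y| ≤ K) :
    |∫ x, u (outcome x) ∂(armLaw P a)| ≤ K := by
  have := isProbabilityMeasure_armLaw ha
  simpa using norm_integral_le_of_norm_le_const (μ := armLaw P a)
    (f := fun x => u (outcome x)) (C := K) (ae_of_all _ fun x => hu _)

theorem abs_fullScore_le (ha : 0 < armProb P a) (hpy : 0 < probY P) (hpl : 0 < probL P)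
    (hu : ∀ y, |u y| ≤ K) (hm : ∀ w, |m w| ≤ K) (hr : ∀ z, |r z| ≤ K) (z : 𝒲 × Bool × ℒ × ℝ) :
    |fullScore P a u m r z| ≤ scoreBound P a K := by
  refine abs_add_scores_le ha hpy hpl (abs_boolInd_mul_sub_le (hu _) (hr _))
    (abs_boolInd_mul_sub_le (hr _) (hm _)) ?_
  exact (abs_sub _ _).trans (by linarith [hm z.1, abs_mean_le (P := P) ha hu])

theorem abs_influence_le (ha : 0 < armProb P a) (hpy : 0 < probY P) (hpl : 0 < probL P)
    (hu : ∀ y, |u y| ≤ K) (hm : ∀ w, |m w| ≤ K) (hr : ∀ z, |r z| ≤ K) (o : ObsData 𝒲 ℒ) :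
    |influence P a u m r o| ≤ scoreBound P a K := by
  have hK : 0 ≤ K := (abs_nonneg _).trans (hu 0)
  have h0 : |(0 : ℝ)| ≤ K := by simpa
  obtain ⟨w, b, l, y⟩ := o
  refine abs_add_scores_le ha hpy hpl (abs_boolInd_mul_sub_le ?_ ?_)
    (abs_boolInd_mul_sub_le ?_ ?_) ?_
  · rcases y with y | y <;> simp [obsY, hu, hK]
  · rcases y with y | y <;> rcases l with l | l <;> simp [obsY, obsLW, hr, hK]
  · rcases l with l | l <;> simp [obsLW, hr, hK]
  · rcases l with l | l <;> simp [obsLW, hm, hK]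
  · exact (abs_sub _ _).trans (by linarith [hm w, abs_mean_le (P := P) ha hu])

namespace IsRegression

theorem measurable_fullScore (h : IsRegression P a u m r) : Measurable (fullScore P a u m r) := by
  have hm := h.measurable_m
  have hr := h.measurable_r
  have hu := h.measurable_u
  unfold fullScore
  fun_prop

/-- In the arm, the residual has mean zero given $(L,W)$, and independent censoring keeps this true
given the censoring pattern as well. With `integral_censoring_regression`, its analogue for $r-m$
given $W$, it yields the conditional expectations of the full-data score. -/
theorem integral_censoring_residual (h : IsRegression P a u m r) (hP : InModel ρ P)
    (ha : 0 < armProb P a) (c : Bool × Bool → ℝ) {β : ℒ × 𝒲 → ℝ} (hβ : Measurable β)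
    (hβ1 : ∀ z, |β z| ≤ 1) :
    ∫ x, c (seenL x, seenY x) * (boolInd a (arm x) * (β (shortTerm x, baseline x) *
      (u (outcome x) - r (shortTerm x, baseline x)))) ∂(P : Measure (FullData 𝒲 ℒ)) = 0 := by
  have := isProbabilityMeasure_armLaw ha
  have hr := h.measurable_r
  have hu := h.measurable_u
  rw [hP.integral_censoring_mul ha c (F := fun w l y => β (l, w) * (u y - r (l, w)))
    (by fun_prop), h.orth_r β hβ, mul_zero, mul_zero]
  have hβm : Measurable fun x : FullData 𝒲 ℒ => β (shortTerm x, baseline x) := by fun_prop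
  exact MemLp.of_bound hβm.aestronglyMeasurable 1 (ae_of_all _ fun x => hβ1 _)

theorem integral_censoring_regression (h : IsRegression P a u m r) (hP : InModel ρ P)
    (ha : 0 < armProb P a) (c : Bool × Bool → ℝ) {β : 𝒲 → ℝ} (hβ : Measurable β)
    (hβ1 : ∀ z, |β z| ≤ 1) :
    ∫ x, c (seenL x, seenY x) * (boolInd a (arm x) * (β (baseline x) *
      (r (shortTerm x, baseline x) - m (baseline x)))) ∂(P : Measure (FullData 𝒲 ℒ)) = 0 := by
  have := isProbabilityMeasure_armLaw ha
  have hr := h.measurable_r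
  have hm := h.measurable_m
  rw [hP.integral_censoring_mul ha c (F := fun w l _ => β w * (r (l, w) - m w))
    (by fun_prop), h.orth_sub β hβ, mul_zero, mul_zero]
  have hβm : Measurable fun x : FullData 𝒲 ℒ => β (baseline x) := by fun_prop
  exact MemLp.of_bound hβm.aestronglyMeasurable 1 (ae_of_all _ fun x => hβ1 _)

theorem integrable_censoring_residual (h : IsRegression P a u m r)
    (ha : 0 < armProb P a) {c : FullData 𝒲 ℒ → ℝ} (hc : Measurable c)
    (hc1 : ∀ x, |c x| ≤ 1) :
    Integrable (fun x => c x * (boolInd a (arm x) *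
      (u (outcome x) - r (shortTerm x, baseline x)))) (P : Measure (FullData 𝒲 ℒ)) :=
  ((memLp_boolInd_arm_mul ha h.memLp_uo).integrable one_le_two).bdd_mul (c := 1)
    hc.aestronglyMeasurable (ae_of_all _ hc1)

theorem integrable_censoring_regression (h : IsRegression P a u m r)
    (ha : 0 < armProb P a) {c : FullData 𝒲 ℒ → ℝ} (hc : Measurable c)
    (hc1 : ∀ x, |c x| ≤ 1) :
    Integrable (fun x => c x * (boolInd a (arm x) *
      (r (shortTerm x, baseline x) - m (baseline x)))) (P : Measure (FullData 𝒲 ℒ)) :=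
  ((memLp_boolInd_arm_mul ha h.memLp_rm).integrable one_le_two).bdd_mul (c := 1)
    hc.aestronglyMeasurable (ae_of_all _ hc1)

end IsRegression

theorem abs_indicator_one_le {α : Type*} (R : Set α) (x : α) :
    |R.indicator (1 : α → ℝ) x| ≤ 1 := by
  by_cases h : x ∈ R <;> simp [h]

theorem abs_mul_le_one {x y : ℝ} (hx : |x| ≤ 1) (hy : |y| ≤ 1) : |x * y| ≤ 1 := by
  rw [abs_mul]
  exact mul_le_one₀ hx (abs_nonneg _) hy

namespace IsRegression

/-- This expresses $E(s\mid A,W)=m(W)-\psi$ through integrals over events. Outside arm `a` equality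
is immediate; inside it, `β` is the section of `R` at `a`, and both residuals are orthogonal to
functions of $W$. -/
theorem integral_indicator_fullScore_sub (h : IsRegression P a u m r) (hP : InModel ρ P)
    (ha : 0 < armProb P a) {R : Set (Bool × 𝒲)} (hR : MeasurableSet R) :
    ∫ x, ((fun x => (arm x, baseline x)) ⁻¹' R).indicator (fun x =>
      fullScore P a u m r (uncensored x) - (m (baseline x) - ∫ x, u (outcome x) ∂(armLaw P a))) x
      ∂(P : Measure (FullData 𝒲 ℒ)) = 0 := by
  set β : 𝒲 → ℝ := fun w => R.indicator 1 (a, w) with hβ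
  have hi : Measurable (R.indicator (1 : Bool × 𝒲 → ℝ)) := measurable_one.indicator hR
  have hβm : Measurable β := hi.comp (by fun_prop)
  have hβ1 : ∀ w, |β w| ≤ 1 := fun w => abs_indicator_one_le R _
  have e3 := h.integral_censoring_residual hP ha (fun _ => 1) (β := fun z => β z.2)
    (by fun_prop) fun z => hβ1 _
  have e2 := h.integral_censoring_regression hP ha (fun _ => 1) hβm hβ1
  have i3 := h.integrable_censoring_residual (P := P) ha (c := fun x => β (baseline x))
    (by fun_prop) fun x => hβ1 _
  have i2 := h.integrable_censoring_regression (P := P) ha (c := fun x => β (baseline x))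
    (by fun_prop) fun x => hβ1 _
  have key := integral_add (i3.const_mul (armProb P a * probY P)⁻¹)
    (i2.const_mul (armProb P a * probL P)⁻¹)
  rw [integral_const_mul, integral_const_mul] at key
  have e3' : ∫ x, β (baseline x) * (boolInd a (arm x) * (u (outcome x) - r (shortTerm x,
      baseline x))) ∂(P : Measure (FullData 𝒲 ℒ)) = 0 := by
    rw [← e3]; congr 1 with x; ring
  have e2' : ∫ x, β (baseline x) * (boolInd a (arm x) * (r (shortTerm x, baseline x) -
      m (baseline x))) ∂(P : Measure (FullData 𝒲 ℒ)) = 0 := by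
    rw [← e2]; congr 1 with x; ring
  rw [e3', e2', mul_zero, mul_zero, add_zero] at key
  rw [← key]
  congr 1 with x
  by_cases hA : arm x = a
  · by_cases hx : (a, baseline x) ∈ R
    · rw [Set.indicator_of_mem (by simpa [hA] using hx)]
      simp only [fullScore_uncensored, hβ, hx, Set.indicator_of_mem, Pi.one_apply]
      ring
    · rw [Set.indicator_of_notMem (by simpa [hA] using hx)]
      simp [hβ, hx]
  · have hb : boolInd a (arm x) = 0 := by simp [boolInd, hA]
    simp [fullScore_uncensored, hb]

/-- This expresses $E(s\mid O)=D$ through integrals over events. The two functions agree if $Y$ is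
seen or the arm is not `a`. If only $L$ is seen they differ by a multiple of $Y-r$ (with $u(Y)$ for
$Y$), and if nothing is seen by a combination of $Y-r$ and $r-m$, all centred given what is
observed. Seeing $Y$ without $L$ has probability zero. -/
theorem integral_indicator_fullScore_sub_influence (h : IsRegression P a u m r)
    (hP : InModel ρ P) (ha : 0 < armProb P a) {R : Set (ObsData 𝒲 ℒ)} (hR : MeasurableSet R) :
    ∫ x, (observe ⁻¹' R).indicator (fun x =>
      fullScore P a u m r (uncensored x) - influence P a u m r (observe x)) x
      ∂(P : Measure (FullData 𝒲 ℒ)) = 0 := by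
  have hi : Measurable (R.indicator (1 : ObsData 𝒲 ℒ → ℝ)) := measurable_one.indicator hR
  -- `β₁` and `β₂` are the indicator of `R` at the observations possible in arm `a` when only the
  -- short-term outcome is seen, and when neither outcome is seen.
  set β₁ : ℒ × 𝒲 → ℝ := fun z => R.indicator 1 (z.2, a, Sum.inl z.1, Sum.inr ()) with hβ₁
  set β₂ : 𝒲 → ℝ := fun w => R.indicator 1 (w, a, Sum.inr (), Sum.inr ()) with hβ₂
  have hm₁ : Measurable β₁ := hi.comp (measurable_snd.prodMk (measurable_const.prodMk
    ((measurable_inl.comp measurable_fst).prodMk measurable_const)))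
  have hm₂ : Measurable β₂ := hi.comp (measurable_id.prodMk measurable_const)
  have b₁ : ∀ z, |β₁ z| ≤ 1 := fun z => abs_indicator_one_le R _
  have b₂ : ∀ z, |β₂ z| ≤ 1 := fun z => abs_indicator_one_le R _
  have e₁ := h.integral_censoring_residual hP ha
    (fun c => boolInd true c.1 * boolInd false c.2) hm₁ b₁
  have e₂ := h.integral_censoring_residual hP ha
    (fun c => boolInd false c.1 * boolInd false c.2) (β := fun z => β₂ z.2) (by fun_prop)
    fun z => b₂ _
  have e₃ := h.integral_censoring_regression hP ha (fun c => boolInd false c.1) hm₂ b₂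
  have i₁ := h.integrable_censoring_residual (P := P) ha
    (c := fun x => boolInd true (seenL x) * boolInd false (seenY x) * β₁ (shortTerm x, baseline x))
    (by fun_prop) fun x => abs_mul_le_one (abs_mul_le_one (abs_boolInd_le _ _)
      (abs_boolInd_le _ _)) (b₁ _)
  have i₂ := h.integrable_censoring_residual (P := P) ha
    (c := fun x => boolInd false (seenL x) * boolInd false (seenY x) * β₂ (baseline x))
    (by fun_prop) fun x => abs_mul_le_one (abs_mul_le_one (abs_boolInd_le _ _)
      (abs_boolInd_le _ _)) (b₂ _)
  have i₃ := h.integrable_censoring_regression (P := P) ha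
    (c := fun x => boolInd false (seenL x) * β₂ (baseline x))
    (by fun_prop) fun x => abs_mul_le_one (abs_boolInd_le _ _) (b₂ _)
  set c₃ := (armProb P a * probY P)⁻¹ with hc₃
  set c₂ := (armProb P a * probL P)⁻¹ with hc₂
  have i₂₃ := (i₂.const_mul c₃).add (i₃.const_mul c₂)
  have key := integral_add (i₁.const_mul c₃) i₂₃
  simp only [Pi.add_apply] at key
  rw [integral_add (i₂.const_mul c₃) (i₃.const_mul c₂)] at key
  simp only [integral_const_mul] at key
  have e₁' : ∫ x, boolInd true (seenL x) * boolInd false (seenY x) *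
      β₁ (shortTerm x, baseline x) * (boolInd a (arm x) * (u (outcome x) -
        r (shortTerm x, baseline x))) ∂(P : Measure (FullData 𝒲 ℒ)) = 0 := by
    rw [← e₁]; congr 1 with x; ring
  have e₂' : ∫ x, boolInd false (seenL x) * boolInd false (seenY x) * β₂ (baseline x) *
      (boolInd a (arm x) * (u (outcome x) -
        r (shortTerm x, baseline x))) ∂(P : Measure (FullData 𝒲 ℒ)) = 0 := by
    rw [← e₂]; congr 1 with x; ring
  have e₃' : ∫ x, boolInd false (seenL x) * β₂ (baseline x) *
      (boolInd a (arm x) * (r (shortTerm x, baseline x) - m (baseline x)))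
        ∂(P : Measure (FullData 𝒲 ℒ)) = 0 := by
    rw [← e₃]; congr 1 with x; ring
  rw [e₁', e₂', e₃', mul_zero, mul_zero, add_zero, add_zero] at key
  rw [← key]
  refine integral_congr_ae ?_
  filter_upwards [influence_observe (u := u) (m := m) (r := r) (a := a) hP, hP.seenY_mul_seenL]
    with x hx hYL
  have hind : (observe ⁻¹' R).indicator (fun x =>
      fullScore P a u m r (uncensored x) - influence P a u m r (observe x)) x
      = R.indicator 1 (observe x) *
        (fullScore P a u m r (uncensored x) - influence P a u m r (observe x)) := by
    by_cases hxR : observe x ∈ R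
    · rw [Set.indicator_of_mem (by exact hxR), Set.indicator_of_mem hxR, Pi.one_apply, one_mul]
    · rw [Set.indicator_of_notMem (by exact hxR), Set.indicator_of_notMem hxR, zero_mul]
  rw [hind, hx, fullScore_uncensored]
  have hTT : boolInd true true = 1 := by simp [boolInd]
  have hFF : boolInd false false = 1 := by simp [boolInd]
  have hTF : boolInd true false = 0 := by simp [boolInd]
  have hFT : boolInd false true = 0 := by simp [boolInd]
  by_cases hA : arm x = a
  · have hb : boolInd a (arm x) = 1 := by simp [boolInd, hA]
    cases hl : seenL x <;> cases hy : seenY x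
    · have ho : observe x = (baseline x, a, Sum.inr (), Sum.inr ()) := by
        simp [observe, hl, hy, hA]
      rw [ho, hb, hTF, hFF]
      simp only [hβ₂]
      ring
    · simp [hl, hy, boolInd] at hYL
    · have ho : observe x = (baseline x, a, Sum.inl (shortTerm x), Sum.inr ()) := by
        simp [observe, hl, hy, hA]
      rw [ho, hb, hTT, hFT, hTF, hFF]
      simp only [hβ₁]
      ring
    · rw [hb, hTT, hFT]
      ring
  · have hb : boolInd a (arm x) = 0 := by simp [boolInd, hA]
    rw [hb]
    ring

/-- The case of the whole space in `integral_indicator_fullScore_sub`, with $E(m)=\psi$. It gives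
the tilts total mass one. -/
theorem integral_fullScore (h : IsRegression P a u m r) (hP : InModel ρ P)
    (ha : 0 < armProb P a) :
    ∫ x, fullScore P a u m r (uncensored x) ∂(P : Measure (FullData 𝒲 ℒ)) = 0 := by
  have e := h.integral_indicator_fullScore_sub hP ha MeasurableSet.univ
  have hs : MemLp (fun x => fullScore P a u m r (uncensored x)) 2
      (P : Measure (FullData 𝒲 ℒ)) := by
    have h3 := memLp_boolInd_arm_mul ha h.memLp_uo
    have h2 := memLp_boolInd_arm_mul ha h.memLp_rm
    have h1 := (hP.memLp_baseline ha h.measurable_m h.memLp_m).sub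
      (memLp_const (∫ x, u (outcome x) ∂(armLaw P a)))
    exact ((h3.const_mul (armProb P a * probY P)⁻¹).add
      (h2.const_mul (armProb P a * probL P)⁻¹)).add h1
  have hm := hP.memLp_baseline ha h.measurable_m h.memLp_m
  simp only [Set.preimage_univ, Set.indicator_univ] at e
  have hm1 := hm.integrable one_le_two
  have i1 : Integrable (fun x => m (baseline x) - ∫ x, u (outcome x) ∂(armLaw P a))
    (P : Measure (FullData 𝒲 ℒ)) := hm1.sub (integrable_const _)
  rw [integral_sub (hs.integrable one_le_two) i1, integral_sub hm1 (integrable_const _),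
    ← hP.integral_baseline ha h.measurable_m, h.integral_m ha] at e
  simpa using e

end IsRegression
end Path
/-! ### The least favourable submodels -/

section Submodel

variable {𝒲 ℒ : Type*} [MeasurableSpace 𝒲] [MeasurableSpace ℒ]
  {P : ProbabilityMeasure (FullData 𝒲 ℒ)} {a : Bool} {u : ℝ → ℝ} {m : 𝒲 → ℝ}
  {r : ℒ × 𝒲 → ℝ} {ρ : ℝ} {K t : ℝ}

open Classical in
/-- The path of linear tilts in the direction of the full-data score. -/
noncomputable def tiltPath (P : ProbabilityMeasure (FullData 𝒲 ℒ)) (s : FullData 𝒲 ℒ → ℝ) (t : ℝ) :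
    ProbabilityMeasure (FullData 𝒲 ℒ) :=
  if h : IsProbabilityMeasure (tilt (P : Measure (FullData 𝒲 ℒ)) s t) then
    (⟨_, h⟩ : ProbabilityMeasure (FullData 𝒲 ℒ)) else P

theorem coe_tiltPath {s : FullData 𝒲 ℒ → ℝ}
    (h : IsProbabilityMeasure (tilt (P : Measure (FullData 𝒲 ℒ)) s t)) :
    (tiltPath P s t : Measure (FullData 𝒲 ℒ)) = tilt (P : Measure (FullData 𝒲 ℒ)) s t := by
  have e : tiltPath P s t = (⟨_, h⟩ : ProbabilityMeasure (FullData 𝒲 ℒ)) := dif_pos h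
  rw [e]; rfl

theorem tiltPath_zero (s : FullData 𝒲 ℒ → ℝ) : tiltPath P s 0 = P := by
  have h0 : tilt (P : Measure (FullData 𝒲 ℒ)) s 0 = P := tilt_zero
  have h : IsProbabilityMeasure (tilt (P : Measure (FullData 𝒲 ℒ)) s 0) := by
    rw [h0]; infer_instance
  exact Subtype.ext ((coe_tiltPath h).trans h0)

theorem eventually_abs_mul_le_half (S : ℝ) : ∀ᶠ t in 𝓝 (0 : ℝ), |t| * S ≤ 1 / 2 := by
  have : Tendsto (fun t : ℝ => |t| * S) (𝓝 0) (𝓝 (|0| * S)) :=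
    (continuous_abs.mul continuous_const).tendsto 0
  rw [abs_zero, zero_mul] at this
  exact this.eventually_le_const (by norm_num)

namespace IsRegression

/-- The density depends on the uncensored data alone, so censoring stays independent. The law of
$(A,W)$ is that of the tilt by $m(W)-\psi$, which leaves $A$ independent of $W$ with the same law.
Monotonicity follows from absolute continuity, and the second moment from the density being at most
2. -/
theorem inModel_tilt (h : IsRegression P a u m r) (hP : InModel ρ P) (ha : 0 < armProb P a)
    (hpy : 0 < probY P) (hu : ∀ y, |u y| ≤ K) (hm : ∀ w, |m w| ≤ K) (hr : ∀ z, |r z| ≤ K)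
    (ht : |t| * scoreBound P a K ≤ 1 / 2) {Q : ProbabilityMeasure (FullData 𝒲 ℒ)}
    (hQ : (Q : Measure (FullData 𝒲 ℒ)) = tilt (P : Measure (FullData 𝒲 ℒ))
      (fun x => fullScore P a u m r (uncensored x)) t) : InModel ρ Q := by
  have hpl : 0 < probL P := hpy.trans_le hP.probY_le_probL
  have hsm := h.measurable_fullScore
  have hmm := h.measurable_m
  have hsx : Measurable fun x : FullData 𝒲 ℒ => fullScore P a u m r (uncensored x) :=
    hsm.comp measurable_uncensored
  have hS : ∀ x : FullData 𝒲 ℒ, |fullScore P a u m r (uncensored x)| ≤ scoreBound P a K :=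
    fun x => abs_fullScore_le ha hpy hpl hu hm hr _
  have hprob : IsProbabilityMeasure (tilt (P : Measure (FullData 𝒲 ℒ))
      (fun x => fullScore P a u m r (uncensored x)) t) := hQ ▸ inferInstance
  set ψ := ∫ x, u (outcome x) ∂(armLaw P a) with hψ
  have hK : 0 ≤ K := (abs_nonneg _).trans (hu 0)
  have hS' : ∀ x : FullData 𝒲 ℒ, |m (baseline x) - ψ| ≤ scoreBound P a K := fun x => by
    have h1 : |m (baseline x) - ψ| ≤ 2 * K :=
      (abs_sub _ _).trans (by linarith [hm (baseline x), abs_mean_le (P := P) ha hu])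
    refine h1.trans ?_
    unfold scoreBound
    have : 0 ≤ (armProb P a * probY P)⁻¹ * (2 * K) + (armProb P a * probL P)⁻¹ * (2 * K) := by
      positivity
    linarith
  have hbm : Measurable fun x : FullData 𝒲 ℒ => m (baseline x) - ψ := by fun_prop
  have hAW : Measurable fun x : FullData 𝒲 ℒ => (arm x, baseline x) := by fun_prop
  have hmap := map_tilt_eq (Q := (P : Measure (FullData 𝒲 ℒ))) hAW hsx hS hbm hS' ht
    fun R hR => h.integral_indicator_fullScore_sub hP ha hR
  have hmean : ∫ x, (m (baseline x) - ψ) ∂(P : Measure (FullData 𝒲 ℒ)) = 0 := by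
    rw [integral_sub ((hP.memLp_baseline ha hmm h.memLp_m).integrable one_le_two)
      (integrable_const _), ← hP.integral_baseline ha hmm, h.integral_m ha]
    simp [hψ]
  have hprob' := isProbabilityMeasure_tilt (Q := (P : Measure (FullData 𝒲 ℒ))) hbm hS' ht hmean
  have hbase := indepFun_tilt (t := t) measurable_arm measurable_baseline
    hP.randomization_indep (f := fun w => m w - ψ) (by fun_prop) (hp := hprob')
  have hcens := indepFun_tilt (t := t) (X := fun x : FullData 𝒲 ℒ => (seenL x, seenY x))
    (by fun_prop) measurable_uncensored hP.independent_censoring hsm (hp := hprob)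
  have hmapapply : ∀ R : Set (Bool × 𝒲), MeasurableSet R →
      tilt (P : Measure (FullData 𝒲 ℒ)) (fun x => fullScore P a u m r (uncensored x)) t
        ((fun x => (arm x, baseline x)) ⁻¹' R)
      = tilt (P : Measure (FullData 𝒲 ℒ)) (fun x => m (baseline x) - ψ) t
        ((fun x => (arm x, baseline x)) ⁻¹' R) := fun R hR => by
    rw [← Measure.map_apply hAW hR, ← Measure.map_apply hAW hR, hmap]
  refine ⟨?_, ?_, ?_, ?_, ?_⟩
  · rw [hQ, indepFun_iff_measure_inter_preimage_eq_mul]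
    intro R B hR hB
    have e1 := hmapapply (R ×ˢ B) (hR.prod hB)
    have e2 := hmapapply (R ×ˢ Set.univ) (hR.prod MeasurableSet.univ)
    have e3 := hmapapply (Set.univ ×ˢ B) (MeasurableSet.univ.prod hB)
    simp only [Set.mk_preimage_prod, Set.preimage_univ, Set.inter_univ, Set.univ_inter] at e1 e2 e3
    rw [e1, e2, e3]
    exact (indepFun_iff_measure_inter_preimage_eq_mul.1 hbase.1) R B hR hB
  · have e2 := hmapapply ({true} ×ˢ Set.univ)
      ((measurableSet_singleton _).prod MeasurableSet.univ)
    simp only [Set.mk_preimage_prod, Set.preimage_univ, Set.inter_univ] at e2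
    rw [measureReal_def, hQ]
    change (tilt (P : Measure (FullData 𝒲 ℒ)) (fun x => fullScore P a u m r (uncensored x)) t
      ((fun x => arm x) ⁻¹' {true})).toReal = ρ
    rw [e2, hbase.2 {true} (measurableSet_singleton _)]
    exact hP.randomization_prob
  · rw [hQ]; exact hcens.1
  · rw [hQ]
    exact (withDensity_absolutelyContinuous _ _).ae_le hP.monotone_censoring
  · rw [hQ]
    exact hP.memLp_outcome.of_measure_le_smul (c := 2) (by simp) (tilt_le hS ht)

theorem obsLaw_tilt (h : IsRegression P a u m r) (hP : InModel ρ P) (ha : 0 < armProb P a)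
    (hpy : 0 < probY P) (hu : ∀ y, |u y| ≤ K) (hm : ∀ w, |m w| ≤ K) (hr : ∀ z, |r z| ≤ K)
    (ht : |t| * scoreBound P a K ≤ 1 / 2) {Q : ProbabilityMeasure (FullData 𝒲 ℒ)}
    (hQ : (Q : Measure (FullData 𝒲 ℒ)) = tilt (P : Measure (FullData 𝒲 ℒ))
      (fun x => fullScore P a u m r (uncensored x)) t) :
    (obsLaw Q : Measure (ObsData 𝒲 ℒ))
      = tilt (obsLaw P : Measure (ObsData 𝒲 ℒ)) (influence P a u m r) t := by
  have hpl : 0 < probL P := hpy.trans_le hP.probY_le_probL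
  have hIm := h.measurable_influence
  have e1 : (obsLaw Q : Measure (ObsData 𝒲 ℒ)) = (Q : Measure (FullData 𝒲 ℒ)).map observe := rfl
  have e2 : (obsLaw P : Measure (ObsData 𝒲 ℒ)) = (P : Measure (FullData 𝒲 ℒ)).map observe := rfl
  rw [e1, e2, hQ, ← map_tilt_comp measurable_observe hIm]
  exact map_tilt_eq measurable_observe (h.measurable_fullScore.comp measurable_uncensored)
    (fun x => abs_fullScore_le ha hpy hpl hu hm hr _) (hIm.comp measurable_observe)
    (fun x => abs_influence_le ha hpy hpl hu hm hr _) ht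
    fun R hR => h.integral_indicator_fullScore_sub_influence hP ha hR

end IsRegression

/-- With the observed-data law at `P` as dominating measure, the root densities are $\sqrt{1+tg}$
and $1$. By the expansion of the square root the error is at most $|t|S^2/2$ uniformly. -/
theorem tendsto_lintegral_rootDensity_tilt {g : ObsData 𝒲 ℒ → ℝ} {S : ℝ}
    {Pt : ℝ → ProbabilityMeasure (FullData 𝒲 ℒ)} (hg : Measurable g) (hS : ∀ o, |g o| ≤ S)
    (h : ∀ᶠ t in 𝓝 (0 : ℝ), (obsLaw (Pt t) : Measure (ObsData 𝒲 ℒ))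
      = tilt (obsLaw P : Measure (ObsData 𝒲 ℒ)) g t) :
    Tendsto (fun t : ℝ => ∫⁻ o, ENNReal.ofReal
        (((rootDensity (Pt t) (obsLaw P) o - rootDensity P (obsLaw P) o) / t
          - 1 / 2 * g o * rootDensity P (obsLaw P) o) ^ 2) ∂(obsLaw P : Measure (ObsData 𝒲 ℒ)))
      (𝓝[≠] (0 : ℝ)) (𝓝 0) := by
  set μ : Measure (ObsData 𝒲 ℒ) := (obsLaw P : Measure (ObsData 𝒲 ℒ)) with hμ
  have h1 : ∀ᵐ o ∂μ, rootDensity P μ o = 1 := by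
    filter_upwards [Measure.rnDeriv_self μ] with o ho
    rw [rootDensity, ← hμ, ho]
    simp
  have hlim : Tendsto (fun t : ℝ => ENNReal.ofReal ((t * S ^ 2 / 2) ^ 2)) (𝓝[≠] (0 : ℝ))
      (𝓝 0) := by
    have : Tendsto (fun t : ℝ => ENNReal.ofReal ((t * S ^ 2 / 2) ^ 2)) (𝓝 (0 : ℝ))
        (𝓝 (ENNReal.ofReal ((0 * S ^ 2 / 2) ^ 2))) :=
      (ENNReal.continuous_ofReal.comp (by fun_prop)).tendsto 0
    simp only [zero_mul, zero_div, ne_eq, OfNat.ofNat_ne_zero, not_false_eq_true, zero_pow,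
      ENNReal.ofReal_zero] at this
    exact this.mono_left nhdsWithin_le_nhds
  refine tendsto_of_tendsto_of_tendsto_of_le_of_le' tendsto_const_nhds hlim
    (Eventually.of_forall fun t => zero_le) ?_
  filter_upwards [h.filter_mono nhdsWithin_le_nhds,
    (eventually_abs_mul_le_half S).filter_mono nhdsWithin_le_nhds, self_mem_nhdsWithin]
    with t ht htS ht0
  have ht0' : t ≠ 0 := ht0
  have hd : ∀ᵐ o ∂μ, rootDensity (Pt t) μ o = √(1 + t * g o) := by
    have := Measure.rnDeriv_withDensity μ (f := fun o => ENNReal.ofReal (1 + t * g o))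
      (by fun_prop)
    filter_upwards [this] with o ho
    rw [rootDensity, ht, tilt, ho,
      ENNReal.toReal_ofReal (by linarith [half_le_one_add hS htS o])]
  have hle : ∫⁻ o, ENNReal.ofReal (((rootDensity (Pt t) μ o - rootDensity P μ o) / t
      - 1 / 2 * g o * rootDensity P μ o) ^ 2) ∂μ
      ≤ ∫⁻ _, ENNReal.ofReal ((t * S ^ 2 / 2) ^ 2) ∂μ := by
    refine lintegral_mono_ae ?_
    filter_upwards [h1, hd] with o ho1 ho2
    rw [ho1, ho2]
    refine ENNReal.ofReal_le_ofReal (sq_le_sq.2 ?_)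
    have e := abs_sqrt_one_add_sub_le (x := t * g o) (by linarith [half_le_one_add hS htS o])
    have e2 : (√(1 + t * g o) - 1) / t - 1 / 2 * g o * 1
        = (√(1 + t * g o) - 1 - t * g o / 2) / t := by field_simp
    rw [e2, abs_div, div_le_iff₀ (abs_pos.2 ht0')]
    refine e.trans ?_
    rw [abs_div, abs_mul, abs_of_nonneg (sq_nonneg S), abs_of_pos (by norm_num : (0 : ℝ) < 2)]
    have hgS : g o ^ 2 ≤ S ^ 2 := sq_le_sq' (abs_le.1 (hS o)).1 (abs_le.1 (hS o)).2
    have ht2 : |t| * |t| = t ^ 2 := by rw [← pow_two, sq_abs]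
    have := mul_le_mul_of_nonneg_left hgS (sq_nonneg t)
    calc (t * g o) ^ 2 / 2 = t ^ 2 * g o ^ 2 / 2 := by ring
      _ ≤ t ^ 2 * S ^ 2 / 2 := by linarith
      _ = |t| * S ^ 2 / 2 * |t| := by rw [← ht2]; ring
  simpa using hle

theorem IsRegression.isRegularSubmodel_tiltPath (h : IsRegression P a u m r) (hP : InModel ρ P)
    (ha : 0 < armProb P a)
    (hpy : 0 < probY P) (hu : ∀ y, |u y| ≤ K) (hm : ∀ w, |m w| ≤ K) (hr : ∀ z, |r z| ≤ K)
    (hpos : 0 < ∫ o, influence P a u m r o ^ 2 ∂(obsLaw P : Measure (ObsData 𝒲 ℒ))) :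
    IsRegularSubmodel ρ P (tiltPath P fun x => fullScore P a u m r (uncensored x))
        (influence P a u m r) ∧
      ∃ d, HasDerivAt
        (fun t => armMean (tiltPath P (fun x => fullScore P a u m r (uncensored x)) t) a) d 0 := by
  have hpl : 0 < probL P := hpy.trans_le hP.probY_le_probL
  have hsx : Measurable fun x : FullData 𝒲 ℒ => fullScore P a u m r (uncensored x) :=
    h.measurable_fullScore.comp measurable_uncensored
  have hS : ∀ x : FullData 𝒲 ℒ, |fullScore P a u m r (uncensored x)| ≤ scoreBound P a K :=
    fun x => abs_fullScore_le ha hpy hpl hu hm hr _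
  have hev := eventually_abs_mul_le_half (scoreBound P a K)
  have hcoe : ∀ t, |t| * scoreBound P a K ≤ 1 / 2 →
      (tiltPath P (fun x => fullScore P a u m r (uncensored x)) t : Measure (FullData 𝒲 ℒ))
        = tilt (P : Measure (FullData 𝒲 ℒ)) (fun x => fullScore P a u m r (uncensored x)) t :=
    fun t ht => coe_tiltPath (isProbabilityMeasure_tilt hsx hS ht (h.integral_fullScore hP ha))
  have hmodel : ∀ t, |t| * scoreBound P a K ≤ 1 / 2 →
      InModel ρ (tiltPath P (fun x => fullScore P a u m r (uncensored x)) t) :=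
    fun t ht => h.inModel_tilt hP ha hpy hu hm hr ht (hcoe t ht)
  have hobs : ∀ t, |t| * scoreBound P a K ≤ 1 / 2 →
      (obsLaw (tiltPath P (fun x => fullScore P a u m r (uncensored x)) t) :
        Measure (ObsData 𝒲 ℒ))
        = tilt (obsLaw P : Measure (ObsData 𝒲 ℒ)) (influence P a u m r) t :=
    fun t ht => h.obsLaw_tilt hP ha hpy hu hm hr ht (hcoe t ht)
  constructor
  · refine ⟨tiltPath_zero _, hev.mono hmodel, ?_, h.memLp_influence hP ha, hpos, ?_⟩
    · have hfin : ∫⁻ x, ENNReal.ofReal (outcome x ^ 2) ∂(P : Measure (FullData 𝒲 ℒ)) ≠ ∞ :=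
        hP.memLp_outcome.integrable_sq.lintegral_lt_top.ne
      refine ⟨(2 * ∫⁻ x, ENNReal.ofReal (outcome x ^ 2)
        ∂(P : Measure (FullData 𝒲 ℒ))).toNNReal, hev.mono fun t ht => ?_⟩
      rw [ENNReal.coe_toNNReal (ENNReal.mul_ne_top (by simp) hfin), hcoe t ht, ← smul_eq_mul,
        ← lintegral_smul_measure]
      exact lintegral_mono' (tilt_le hS ht) le_rfl
    · refine ⟨obsLaw P, inferInstance, hev.mono fun t ht => ?_,
        tendsto_lintegral_rootDensity_tilt h.measurable_influence
          (abs_influence_le ha hpy hpl hu hm hr) (hev.mono hobs)⟩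
      rw [hobs t ht]
      exact withDensity_absolutelyContinuous _ _
  · set s : FullData 𝒲 ℒ → ℝ := fun x => fullScore P a u m r (uncensored x) with hs
    refine ⟨(armProb P a)⁻¹ * ∫ x, s x * (boolInd a (arm x) * outcome x)
      ∂(P : Measure (FullData 𝒲 ℒ)), ?_⟩
    have hY := (memLp_boolInd_mul measurable_arm a hP.memLp_outcome).integrable one_le_two
    have hsY : Integrable (fun x => s x * (boolInd a (arm x) * outcome x))
        (P : Measure (FullData 𝒲 ℒ)) :=
      hY.bdd_mul (c := scoreBound P a K) hsx.aestronglyMeasurable (ae_of_all _ hS)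
    -- Near `0` the arm mean is affine in `t`, as $p_a$ is fixed and the tilt is linear in `t`. Only
    -- existence of the derivative matters here; `deriv_armMean_eq` identifies it as an inner
    -- product.
    have hlin : HasDerivAt (fun t : ℝ => (armProb P a)⁻¹ *
        ((∫ x, boolInd a (arm x) * outcome x ∂(P : Measure (FullData 𝒲 ℒ)))
          + t * ∫ x, s x * (boolInd a (arm x) * outcome x) ∂(P : Measure (FullData 𝒲 ℒ))))
        ((armProb P a)⁻¹ * (1 * ∫ x, s x * (boolInd a (arm x) * outcome x)
          ∂(P : Measure (FullData 𝒲 ℒ)))) 0 :=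
      (((hasDerivAt_id (0 : ℝ)).mul_const _).const_add _).const_mul _
    rw [one_mul] at hlin
    refine hlin.congr_of_eventuallyEq ?_
    filter_upwards [hev] with t ht
    have hta : armProb (tiltPath P s t) a = armProb P a := by
      rw [(hmodel t ht).armProb_eq, hP.armProb_eq]
    have e := integral_boolInd_arm_mul (P := tiltPath P s t) (a := a) (hta ▸ ha) outcome
    rw [hta, hcoe t ht, integral_tilt hsx hS ht] at e
    rw [armMean, ← inv_mul_cancel_left₀ ha.ne' (∫ x, outcome x ∂(armLaw (tiltPath P s t) a)), ← e,
      ← integral_const_mul t, ← integral_add hY (hsY.const_mul t)]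
    congr 2 with x
    ring

end Submodel
/-! ### The semiparametric lower bound -/

section Bound

variable {𝒲 ℒ : Type*} [MeasurableSpace 𝒲] [MeasurableSpace ℒ]
  {P : ProbabilityMeasure (FullData 𝒲 ℒ)} {a : Bool} {u : ℝ → ℝ} {m n : 𝒲 → ℝ}
  {r q : ℒ × 𝒲 → ℝ} {ρ : ℝ}

/-- Each of the three second moments is at most $\mathrm{Var}_a(u(Y))\le E_a\{u(Y)^2\}$. The
resulting $L^2$ continuity in `u` turns the convergence of clipped outcomes into that of influence
functions. -/
theorem IsRegression.integral_influence_sq_le (h : IsRegression P a u m r) (hP : InModel ρ P)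
    (ha : 0 < armProb P a) (hpy : 0 < probY P) :
    ∫ o, influence P a u m r o ^ 2 ∂(obsLaw P : Measure (ObsData 𝒲 ℒ))
      ≤ ((armProb P a * probY P)⁻¹ + (armProb P a * probL P)⁻¹ + 1)
        * ∫ x, u (outcome x) ^ 2 ∂(armLaw P a) := by
  have := isProbabilityMeasure_armLaw ha
  have hpl : 0 < probL P := hpy.trans_le hP.probY_le_probL
  have hle : ∫ x, (u (outcome x) - ∫ x, u (outcome x) ∂(armLaw P a)) ^ 2 ∂(armLaw P a)
      ≤ ∫ x, u (outcome x) ^ 2 ∂(armLaw P a) := by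
    have hv := variance_le_expectation_sq (μ := armLaw P a) h.memLp_u.aestronglyMeasurable
    rw [variance_eq_integral h.memLp_u.aemeasurable] at hv
    exact hv
  rw [h.integral_sq_sub_mean ha] at hle
  rw [h.integral_influence_sq hP ha hpy]
  have h3 : 0 ≤ ∫ x, (u (outcome x) - r (shortTerm x, baseline x)) ^ 2 ∂(armLaw P a) :=
    integral_nonneg fun x => sq_nonneg _
  have h2 : 0 ≤ ∫ x, (r (shortTerm x, baseline x) - m (baseline x)) ^ 2 ∂(armLaw P a) :=
    integral_nonneg fun x => sq_nonneg _
  have h1 : 0 ≤ ∫ x, (m (baseline x) - ∫ x, u (outcome x) ∂(armLaw P a)) ^ 2 ∂(armLaw P a) :=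
    integral_nonneg fun x => sq_nonneg _
  have c3 : 0 < (armProb P a * probY P)⁻¹ := by positivity
  have c2 : 0 < (armProb P a * probL P)⁻¹ := by positivity
  rw [add_mul, add_mul, one_mul]
  refine add_le_add (add_le_add ?_ ?_) ?_
  · exact mul_le_mul_of_nonneg_left (by linarith) c3.le
  · exact mul_le_mul_of_nonneg_left (by linarith) c2.le
  · linarith

/-- The Cramér–Rao bound of the least favourable submodel of a bounded regression. -/
theorem IsRegression.ofReal_le_varianceBound (h : IsRegression P a u m r) (hP : InModel ρ P)
    (ha : 0 < armProb P a) (hpy : 0 < probY P) (hY : IsRegression P a (fun y => y) n q) {K : ℝ}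
    (hu : ∀ y, |u y| ≤ K) (hm : ∀ w, |m w| ≤ K) (hr : ∀ z, |r z| ≤ K)
    (hpos : 0 < ∫ o, influence P a u m r o ^ 2 ∂(obsLaw P : Measure (ObsData 𝒲 ℒ))) :
    ENNReal.ofReal ((∫ o, influence P a (fun y => y) n q o * influence P a u m r o
        ∂(obsLaw P : Measure (ObsData 𝒲 ℒ))) ^ 2
        / ∫ o, influence P a u m r o ^ 2 ∂(obsLaw P : Measure (ObsData 𝒲 ℒ)))
      ≤ varianceBound ρ P a := by
  obtain ⟨hsub, d, hd⟩ := h.isRegularSubmodel_tiltPath hP ha hpy hu hm hr hpos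
  rw [← hsub.deriv_armMean_eq hP ha hpy hY hd]
  exact le_iSup_of_le _ (le_iSup_of_le _ (le_iSup_of_le d (le_iSup_of_le hsub
    (le_iSup_of_le hd le_rfl))))

theorem tendsto_integral_sub_clip_sq (ha : 0 < armProb P a)
    (hY : MemLp (fun x => outcome x) 2 (armLaw P a)) :
    Tendsto (fun k : ℕ => ∫ x, (outcome x - clip k (outcome x)) ^ 2 ∂(armLaw P a)) atTop
      (𝓝 0) := by
  have := isProbabilityMeasure_armLaw ha
  have : Tendsto (fun k : ℕ => ∫ x, (outcome x - clip k (outcome x)) ^ 2 ∂(armLaw P a)) atTop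
      (𝓝 (∫ _, (0 : ℝ) ∂(armLaw P a))) := by
    refine tendsto_integral_of_dominated_convergence (fun x => 4 * outcome x ^ 2) ?_
      (hY.integrable_sq.const_mul 4) ?_ ?_
    · exact fun k => ((measurable_outcome.sub
        ((measurable_clip k).comp measurable_outcome)).pow_const 2).aestronglyMeasurable
    · refine fun k => ae_of_all _ fun x => ?_
      rw [Real.norm_eq_abs, abs_of_nonneg (sq_nonneg _)]
      have h1 := abs_sub (outcome x) (clip k (outcome x))
      have h2 := abs_clip_le_abs (Nat.cast_nonneg k) (outcome x)
      calc (outcome x - clip k (outcome x)) ^ 2 = |outcome x - clip k (outcome x)| ^ 2 :=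
            (sq_abs _).symm
        _ ≤ (2 * |outcome x|) ^ 2 := by gcongr; linarith
        _ = 4 * outcome x ^ 2 := by rw [mul_pow, sq_abs]; norm_num
    · refine ae_of_all _ fun x => ?_
      have := ((tendsto_const_nhds (x := outcome x)).sub (tendsto_clip (outcome x))).pow 2
      simpa using this
  simpa using this

/-- The semiparametric lower bound is the variance of the efficient influence function. -/
theorem varianceBound_eq (hP : InModel ρ P) (ha : 0 < armProb P a) (hpy : 0 < probY P)
    (hY : IsRegression P a (fun y => y) n q)
    (hV : 0 < ∫ o, influence P a (fun y => y) n q o ^ 2 ∂(obsLaw P : Measure (ObsData 𝒲 ℒ))) :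
    varianceBound ρ P a = ENNReal.ofReal
      (∫ o, influence P a (fun y => y) n q o ^ 2 ∂(obsLaw P : Measure (ObsData 𝒲 ℒ))) := by
  refine le_antisymm ?_ ?_
  · refine iSup_le fun Pt => iSup_le fun g => iSup_le fun d => iSup_le fun h => iSup_le fun hd => ?_
    exact ENNReal.ofReal_le_ofReal (h.sq_deriv_div_le hP ha hpy hY hd)
  -- For the converse inequality `D` is approximated in $L^2$ by the influence functions `E k` of
  -- the clipped outcomes, which are bounded and thus scores of tilts.
  set D := influence P a (fun y => y) n q with hD
  have hDL : MemLp D 2 (obsLaw P : Measure (ObsData 𝒲 ℒ)) := hY.memLp_influence hP ha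
  have hex : ∀ k : ℕ, ∃ (m : 𝒲 → ℝ) (r : ℒ × 𝒲 → ℝ), IsRegression P a (clip k) m r ∧
      (∀ w, |m w| ≤ (k : ℝ)) ∧ ∀ z, |r z| ≤ (k : ℝ) := fun k => by
    have := exists_isRegression_bounded (P := P) ha (measurable_clip k) (K := (k : ℝ≥0))
      (fun y => by simpa using abs_clip_le (Nat.cast_nonneg k) y)
    simpa using this
  choose m r hreg hm hr using hex
  set E : ℕ → ObsData 𝒲 ℒ → ℝ := fun k => influence P a (clip k) (m k) (r k) with hE
  have hEL : ∀ k, MemLp (E k) 2 (obsLaw P : Measure (ObsData 𝒲 ℒ)) :=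
    fun k => (hreg k).memLp_influence hP ha
  have hΔ : Tendsto (fun k => ∫ o, (D o - E k o) ^ 2 ∂(obsLaw P : Measure (ObsData 𝒲 ℒ))) atTop
      (𝓝 0) := by
    have hlim := (tendsto_integral_sub_clip_sq ha hY.memLp_u).const_mul
      ((armProb P a * probY P)⁻¹ + (armProb P a * probL P)⁻¹ + 1)
    rw [mul_zero] at hlim
    refine squeeze_zero (fun k => integral_nonneg fun o => sq_nonneg _) (fun k => ?_) hlim
    refine le_trans (le_of_eq ?_) ((hY.sub (hreg k)).integral_influence_sq_le hP ha hpy)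
    congr 1 with o
    rw [influence_sub hY (hreg k) ha]
  have hcross : Tendsto (fun k => ∫ o, D o * (D o - E k o) ∂(obsLaw P : Measure (ObsData 𝒲 ℒ)))
      atTop (𝓝 0) := by
    have hlim := hΔ.sqrt.const_mul (√(∫ o, D o ^ 2 ∂(obsLaw P : Measure (ObsData 𝒲 ℒ))))
    rw [Real.sqrt_zero, mul_zero] at hlim
    exact squeeze_zero_norm (fun k => abs_integral_mul_le hDL (hDL.sub (hEL k))) hlim
  set V := ∫ o, D o ^ 2 ∂(obsLaw P : Measure (ObsData 𝒲 ℒ)) with hVdef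
  have iX : ∀ k, Integrable (fun o => D o * (D o - E k o))
      (obsLaw P : Measure (ObsData 𝒲 ℒ)) := fun k => hDL.integrable_mul (hDL.sub (hEL k))
  have iΔ : ∀ k, Integrable (fun o => (D o - E k o) ^ 2)
      (obsLaw P : Measure (ObsData 𝒲 ℒ)) := fun k => (hDL.sub (hEL k)).integrable_sq
  have hnum : Tendsto (fun k => ∫ o, D o * E k o ∂(obsLaw P : Measure (ObsData 𝒲 ℒ))) atTop
      (𝓝 V) := by
    have := (tendsto_const_nhds (x := V)).sub hcross
    rw [sub_zero] at this
    refine this.congr fun k => ?_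
    rw [hVdef, ← integral_sub hDL.integrable_sq (iX k)]
    congr 1 with o
    ring
  have hden : Tendsto (fun k => ∫ o, E k o ^ 2 ∂(obsLaw P : Measure (ObsData 𝒲 ℒ))) atTop
      (𝓝 V) := by
    have := ((tendsto_const_nhds (x := V)).sub (hcross.const_mul 2)).add hΔ
    rw [mul_zero, sub_zero, add_zero] at this
    refine this.congr fun k => ?_
    have i1 : Integrable (fun o => D o ^ 2 - 2 * (D o * (D o - E k o)))
      (obsLaw P : Measure (ObsData 𝒲 ℒ)) := hDL.integrable_sq.sub ((iX k).const_mul 2)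
    rw [hVdef, ← integral_const_mul, ← integral_sub hDL.integrable_sq ((iX k).const_mul 2),
      ← integral_add i1 (iΔ k)]
    congr 1 with o
    ring
  have hratio := ENNReal.tendsto_ofReal ((hnum.pow 2).div hden hV.ne')
  have hVV : V ^ 2 / V = V := by field_simp
  rw [hVV] at hratio
  refine le_of_tendsto hratio ?_
  -- A regular submodel needs positive information, which `E k` has once `k` is large.
  filter_upwards [hden.eventually_const_lt hV] with k hk
  exact (hreg k).ofReal_le_varianceBound hP ha hpy hY
    (fun y => abs_clip_le (Nat.cast_nonneg k) y) (hm k) (hr k) hk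

end Bound
/-! ### The unadjusted estimator -/

/-- Asymptotic normality of a ratio of sample means, with its value at the sample of size `n`
written on the space of infinite sequences of observations. -/
theorem tendstoInDistribution_ratio {Ω : Type*} [MeasurableSpace Ω] {κ : Measure Ω}
    [IsProbabilityMeasure κ] {N B : Ω → ℝ} (hN : Measurable N) (hB : Measurable B)
    (hN2 : MemLp N 2 κ) (hB2 : MemLp B 2 κ) {ψ : ℝ} (hψ : ∫ ω, N ω ∂κ = ψ * ∫ ω, B ω ∂κ)
    (hp : 0 < ∫ ω, B ω ∂κ) {v : ℝ≥0}
    (hv : (v : ℝ) = (∫ ω, (N ω - ψ * B ω) ^ 2 ∂κ) / (∫ ω, B ω ∂κ) ^ 2) :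
    TendstoInDistribution (fun (n : ℕ) (ω : ℕ → Ω) =>
        Real.sqrt n * ((∑ i ∈ Finset.range n, N (ω i)) / (∑ i ∈ Finset.range n, B (ω i)) - ψ))
      atTop (id : ℝ → ℝ) (fun _ => Measure.infinitePi (fun _ : ℕ => κ)) (gaussianReal 0 v) := by
  set μ := Measure.infinitePi (fun _ : ℕ => κ)
  set p := ∫ ω, B ω ∂κ with hp_def
  have mp (i : ℕ) : MeasurePreserving (fun ω : ℕ → Ω => ω i) μ κ :=
    measurePreserving_eval_infinitePi (fun _ : ℕ => κ) i
  have indep {X : Ω → ℝ} (hX : Measurable X) : iIndepFun (fun i (ω : ℕ → Ω) => X (ω i)) μ :=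
    iIndepFun_infinitePi (X := fun _ => X) fun _ => hX
  have ident {X : Ω → ℝ} (hX : Measurable X) (i : ℕ) :
      IdentDistrib (fun ω : ℕ → Ω => X (ω i)) (fun ω : ℕ → Ω => X (ω 0)) μ μ := by
    refine ⟨(hX.comp (measurable_pi_apply i)).aemeasurable,
      (hX.comp (measurable_pi_apply 0)).aemeasurable, ?_⟩
    have h (j : ℕ) : μ.map (fun ω : ℕ → Ω => X (ω j)) = κ.map X := by
      rw [← (mp j).map_eq, Measure.map_map hX (by fun_prop)]; rfl
    rw [h, h]
  have integ {X : Ω → ℝ} (hX : Measurable X) : ∫ ω, X (ω 0) ∂μ = ∫ x, X x ∂κ := by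
    rw [← (mp 0).map_eq, integral_map (measurable_pi_apply 0).aemeasurable hX.aestronglyMeasurable]
  -- The linearization: when the denominator is nonzero, the ratio minus `ψ` is the sum of the
  -- centred variables `Z` over that of `B`. The central limit theorem for `Z`, the strong law for
  -- `B` and Slutsky's lemma then give the limit.
  let Z : Ω → ℝ := fun x => N x - ψ * B x
  have hZ : Measurable Z := by fun_prop
  have hZ2 : MemLp Z 2 κ := hN2.sub (hB2.const_mul ψ)
  have hZ2' : MemLp (fun ω : ℕ → Ω => Z (ω 0)) 2 μ := hZ2.comp_measurePreserving (mp 0)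
  have hZ0 : ∫ x, Z x ∂κ = 0 := by
    simp only [Z]
    rw [integral_sub (hN2.integrable one_le_two) ((hB2.integrable one_le_two).const_mul ψ),
      integral_const_mul, hψ, sub_self]
  have hvar : Var[fun ω : ℕ → Ω => Z (ω 0); μ] = ∫ x, Z x ^ 2 ∂κ := by
    rw [variance_of_integral_eq_zero hZ2'.aestronglyMeasurable.aemeasurable (by rw [integ hZ, hZ0])]
    exact integ (X := fun x => Z x ^ 2) (by fun_prop)
  have clt := tendstoInDistribution_inv_sqrt_mul_sum_sub
    (X := fun i (ω : ℕ → Ω) => Z (ω i)) (P := μ) (Y := (id : ℝ → ℝ))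
    (P' := gaussianReal 0 (Var[fun ω : ℕ → Ω => Z (ω 0); μ]).toNNReal)
    HasLaw.id hZ2' (indep hZ) (ident hZ)
  have slln : ∀ᵐ ω ∂μ,
      Tendsto (fun n : ℕ => (∑ i ∈ Finset.range n, B (ω i)) / n) atTop (𝓝 p) := by
    have := strong_law_ae_real (fun i (ω : ℕ → Ω) => B (ω i))
      ((hB2.comp_measurePreserving (mp 0)).integrable one_le_two)
      (fun i j hij => (indep hB).indepFun hij) (ident hB)
    rwa [integ hB] at this
  have inv_tendsto : TendstoInMeasure μ
      (fun (n : ℕ) (ω : ℕ → Ω) => ((∑ i ∈ Finset.range n, B (ω i)) / n)⁻¹) atTop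
      (fun _ => p⁻¹) := by
    refine tendstoInMeasure_of_tendsto_ae (fun n => ?_) ?_
    · exact (by fun_prop : Measurable _).aestronglyMeasurable
    · filter_upwards [slln] with ω hω using hω.inv₀ hp.ne'
  have slutsky := clt.continuous_comp_prodMk_of_tendstoInMeasure_const
    (g := fun x : ℝ × ℝ => x.1 * x.2) (by fun_prop) inv_tendsto
    (fun n => (by fun_prop : Measurable _).aemeasurable)
  have lim : TendstoInDistribution (fun (n : ℕ) (ω : ℕ → Ω) =>
      Real.sqrt n * ((∑ i ∈ Finset.range n, N (ω i)) / (∑ i ∈ Finset.range n, B (ω i)) - ψ))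
      atTop (fun x : ℝ => id x * p⁻¹) (fun _ => μ)
      (gaussianReal 0 (Var[fun ω : ℕ → Ω => Z (ω 0); μ]).toNNReal) := by
    refine tendstoInDistribution_of_tendstoInMeasure_sub _ _ slutsky ?_
      (fun n => (by fun_prop : Measurable _).aemeasurable)
    refine tendstoInMeasure_of_tendsto_ae (fun n => ?_) ?_
    · simp only [Pi.sub_apply]
      exact (by fun_prop : Measurable _).sub (by fun_prop : Measurable _) |>.aestronglyMeasurable
    -- Almost surely the denominator is eventually nonzero, so the linearization is eventually exact
    -- and the conventional value of division by zero plays no role in the limit.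
    filter_upwards [slln] with ω hω
    refine tendsto_const_nhds.congr' ?_
    filter_upwards [hω.eventually_ne hp.ne', eventually_gt_atTop 0] with n hn hn0
    have hn1 : (0 : ℝ) < n := by exact_mod_cast hn0
    have hBn : ∑ i ∈ Finset.range n, B (ω i) ≠ 0 := fun h => hn (by rw [h, zero_div])
    simp only [Pi.sub_apply, Pi.zero_apply, integ hZ, hZ0, mul_zero, sub_zero, Z,
      Finset.sum_sub_distrib, ← Finset.mul_sum]
    have hs : Real.sqrt n ≠ 0 := (Real.sqrt_pos.2 hn1).ne'
    have hs2 : Real.sqrt n ^ 2 = n := Real.sq_sqrt hn1.le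
    field_simp
    rw [hs2]; ring
  have law : (gaussianReal 0 (Var[fun ω : ℕ → Ω => Z (ω 0); μ]).toNNReal).map
      (fun x : ℝ => id x * p⁻¹) = (gaussianReal 0 v).map id := by
    change Measure.map (fun x : ℝ => x * p⁻¹) _ = _
    rw [gaussianReal_map_mul_const, mul_zero, Measure.map_id]
    congr 1
    refine NNReal.eq ?_
    rw [hv, NNReal.coe_mul, Real.coe_toNNReal _ (variance_nonneg _ _), hvar, NNReal.coe_mk]
    field_simp
    rfl
  refine ⟨lim.forall_aemeasurable, aemeasurable_id, ?_⟩
  have h := lim.tendsto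
  have e : (⟨_, Measure.isProbabilityMeasure_map lim.aemeasurable_limit⟩ : ProbabilityMeasure ℝ)
      = ⟨(gaussianReal 0 v).map id, Measure.isProbabilityMeasure_map aemeasurable_id⟩ :=
    Subtype.ext law
  rwa [e] at h

theorem unadjusted_eq {𝒲 ℒ : Type*} (a : Bool) (n : ℕ) (o : Fin n → ObsData 𝒲 ℒ) :
    unadjusted a n o = (∑ i, boolInd a (o i).2.1 * obsY (fun y => y) (o i)) /
      ∑ i, boolInd a (o i).2.1 * obsY (fun _ => 1) (o i) := by
  unfold unadjusted boolInd obsY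
  simp only [ite_mul, one_mul, zero_mul]
  rfl

section Unadjusted

variable {𝒲 ℒ : Type*} [MeasurableSpace 𝒲] [MeasurableSpace ℒ]
  {P : ProbabilityMeasure (FullData 𝒲 ℒ)} {a : Bool} {ρ : ℝ}

theorem map_infinitePi_obsLaw (P : ProbabilityMeasure (FullData 𝒲 ℒ)) (n : ℕ) :
    (Measure.infinitePi (fun _ : ℕ => (obsLaw P : Measure (ObsData 𝒲 ℒ)))).map
        (fun ω (i : Fin n) => ω i) = (sampleLaw P n : Measure (Fin n → ObsData 𝒲 ℒ)) := by
  rw [Measure.map_infinitePi_infinitePi_of_inj (f := ((↑) : Fin n → ℕ)) Fin.val_injective,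
    Measure.infinitePi_eq_pi]
  rfl

theorem integral_boolInd_mul_obsY (hP : InModel ρ P) (ha : 0 < armProb P a) {u : ℝ → ℝ}
    (hu : Measurable u) :
    ∫ o, boolInd a o.2.1 * obsY u o ∂(obsLaw P : Measure (ObsData 𝒲 ℒ)) =
      probY P * (armProb P a * ∫ x, u (outcome x) ∂armLaw P a) := by
  rw [integral_obsLaw (f := fun o => boolInd a o.2.1 * obsY u o)
    (by have := measurable_obsY (𝒲 := 𝒲) (ℒ := ℒ) hu
        have := measurable_boolInd a
        exact Measurable.aestronglyMeasurable (by fun_prop))]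
  have h := hP.integral_censoring_mul ha (fun c => boolInd true c.2) (F := fun _ _ y => u y)
    (by fun_prop)
  rw [integral_boolInd_seenY] at h
  rw [← h]
  refine integral_congr_ae (.of_forall fun x => ?_)
  simp only [obsY_observe]
  simp only [observe]
  ring

/-- The delta method for the ratio with $N=1(A=a)C^YY$ and $B=1(A=a)C^Y$: the mean of $B$ is
$p_ap_y$, the second moment of $N-\psi B$ is $p_ap_y\mathrm{Var}_a(Y)$, and it is divided by
$(p_ap_y)^2$. -/
theorem hasAsymptoticVariance_unadjusted (hP : InModel ρ P) (ha : 0 < armProb P a)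
    (hpy : 0 < probY P) {v : ℝ≥0} (hv : (v : ℝ) = armVar P a outcome / (armProb P a * probY P)) :
    HasAsymptoticVariance a P (unadjusted a) v := by
  have := isProbabilityMeasure_armLaw ha
  have hb := measurable_boolInd a
  have hYm := measurable_obsY (𝒲 := 𝒲) (ℒ := ℒ) measurable_id'
  have h1m := measurable_obsY (𝒲 := 𝒲) (ℒ := ℒ) (measurable_const (a := (1 : ℝ)))
  set N : ObsData 𝒲 ℒ → ℝ := fun o => boolInd a o.2.1 * obsY (fun y => y) o with hN_def
  set B : ObsData 𝒲 ℒ → ℝ := fun o => boolInd a o.2.1 * obsY (fun _ => 1) o with hB_def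
  have hNm : Measurable N := by fun_prop
  have hBm : Measurable B := by fun_prop
  have hN2 : MemLp N 2 (obsLaw P : Measure (ObsData 𝒲 ℒ)) := by
    refine (memLp_obsLaw hNm.aestronglyMeasurable).2 ?_
    simp only [hN_def, obsY_observe]
    exact memLp_boolInd_mul measurable_arm a (memLp_boolInd_mul measurable_seenY true
      hP.memLp_outcome)
  have hB2 : MemLp B 2 (obsLaw P : Measure (ObsData 𝒲 ℒ)) := by
    refine (memLp_obsLaw hBm.aestronglyMeasurable).2 ?_
    simp only [hB_def, obsY_observe]
    exact memLp_boolInd_mul measurable_arm a (memLp_boolInd_mul measurable_seenY true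
      (memLp_const 1))
  have iN := integral_boolInd_mul_obsY hP ha measurable_id'
  have iB := integral_boolInd_mul_obsY hP ha (measurable_const (a := (1 : ℝ)))
  simp only [integral_const, probReal_univ, smul_eq_mul, mul_one] at iB
  have iZ : ∫ o, (N o - armMean P a * B o) ^ 2 ∂(obsLaw P : Measure (ObsData 𝒲 ℒ))
      = probY P * (armProb P a * armVar P a outcome) := by
    rw [armVar, variance_eq_integral measurable_outcome.aemeasurable, ← armMean, ← integral_boolInd_mul_obsY (u := fun y => (y - armMean P a) ^ 2) hP ha (by fun_prop)]
    refine integral_congr_ae (.of_forall fun o => ?_)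
    simp only [hN_def, hB_def, boolInd, obsY]
    rcases o with ⟨w, b, l, y | y⟩ <;> by_cases hba : b = a <;> simp [hba]
  have key := tendstoInDistribution_ratio (v := v) (ψ := armMean P a) hNm hBm hN2 hB2
    (by rw [iN, iB, armMean]; ring) (by rw [iB]; positivity)
    (by rw [hv, iZ, iB]; field_simp)
  have res (n : ℕ) : Measurable (fun (ω : ℕ → ObsData 𝒲 ℒ) (i : Fin n) => ω i) := by fun_prop
  have meas (n : ℕ) : Measurable fun o : Fin n → ObsData 𝒲 ℒ =>
      Real.sqrt n * (unadjusted a n o - armMean P a) := by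
    simp only [unadjusted_eq]; fun_prop
  -- Convergence in distribution involves only the laws, and the sample of size `n` has the law of
  -- the first `n` coordinates of the infinite sequence.
  refine ⟨fun n => (meas n).aemeasurable, aemeasurable_id, ?_⟩
  refine key.tendsto.congr fun n => Subtype.ext ?_
  change Measure.map _ _ = Measure.map _ _
  rw [← map_infinitePi_obsLaw P n, Measure.map_map (meas n) (res n)]
  congr 1
  funext ω
  simp only [Function.comp_apply, unadjusted_eq]
  rw [Fin.sum_univ_eq_sum_range (fun i => boolInd a (ω i).2.1 * obsY (fun y => y) (ω i)),
    Fin.sum_univ_eq_sum_range (fun i => boolInd a (ω i).2.1 * obsY (fun _ => 1) (ω i))]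

end Unadjusted

/-! ### The asymptotic relative efficiency -/

section Decomposition

variable {𝒲 ℒ : Type*} [MeasurableSpace 𝒲] [MeasurableSpace ℒ]
  {P : ProbabilityMeasure (FullData 𝒲 ℒ)} {a : Bool} {ρ : ℝ} {m : 𝒲 → ℝ} {r : ℒ × 𝒲 → ℝ}

/-- The variance under the whole population equals the one in the arm, since randomization gives $W$
the same law in both. -/
theorem IsRegression.variance_baseline (h : IsRegression P a (fun y => y) m r)
    (hP : InModel ρ P) (ha : 0 < armProb P a) :
    variance (fun x => m (baseline x)) (P : Measure (FullData 𝒲 ℒ)) =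
      ∫ x, (m (baseline x) - armMean P a) ^ 2 ∂armLaw P a := by
  have hm := h.measurable_m
  rw [variance_eq_integral (by fun_prop), ← hP.integral_baseline ha hm, h.integral_m ha,
    ← armMean]
  exact (hP.integral_baseline ha (b := fun w => (m w - armMean P a) ^ 2) (by fun_prop)).symm

theorem IsRegression.armVar_sub (h : IsRegression P a (fun y => y) m r)
    (ha : 0 < armProb P a) : armVar P a (fun x => r (shortTerm x, baseline x) - m (baseline x)) =
      ∫ x, (r (shortTerm x, baseline x) - m (baseline x)) ^ 2 ∂armLaw P a := by
  have := isProbabilityMeasure_armLaw ha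
  refine variance_of_integral_eq_zero h.memLp_rm.aestronglyMeasurable.aemeasurable ?_
  simpa using h.orth_sub (fun _ => 1) measurable_const (memLp_const 1)

theorem IsRegression.armVar_outcome (h : IsRegression P a (fun y => y) m r)
    (ha : 0 < armProb P a) :
    armVar P a outcome = ∫ x, (outcome x - r (shortTerm x, baseline x)) ^ 2 ∂armLaw P a
      + ∫ x, (r (shortTerm x, baseline x) - m (baseline x)) ^ 2 ∂armLaw P a
      + ∫ x, (m (baseline x) - armMean P a) ^ 2 ∂armLaw P a := by
  rw [armVar, variance_eq_integral measurable_outcome.aemeasurable, ← armMean]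
  exact h.integral_sq_sub_mean ha (armMean P a)

end Decomposition

end TrialARE

theorem mainTheorem4 {𝒲 ℒ : Type*} [MeasurableSpace 𝒲] [MeasurableSpace ℒ]
    (ρ : ℝ) (hρ0 : 0 < ρ) (hρ1 : ρ < 1)
    (P : ProbabilityMeasure (FullData 𝒲 ℒ)) (hP : InModel ρ P) (hpy : 0 < probY P)
    (a : Bool) (hvar : 0 < armVar P a outcome)
    (T : Estimator 𝒲 ℒ) (hT : IsEfficientRAL ρ a P T) :
    HasARE a P T (unadjusted a)
      (1 / (1 - (1 - armProb P a * probY P) * rsqW P a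
              - (1 - probY P / probL P) * rsqLW P a)) := by
  have ha := hP.armProb_pos hρ0 hρ1 a
  obtain ⟨m, r, hR, em, er⟩ :=
    exists_isRegression ha measurable_id' (memLp_armLaw ha hP.memLp_outcome)
  have hpl : 0 < probL P := hpy.trans_le hP.probY_le_probL
  have hσ := hR.armVar_outcome ha
  have h1 := hR.variance_baseline hP ha
  have h2 := hR.armVar_sub ha
  have hV := hR.integral_influence_sq hP ha hpy
  have e1 : variance (regW P a) (P : Measure (FullData 𝒲 ℒ)) =
      variance (fun x => m (baseline x)) (P : Measure (FullData 𝒲 ℒ)) := by rw [em]; rfl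
  have e2 : armVar P a (fun x => regLW P a x - regW P a x) =
      armVar P a (fun x => r (shortTerm x, baseline x) - m (baseline x)) := by
    congr 1
    funext x
    exact (congrArg₂ (· - ·) (congrFun er x) (congrFun em x)).symm
  rw [rsqW, rsqLW, e1, e2, h1, h2]
  have n1 : 0 ≤ ∫ x, (m (baseline x) - armMean P a) ^ 2 ∂armLaw P a :=
    integral_nonneg fun _ => sq_nonneg _
  have n2 : 0 ≤ ∫ x, (r (shortTerm x, baseline x) - m (baseline x)) ^ 2 ∂armLaw P a :=
    integral_nonneg fun _ => sq_nonneg _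
  have n3 : 0 ≤ ∫ x, (outcome x - r (shortTerm x, baseline x)) ^ 2 ∂armLaw P a :=
    integral_nonneg fun _ => sq_nonneg _
  change _ = _ + _ + ∫ x, (m (baseline x) - armMean P a) ^ 2 ∂armLaw P a at hV
  generalize (∫ x, (m (baseline x) - armMean P a) ^ 2 ∂armLaw P a) = T₁ at *
  generalize (∫ x, (r (shortTerm x, baseline x) - m (baseline x)) ^ 2 ∂armLaw P a) = T₂ at *
  generalize (∫ x, (outcome x - r (shortTerm x, baseline x)) ^ 2 ∂armLaw P a) = T₃ at *
  -- Both weights $(p_ap_y)^{-1}$ and $(p_ap_l)^{-1}$ are at least one, so $E(D^2)\ge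
  -- T_1+T_2+T_3=\mathrm{Var}_a(Y)>0$.
  have hVpos : 0 < ∫ o, influence P a (fun y => y) m r o ^ 2
      ∂(obsLaw P : Measure (ObsData 𝒲 ℒ)) := by
    have c3 : 1 ≤ (armProb P a * probY P)⁻¹ := (one_le_inv₀ (by positivity)).2
      (mul_le_one₀ armProb_le_one hpy.le (hP.probY_le_probL.trans probL_le_one))
    have c2 : 1 ≤ (armProb P a * probL P)⁻¹ := (one_le_inv₀ (by positivity)).2
      (mul_le_one₀ armProb_le_one hpl.le probL_le_one)
    rw [hV]
    linarith [le_mul_of_one_le_left n3 c3, le_mul_of_one_le_left n2 c2]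
  obtain ⟨-, v₁, hv₁, hv₁'⟩ := hT
  have hv₁'' : (v₁ : ℝ) = ∫ o, influence P a (fun y => y) m r o ^ 2
      ∂(obsLaw P : Measure (ObsData 𝒲 ℒ)) := by
    rw [varianceBound_eq hP ha hpy hR hVpos] at hv₁'
    rw [← ENNReal.toReal_ofReal hVpos.le, ← hv₁', ENNReal.coe_toReal]
  refine ⟨v₁, NNReal.mk (armVar P a outcome / (armProb P a * probY P)) (by positivity), hv₁,
    hasAsymptoticVariance_unadjusted hP ha hpy rfl, ?_, ?_⟩
  · rw [← NNReal.coe_ne_zero, hv₁'']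
    exact hVpos.ne'
  · rw [hv₁'', NNReal.coe_mk]
    -- After multiplication by $\mathrm{Var}_a(Y)=T_1+T_2+T_3$ both sides equal
    -- $T_3+(p_y/p_l)T_2+p_ap_yT_1$.
    have hden : 1 - (1 - armProb P a * probY P) * (T₁ / armVar P a outcome)
        - (1 - probY P / probL P) * (T₂ / armVar P a outcome)
        = (∫ o, influence P a (fun y => y) m r o ^ 2 ∂(obsLaw P : Measure (ObsData 𝒲 ℒ)))
          * (armProb P a * probY P) / armVar P a outcome := by
      rw [hV]
      field_simp
      rw [hσ]
      ring
    rw [hden]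
    field_simp
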